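/- Let $d\in\{2,3\}$ and let $\Omega\subset\mathbb R^d$ be a bounded connected open set with polygonal (polyhedral) Lipschitz boundary. Let $\gamma:H^1(\Omega)\to H^{1/2}(\partial\Omega)$ be the trace operator, where $H^{1/2}(\partial\Omega)$ is the space of traces with norm $\|g\|_{H^{1/2}(\partial\Omega)}=\min\{\|u\|_{H^1(\Omega)}:\gamma u=g\}$, let $H^{-1/2}(\partial\Omega)$ be its dual, and let $\gamma^{-1}$ be a right inverse of $\gamma$. Put $H^1_\diamond(\Omega)=\{u\in H^1(\Omega):\int_{\partial\Omega}\gamma u=0\}$, $H^1_0(\Omega)=\{u\in H^1(\Omega):\gamma u=0\}$ and $H^{1/2}_\diamond(\partial\Omega)=\{g\in H^{1/2}(\partial\Omega):\int_{\partial\Omega}g=0\}$. Let $f\in H^1(\Omega)^*$, let $H^{-1/2}_{-c_f}(\partial\Omega)$ be the set of $j\in H^{-1/2}(\partial\Omega)$ with $\langle j,1\rangle=-(f,1)$, let $\underline q,\overline q>0$ and $\mathcal Q=\{q\in L^\infty(\Omega):\underline q\le q\le\overline q\text{ a.e. in }\Omega\}$. For $q\in\mathcal Q$, $j\in H^{-1/2}(\partial\Omega)$,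 $g\in H^{1/2}(\partial\Omega)$ let $\mathcal N_qj\in H^1_\diamond(\Omega)$ be the solution of $\int_\Omega q\nabla \mathcal N_qj\cdot\nabla\varphi=\langle j,\gamma\varphi\rangle+(f,\varphi)$ for all $\varphi\in H^1_\diamond(\Omega)$, and let $\mathcal D_qg\in H^1(\Omega)$ be the solution of $\gamma\mathcal D_qg=g$, $\int_\Omega q\nabla\mathcal D_qg\cdot\nabla\psi=(f,\psi)$ for all $\psi\in H^1_0(\Omega)$. Let $(\mathcal T^h)_{0<h<1}$ be a regular and quasi-uniform family of conforming simplicial triangulations of $\overline\Omega$ of mesh size $h$ (every element $S$ contains a ball of radius $\sigma\operatorname{diam}S$ and satisfies $\tau h\le\operatorname{diam}S\le h$, with $\sigma,\tau>0$ independent of $h$ and $S$). Let $\mathcal V_1^h$ be the space of continuous functions on $\overline\Omega$ that are affine on each element, $\mathcal V^h_{1,\diamond}=\mathcal V^h_1\cap H^1_\diamond(\Omega)$ and $\mathcal V^h_{1,0}=\mathcal V^h_1\cap H^1_0(\Omega)$. By interpolation operators we mean a family of linear maps $\Pi^h_\diamond:H^1(\Omega)\to\mathcal V^h_{1,\diamond}$,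 $0<h<1$, that are the identity on $\mathcal V^h_{1,\diamond}$, map $H^1_0(\Omega)$ into $\mathcal V^h_{1,0}$, and are bounded in $H^1(\Omega)$ uniformly in $h$. Such interpolation operators exist. Fix any of them. For $j\in H^{-1/2}_{-c_f}(\partial\Omega)$ and $g\in H^{1/2}_\diamond(\partial\Omega)$ let $\mathcal N^h_qj\in\mathcal V^h_{1,\diamond}$ be the solution of the first equation above with test functions $\varphi\in\mathcal V^h_{1,\diamond}$, and let $\mathcal D^h_qg\in\mathcal V^h_{1,\diamond}$ be the solution of $\gamma\mathcal D^h_qg=\gamma(\Pi^h_\diamond\gamma^{-1}g)$, $\int_\Omega q\nabla\mathcal D^h_qg\cdot\nabla\psi=(f,\psi)$ for all $\psi\in\mathcal V^h_{1,0}$. Let $h_n\in(0,1)$, $h_n\to0$, and let $(j_{\delta_n},g_{\delta_n})\in H^{-1/2}_{-c_f}(\partial\Omega)\times H^{1/2}_\diamond(\partial\Omega)$ converge to $(j_\delta,g_\delta)$ in the norm of $H^{-1/2}(\partial\Omega)\times H^{1/2}(\partial\Omega)$. Put $$\mathcal J_\delta(q)=\int_\Omega q\,|\nabla(\mathcal N_qj_\delta-\mathcal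 D_qg_\delta)|^2,\qquad \mathcal J^{h_n}_{\delta_n}(q)=\int_\Omega q\,|\nabla(\mathcal N^{h_n}_qj_{\delta_n}-\mathcal D^{h_n}_qg_{\delta_n})|^2 .$$ Then for every $q\in\mathcal Q$, $$\lim_{n\to\infty}\mathcal J^{h_n}_{\delta_n}(q)=\mathcal J_\delta(q).$$ Furthermore, if $(q_n)\subset\mathcal Q$ converges to $q$ in $L^1(\Omega)$, then $(\mathcal N^{h_n}_{q_n}j_{\delta_n},\mathcal D^{h_n}_{q_n}g_{\delta_n})$ converges to $(\mathcal N_qj_\delta,\mathcal D_qg_\delta)$ in $H^1(\Omega)\times H^1(\Omega)$, and $$\lim_{n\to\infty}\mathcal J^{h_n}_{\delta_n}(q_n)=\mathcal J_\delta(q).$$ -/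

import Mathlib

open Set Filter Topology MeasureTheory
open scoped ContDiff

noncomputable section

namespace EIT

/-- Euclidean space `ℝ^d`. -/
abbrev Eu (d : ℕ) : Type := EuclideanSpace ℝ (Fin d)

/-- Lipschitz boundary: near each boundary point, in suitable Cartesian coordinates (with last
axis `ν`), `Ω` is the set above the graph of a Lipschitz function `ψ` of the other coordinates
(that is, `ψ` does not depend on the coordinate along `ν`). -/
def HasLipschitzBoundary {d : ℕ} (Ω : Set (Eu d)) : Prop :=
  ∀ x ∈ frontier Ω, ∃ ν : Eu d, ‖ν‖ = 1 ∧ ∃ (ψ : Eu d → ℝ) (K : NNReal), LipschitzWith K ψ ∧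
    (∀ (y : Eu d) (t : ℝ), ψ (y + t • ν) = ψ y) ∧
    ∃ U ∈ 𝓝 x, ∀ y ∈ U, (y ∈ Ω ↔ ψ y < inner ℝ ν y)

/-! ### The Sobolev space `H¹(Ω)` -/

/-- `L²(Ω)`. -/
abbrev L2 {d : ℕ} (Ω : Set (Eu d)) : Type := Lp ℝ 2 (volume.restrict Ω)

/-- `L²(Ω)^d`. -/
abbrev L2Vec {d : ℕ} (Ω : Set (Eu d)) : Type := Lp (Eu d) 2 (volume.restrict Ω)

/-- `G` is the weak gradient of `u` in `Ω`: `∫_Ω u ∂ᵢφ = - ∫_Ω Gᵢ φ` for all test functions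
`φ ∈ C_c^∞(Ω)` and all `i`. -/
def IsWeakGradient {d : ℕ} (Ω : Set (Eu d)) (u : Eu d → ℝ) (G : Eu d → Eu d) : Prop :=
  ∀ φ : Eu d → ℝ, ContDiff ℝ ∞ φ → HasCompactSupport φ → tsupport φ ⊆ Ω → ∀ i : Fin d,
    ∫ x in Ω, u x * fderiv ℝ φ x (EuclideanSpace.single i 1) = - ∫ x in Ω, G x i * φ x

theorem integrable_mul_test {d : ℕ} {Ω : Set (Eu d)} {v φ : Eu d → ℝ}
    (hv : MemLp v 2 (volume.restrict Ω)) (hφ : Continuous φ) (hc : HasCompactSupport φ) :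
    Integrable (fun x => v x * φ x) (volume.restrict Ω) :=
  MemLp.integrable_mul (p := 2) (q := 2) hv (hφ.memLp_of_hasCompactSupport hc)

theorem integrable_mul_deriv {d : ℕ} {Ω : Set (Eu d)} {v φ : Eu d → ℝ}
    (hv : MemLp v 2 (volume.restrict Ω)) (hφ : ContDiff ℝ ∞ φ) (hc : HasCompactSupport φ)
    (w : Eu d) :
    Integrable (fun x => v x * fderiv ℝ φ x w) (volume.restrict Ω) :=
  integrable_mul_test hv ((hφ.continuous_fderiv (by simp)).clm_apply continuous_const)
    (hc.fderiv_apply (𝕜 := ℝ) w)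

theorem memLp_coord {d : ℕ} {Ω : Set (Eu d)} {G : Eu d → Eu d}
    (hG : MemLp G 2 (volume.restrict Ω)) (i : Fin d) :
    MemLp (fun x => G x i) 2 (volume.restrict Ω) :=
  (EuclideanSpace.proj i : Eu d →L[ℝ] ℝ).comp_memLp' hG

/-- `H¹(Ω)`, as the space of pairs `(u, ∇u)` in the Hilbert space `L²(Ω) × L²(Ω)^d`; the inherited
norm is `‖u‖² = ∫_Ω u² + ∫_Ω |∇u|²`. -/
def H1 {d : ℕ} (Ω : Set (Eu d)) : Submodule ℝ (WithLp 2 (L2 Ω × L2Vec Ω)) where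
  carrier := {w | IsWeakGradient Ω w.fst w.snd}
  zero_mem' := by
    intro φ _ _ _ i
    have h1 : ∀ᵐ x ∂(volume.restrict Ω), (0 : L2 Ω) x = 0 := Lp.coeFn_zero _ _ _
    have h2 : ∀ᵐ x ∂(volume.restrict Ω), (0 : L2Vec Ω) x = 0 := Lp.coeFn_zero _ _ _
    have e1 : ∫ x in Ω, (0 : L2 Ω) x * fderiv ℝ φ x (EuclideanSpace.single i 1) = 0 :=
      integral_eq_zero_of_ae (h1.mono fun x hx => by
        show (0 : L2 Ω) x * _ = 0
        rw [hx, zero_mul])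
    have e2 : ∫ x in Ω, (0 : L2Vec Ω) x i * φ x = 0 :=
      integral_eq_zero_of_ae (h2.mono fun x hx => by
        show (0 : L2Vec Ω) x i * _ = 0
        rw [hx, PiLp.zero_apply, zero_mul])
    exact e1.trans ((neg_eq_zero.mpr e2).symm)
  add_mem' := by
    intro a b ha hb φ h1 h2 h3 i
    have ea : ∫ x in Ω, (a + b).fst x * fderiv ℝ φ x (EuclideanSpace.single i 1) =
        ∫ x in Ω, (a.fst x * fderiv ℝ φ x (EuclideanSpace.single i 1) +
          b.fst x * fderiv ℝ φ x (EuclideanSpace.single i 1)) :=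
      integral_congr_ae ((Lp.coeFn_add a.fst b.fst).mono fun x hx => by
        simp only [WithLp.add_fst, hx, Pi.add_apply, add_mul])
    have eb : ∫ x in Ω, (a + b).snd x i * φ x =
        ∫ x in Ω, (a.snd x i * φ x + b.snd x i * φ x) :=
      integral_congr_ae ((Lp.coeFn_add a.snd b.snd).mono fun x hx => by
        simp only [WithLp.add_snd, hx, Pi.add_apply, PiLp.add_apply, add_mul])
    rw [ea, eb, integral_add (integrable_mul_deriv (Lp.memLp _) h1 h2 _)
      (integrable_mul_deriv (Lp.memLp _) h1 h2 _),
      integral_add (integrable_mul_test (memLp_coord (Lp.memLp _) i) h1.continuous h2)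
      (integrable_mul_test (memLp_coord (Lp.memLp _) i) h1.continuous h2),
      ha φ h1 h2 h3 i, hb φ h1 h2 h3 i, neg_add]
  smul_mem' := by
    intro c a ha φ h1 h2 h3 i
    have ea : ∫ x in Ω, (c • a).fst x * fderiv ℝ φ x (EuclideanSpace.single i 1) =
        ∫ x in Ω, c * (a.fst x * fderiv ℝ φ x (EuclideanSpace.single i 1)) :=
      integral_congr_ae ((Lp.coeFn_smul c a.fst).mono fun x hx => by
        simp only [WithLp.smul_fst, hx, Pi.smul_apply, smul_eq_mul, mul_assoc])
    have eb : ∫ x in Ω, (c • a).snd x i * φ x = ∫ x in Ω, c * (a.snd x i * φ x) :=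
      integral_congr_ae ((Lp.coeFn_smul c a.snd).mono fun x hx => by
        simp only [WithLp.smul_snd, hx, Pi.smul_apply, PiLp.smul_apply, smul_eq_mul, mul_assoc])
    rw [ea, eb, integral_const_mul, integral_const_mul, ha φ h1 h2 h3 i, mul_neg]

/-- The function underlying an element of `H¹(Ω)`. -/
def fn {d : ℕ} {Ω : Set (Eu d)} (u : H1 Ω) : L2 Ω := u.1.fst

/-- The weak gradient of an element of `H¹(Ω)`. -/
def grad {d : ℕ} {Ω : Set (Eu d)} (u : H1 Ω) : L2Vec Ω := u.1.snd

/-! ### Traces and boundary spaces -/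

/-- Surface measure on `∂Ω`, i.e. the `(d-1)`-dimensional Hausdorff measure (its normalization by a
constant factor plays no role below). -/
def surfaceMeasure {d : ℕ} (Ω : Set (Eu d)) : Measure (Eu d) :=
  (Measure.hausdorffMeasure ((d : ℝ) - 1)).restrict (frontier Ω)

/-- `L²(∂Ω)`. -/
abbrev L2Bd {d : ℕ} (Ω : Set (Eu d)) : Type := Lp ℝ 2 (surfaceMeasure Ω)

/-- The pairs `(φ|_Ω, φ|_∂Ω)` in `H¹(Ω) × L²(∂Ω)`, for smooth `φ` on `ℝ^d`. -/
def smoothTraceGraph {d : ℕ} (Ω : Set (Eu d)) : Submodule ℝ (H1 Ω × L2Bd Ω) where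
  carrier := {p | ∃ φ : Eu d → ℝ, ContDiff ℝ ∞ φ ∧
    fn p.1 =ᵐ[volume.restrict Ω] φ ∧ p.2 =ᵐ[surfaceMeasure Ω] φ}
  zero_mem' := ⟨0, contDiff_const, Lp.coeFn_zero _ _ _, Lp.coeFn_zero _ _ _⟩
  add_mem' := by
    rintro a b ⟨φ, h1, h2, h3⟩ ⟨χ, k1, k2, k3⟩
    exact ⟨φ + χ, h1.add k1, (Lp.coeFn_add (fn a.1) (fn b.1)).trans (h2.add k2),
      (Lp.coeFn_add a.2 b.2).trans (h3.add k3)⟩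
  smul_mem' := by
    rintro c a ⟨φ, h1, h2, h3⟩
    exact ⟨c • φ, h1.const_smul c, (Lp.coeFn_smul c (fn a.1)).trans (h2.const_smul c),
      (Lp.coeFn_smul c a.2).trans (h3.const_smul c)⟩

/-- The graph of the Dirichlet trace operator: the closure in `H¹(Ω) × L²(∂Ω)` of the pairs
`(φ|_Ω, φ|_∂Ω)`, `φ` smooth. -/
def traceGraph {d : ℕ} (Ω : Set (Eu d)) : Submodule ℝ (H1 Ω × L2Bd Ω) :=
  (smoothTraceGraph Ω).topologicalClosure

/-- `H^{1/2}(∂Ω)`, the space of traces of `H¹(Ω)`-functions. It is a subspace of `L²(∂Ω)`; its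
own norm is `normHalf`. -/
def HHalf {d : ℕ} (Ω : Set (Eu d)) : Submodule ℝ (L2Bd Ω) :=
  (traceGraph Ω).map (LinearMap.snd ℝ (H1 Ω) (L2Bd Ω))

/-- The norm of `H^{1/2}(∂Ω)`: the smallest `H¹(Ω)`-norm of an extension. -/
def normHalf {d : ℕ} {Ω : Set (Eu d)} (g : HHalf Ω) : ℝ :=
  sInf {r | ∃ u : H1 Ω, (u, (g : L2Bd Ω)) ∈ traceGraph Ω ∧ r = ‖u‖}

/-- The trace operator `γ : H¹(Ω) → H^{1/2}(∂Ω)`. -/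
def trace {d : ℕ} {Ω : Set (Eu d)} (u : H1 Ω) : HHalf Ω :=
  Classical.epsilon fun t : HHalf Ω => (u, (t : L2Bd Ω)) ∈ traceGraph Ω

/-- `H^{-1/2}(∂Ω)`, the bounded linear functionals on `H^{1/2}(∂Ω)`. -/
def HNegHalf {d : ℕ} (Ω : Set (Eu d)) : Set (HHalf Ω →ₗ[ℝ] ℝ) :=
  {j | ∃ C : ℝ, ∀ g, |j g| ≤ C * normHalf g}

/-- The dual norm on `H^{-1/2}(∂Ω)`. -/
def normNegHalf {d : ℕ} {Ω : Set (Eu d)} (j : HHalf Ω →ₗ[ℝ] ℝ) : ℝ :=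
  sInf {C : ℝ | 0 ≤ C ∧ ∀ g, |j g| ≤ C * normHalf g}

/-- `H^{-1}(Ω)`, which here denotes the dual of `H¹(Ω)`. -/
abbrev HNegOne {d : ℕ} (Ω : Set (Eu d)) : Type := H1 Ω →L[ℝ] ℝ

/-- `H^{-1/2}_{-c_f}(∂Ω)`: the `j ∈ H^{-1/2}(∂Ω)` with `⟨j, 1⟩ = -c_f`, where `c_f = (f, 1)`. -/
def HNegHalfCompat {d : ℕ} {Ω : Set (Eu d)} (f : HNegOne Ω) : Set (HHalf Ω →ₗ[ℝ] ℝ) :=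
  {j | j ∈ HNegHalf Ω ∧
    ∀ e : H1 Ω, fn e =ᵐ[volume.restrict Ω] (fun _ => (1 : ℝ)) → j (trace e) = - f e}

/-- `H^{1/2}_⋄(∂Ω)`: the elements of `H^{1/2}(∂Ω)` with zero mean. -/
def HHalfMean0 {d : ℕ} (Ω : Set (Eu d)) : Set (HHalf Ω) :=
  {g | ∫ s, (g : L2Bd Ω) s ∂(surfaceMeasure Ω) = 0}

/-- `H¹_⋄(Ω)`: the elements of `H¹(Ω)` with zero mean on the boundary. -/
def H1Mean0 {d : ℕ} (Ω : Set (Eu d)) : Set (H1 Ω) := {u | trace u ∈ HHalfMean0 Ω}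

/-- `H¹₀(Ω)`: the elements of `H¹(Ω)` with zero trace. -/
def H1Zero {d : ℕ} (Ω : Set (Eu d)) : Set (H1 Ω) := {u | trace u = 0}

/-! ### Conductivities and the continuous problems -/

/-- The set `𝒬` of conductivities `q ∈ L^∞(Ω)` with `ql ≤ q ≤ qu` a.e. in `Ω`. -/
def Conductivities {d : ℕ} (Ω : Set (Eu d)) (ql qu : ℝ) : Set (Eu d → ℝ) :=
  {q | AEStronglyMeasurable q (volume.restrict Ω) ∧
    ∀ᵐ x ∂(volume.restrict Ω), ql ≤ q x ∧ q x ≤ qu}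

/-- `∫_Ω q ∇u · ∇v`. -/
def energy {d : ℕ} {Ω : Set (Eu d)} (q : Eu d → ℝ) (u v : H1 Ω) : ℝ :=
  ∫ x in Ω, q x * inner ℝ (grad u x) (grad v x)

/-- Weak solutions of `-∇·(q∇u) = f` in `Ω`, `q∇u·n = j` on `∂Ω`, with zero boundary mean. -/
def IsNeumannSol {d : ℕ} {Ω : Set (Eu d)} (f : HNegOne Ω) (q : Eu d → ℝ)
    (j : HHalf Ω →ₗ[ℝ] ℝ) (u : H1 Ω) : Prop :=
  u ∈ H1Mean0 Ω ∧ ∀ φ ∈ H1Mean0 Ω, energy q u φ = j (trace φ) + f φ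

/-- Weak solutions of `-∇·(q∇v) = f` in `Ω`, `v = g` on `∂Ω`. -/
def IsDirichletSol {d : ℕ} {Ω : Set (Eu d)} (f : HNegOne Ω) (q : Eu d → ℝ)
    (g : HHalf Ω) (v : H1 Ω) : Prop :=
  trace v = g ∧ ∀ ψ ∈ H1Zero Ω, energy q v ψ = f ψ

/-- The Neumann operator: `neumann f q j` is the weak solution `𝒩_q j`. -/
def neumann {d : ℕ} {Ω : Set (Eu d)} (f : HNegOne Ω) (q : Eu d → ℝ)
    (j : HHalf Ω →ₗ[ℝ] ℝ) : H1 Ω :=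
  Classical.epsilon (IsNeumannSol f q j)

/-- The Dirichlet operator: `dirichlet f q g` is the weak solution `𝒟_q g`. -/
def dirichlet {d : ℕ} {Ω : Set (Eu d)} (f : HNegOne Ω) (q : Eu d → ℝ) (g : HHalf Ω) : H1 Ω :=
  Classical.epsilon (IsDirichletSol f q g)

/-- The functional `𝒥(q) = ∫_Ω q ∇(𝒩_q j - 𝒟_q g) · ∇(𝒩_q j - 𝒟_q g)` for the data `(j, g)`. -/
def costJ {d : ℕ} {Ω : Set (Eu d)} (f : HNegOne Ω) (j : HHalf Ω →ₗ[ℝ] ℝ) (g : HHalf Ω)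
    (q : Eu d → ℝ) : ℝ :=
  energy q (neumann f q j - dirichlet f q g) (neumann f q j - dirichlet f q g)

/-! ### Triangulations and finite elements -/

/-- A (geometrically conforming) triangulation of the closure of `Ω`: a finite simplicial complex
with underlying set `closure Ω`. -/
def IsTriangulation {d : ℕ} (Ω : Set (Eu d)) (K : Geometry.SimplicialComplex ℝ (Eu d)) : Prop :=
  K.faces.Finite ∧ K.space = closure Ω

/-- The elements of a triangulation: its (closed) `d`-dimensional simplices. -/
def elements {d : ℕ} (K : Geometry.SimplicialComplex ℝ (Eu d)) : Set (Set (Eu d)) :=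
  {S | ∃ s ∈ K.faces, s.card = d + 1 ∧ S = convexHull ℝ (s : Set (Eu d))}

/-- Regularity (shape regularity) of a family of triangulations: every element `S` contains a ball
of radius at least a fixed multiple of `diam S`. -/
def IsRegularFamily {d : ℕ} (T : ℝ → Geometry.SimplicialComplex ℝ (Eu d)) : Prop :=
  ∃ σ : ℝ, 0 < σ ∧ ∀ h ∈ Ioo (0 : ℝ) 1, ∀ S ∈ elements (T h),
    ∃ x, Metric.closedBall x (σ * Metric.diam S) ⊆ S

/-- Quasi-uniformity with mesh size `h`: the diameters of all elements of `T h` are at most `h` and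
at least a fixed multiple of `h`. -/
def IsQuasiUniformFamily {d : ℕ} (T : ℝ → Geometry.SimplicialComplex ℝ (Eu d)) : Prop :=
  ∃ τ : ℝ, 0 < τ ∧ ∀ h ∈ Ioo (0 : ℝ) 1, ∀ S ∈ elements (T h),
    τ * h ≤ Metric.diam S ∧ Metric.diam S ≤ h

/-- `𝒱₁`: continuous functions on `closure Ω` that are affine on each element. -/
def V1 {d : ℕ} (Ω : Set (Eu d)) (K : Geometry.SimplicialComplex ℝ (Eu d)) : Set (H1 Ω) :=
  {u | ∃ v : Eu d → ℝ, ContinuousOn v (closure Ω) ∧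
    (∀ S ∈ elements K, ∃ A : Eu d →ᵃ[ℝ] ℝ, EqOn v A S) ∧ fn u =ᵐ[volume.restrict Ω] v}

/-- `𝒱_{1,⋄} = 𝒱₁ ∩ H¹_⋄(Ω)`. -/
def V1Mean0 {d : ℕ} (Ω : Set (Eu d)) (K : Geometry.SimplicialComplex ℝ (Eu d)) : Set (H1 Ω) :=
  V1 Ω K ∩ H1Mean0 Ω

/-- `𝒱_{1,0} = 𝒱₁ ∩ H¹₀(Ω)`. -/
def V1Zero {d : ℕ} (Ω : Set (Eu d)) (K : Geometry.SimplicialComplex ℝ (Eu d)) : Set (H1 Ω) :=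
  V1 Ω K ∩ H1Zero Ω

/-- A family of interpolation operators `Π_⋄^h : H¹(Ω) → 𝒱_{1,⋄}^h` (of modified Clément /
Scott–Zhang type): linear, the identity on `𝒱_{1,⋄}^h`, mapping `H¹₀(Ω)` into `𝒱_{1,0}^h`, and
bounded in `H¹(Ω)` uniformly in `h`. No approximation property is required. -/
structure IsInterpolation {d : ℕ} (Ω : Set (Eu d))
    (T : ℝ → Geometry.SimplicialComplex ℝ (Eu d)) (P : ℝ → H1 Ω →ₗ[ℝ] H1 Ω) : Prop where
  range : ∀ h ∈ Ioo (0 : ℝ) 1, ∀ u, P h u ∈ V1Mean0 Ω (T h)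
  proj : ∀ h ∈ Ioo (0 : ℝ) 1, ∀ u ∈ V1Mean0 Ω (T h), P h u = u
  zero : ∀ h ∈ Ioo (0 : ℝ) 1, ∀ u ∈ H1Zero Ω, P h u ∈ V1Zero Ω (T h)
  stable : ∃ C : ℝ, ∀ h ∈ Ioo (0 : ℝ) 1, ∀ u, ‖P h u‖ ≤ C * ‖u‖

/-- Solutions of the discrete Neumann problem on the triangulation `K`. -/
def IsDiscNeumannSol {d : ℕ} {Ω : Set (Eu d)} (K : Geometry.SimplicialComplex ℝ (Eu d))
    (f : HNegOne Ω) (q : Eu d → ℝ) (j : HHalf Ω →ₗ[ℝ] ℝ) (u : H1 Ω) : Prop :=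
  u ∈ V1Mean0 Ω K ∧ ∀ φ ∈ V1Mean0 Ω K, energy q u φ = j (trace φ) + f φ

/-- Solutions of the discrete Dirichlet problem on the triangulation `K`, with interpolation
operator `P` on `K` and right inverse `E` of the trace: the boundary condition is
`γ v = γ (P (E g))`. -/
def IsDiscDirichletSol {d : ℕ} {Ω : Set (Eu d)} (K : Geometry.SimplicialComplex ℝ (Eu d))
    (P : H1 Ω →ₗ[ℝ] H1 Ω) (E : HHalf Ω → H1 Ω)
    (f : HNegOne Ω) (q : Eu d → ℝ) (g : HHalf Ω) (v : H1 Ω) : Prop :=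
  v ∈ V1Mean0 Ω K ∧ trace v = trace (P (E g)) ∧ ∀ ψ ∈ V1Zero Ω K, energy q v ψ = f ψ

/-- The discrete Neumann operator `𝒩^h_q j`. -/
def discNeumann {d : ℕ} {Ω : Set (Eu d)} (K : Geometry.SimplicialComplex ℝ (Eu d))
    (f : HNegOne Ω) (q : Eu d → ℝ) (j : HHalf Ω →ₗ[ℝ] ℝ) : H1 Ω :=
  Classical.epsilon (IsDiscNeumannSol K f q j)

/-- The discrete Dirichlet operator `𝒟^h_q g`. -/
def discDirichlet {d : ℕ} {Ω : Set (Eu d)} (K : Geometry.SimplicialComplex ℝ (Eu d))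
    (P : H1 Ω →ₗ[ℝ] H1 Ω) (E : HHalf Ω → H1 Ω)
    (f : HNegOne Ω) (q : Eu d → ℝ) (g : HHalf Ω) : H1 Ω :=
  Classical.epsilon (IsDiscDirichletSol K P E f q g)

/-- The discrete functional `𝒥^h(q)` for the data `(j, g)`. -/
def discCostJ {d : ℕ} {Ω : Set (Eu d)} (K : Geometry.SimplicialComplex ℝ (Eu d))
    (P : H1 Ω →ₗ[ℝ] H1 Ω) (E : HHalf Ω → H1 Ω) (f : HNegOne Ω)
    (j : HHalf Ω →ₗ[ℝ] ℝ) (g : HHalf Ω) (q : Eu d → ℝ) : ℝ :=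
  energy q (discNeumann K f q j - discDirichlet K P E f q g)
    (discNeumann K f q j - discDirichlet K P E f q g)

end EIT

end

noncomputable section

namespace EIT

variable {d : ℕ} {Ω : Set (Eu d)}

/-! ### Elementary properties of `H¹(Ω)` -/

/-! The convergence is an argument of Céa type. Let `u` be a continuous solution, `v n` its
interpolant and `e n` the discrete solution minus `v n`. Both variational equations may be tested
with `e n`. By coercivity and the Poincaré inequality, `‖e n‖` is bounded by the data error, the
norm of `(q_n - q) ∇u` and `‖v n - u‖` (`tendsto_zero_of_energy_eq`). The second quantity tends to
zero although `q_n → q` only in `L¹`: the `q_n` are uniformly bounded and multiply the fixed field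
`∇u`, so dominated convergence applies (`tendsto_condMul`). The third tends to zero because
uniformly bounded projections converge strongly once the spaces they project onto are asymptotically
dense (`IsInterpolation.tendsto`). Strong convergence of the solutions then passes to the energies.
In the Dirichlet problem the lifting `E` is neither linear nor bounded. This is harmless:
interpolation respects zero traces, so the discrete boundary value depends on `g_n` alone, and `E
g_n` may be replaced by `u + r n`, where `r n` is a small extension of `g_n - g`. Existence of
interpolation operators is reduced by `exists_projection` to a stable discrete extension: if `u` has
the trace of some finite element function, then it has the trace of one with norm at most `B ‖u‖`,
with `B` independent of the mesh. Such an extension is a quasi-interpolant `u'` of `u` plus a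
discrete function that corrects the boundary values and vanishes at all interior nodes. The
correction costs a factor `h⁻¹` against the squared `L²` norm of the trace of `u - u'`. The
multiplicative trace inequality `‖γw‖² ≤ K ‖w‖_{L²} ‖w‖_{H¹}` gives the factor `h` back, because `u
- u'` has size `h` in `L²`. All of this rests on the theory of `H¹` on a Lipschitz domain. Averages
shifted into the domain along interior cones give smooth approximations up to the boundary, which
define the trace and have controlled gradients at scale `h`. The Poincaré inequality comes from
chaining convex sets inside the connected domain and from the finitely many elements of a
triangulation. -/

theorem ofReal_norm_sq_eq_lintegral {α F : Type*} [MeasurableSpace α] [NormedAddCommGroup F]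
    {μ : Measure α} (f : Lp F 2 μ) :
    ENNReal.ofReal (‖f‖ ^ 2) = ∫⁻ x, ‖f x‖ₑ ^ 2 ∂μ := by
  have h := eLpNorm_nnreal_pow_eq_lintegral (μ := μ) (f := f) (p := 2) two_ne_zero
  simp only [NNReal.coe_ofNat, ENNReal.coe_ofNat, ENNReal.rpow_ofNat] at h
  rw [← h, ENNReal.ofReal_pow (norm_nonneg _), Lp.norm_def, ENNReal.ofReal_toReal (Lp.eLpNorm_ne_top f)]

theorem norm_sq_eq_toReal_lintegral {α F : Type*} [MeasurableSpace α] [NormedAddCommGroup F]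
    {μ : Measure α} (f : Lp F 2 μ) :
    ‖f‖ ^ 2 = (∫⁻ x, ‖f x‖ₑ ^ 2 ∂μ).toReal := by
  rw [← ofReal_norm_sq_eq_lintegral, ENNReal.toReal_ofReal (by positivity)]

/-- The form in which `L²` bounds are proved throughout: the estimates are made in `[0, ∞]`, where
integrability need not be checked. -/
theorem norm_sq_le_of_lintegral_le {α F : Type*} [MeasurableSpace α] [NormedAddCommGroup F]
    {μ : Measure α} {f : Lp F 2 μ} {g : α → F} (hfg : f =ᵐ[μ] g) {C : ℝ} (hC : 0 ≤ C)
    (h : ∫⁻ x, ‖g x‖ₑ ^ 2 ∂μ ≤ ENNReal.ofReal C) : ‖f‖ ^ 2 ≤ C := by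
  rw [← ENNReal.ofReal_le_ofReal_iff hC, ofReal_norm_sq_eq_lintegral]
  refine le_trans (le_of_eq (lintegral_congr_ae (hfg.mono fun x hx => ?_))) h
  simp only [hx]

/-- `u ↦ u` as a map `H¹(Ω) → L²(Ω)`. -/
def fnL (Ω : Set (Eu d)) : H1 Ω →L[ℝ] L2 Ω :=
  (WithLp.fstL 2 ℝ (L2 Ω) (L2Vec Ω)).comp (H1 Ω).subtypeL

/-- `u ↦ ∇u` as a map `H¹(Ω) → L²(Ω)^d`. -/
def gradL (Ω : Set (Eu d)) : H1 Ω →L[ℝ] L2Vec Ω :=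
  (WithLp.sndL 2 ℝ (L2 Ω) (L2Vec Ω)).comp (H1 Ω).subtypeL

theorem fn_add (u v : H1 Ω) : fn (u + v) = fn u + fn v := rfl
theorem fn_sub (u v : H1 Ω) : fn (u - v) = fn u - fn v := rfl
theorem fn_smul (c : ℝ) (u : H1 Ω) : fn (c • u) = c • fn u := rfl
theorem grad_add (u v : H1 Ω) : grad (u + v) = grad u + grad v := rfl
theorem grad_sub (u v : H1 Ω) : grad (u - v) = grad u - grad v := rfl
theorem grad_smul (c : ℝ) (u : H1 Ω) : grad (c • u) = c • grad u := rfl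

theorem norm_sq_eq (u : H1 Ω) : ‖u‖ ^ 2 = ‖fn u‖ ^ 2 + ‖grad u‖ ^ 2 := by
  exact WithLp.prod_norm_sq_eq_of_L2 u.1

theorem norm_fn_le (u : H1 Ω) : ‖fn u‖ ≤ ‖u‖ := by
  have := norm_sq_eq u
  nlinarith [norm_nonneg (fn u), norm_nonneg u, sq_nonneg ‖grad u‖]

theorem norm_grad_le (u : H1 Ω) : ‖grad u‖ ≤ ‖u‖ := by
  have := norm_sq_eq u
  nlinarith [norm_nonneg (grad u), norm_nonneg u, sq_nonneg ‖fn u‖]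

theorem norm_le_fn_add_grad (u : H1 Ω) : ‖u‖ ≤ ‖fn u‖ + ‖grad u‖ := by
  have := norm_sq_eq u
  nlinarith [norm_nonneg (fn u), norm_nonneg (grad u), norm_nonneg u]

theorem isWeakGradient_congr {u v : Eu d → ℝ} {G H : Eu d → Eu d}
    (h1 : u =ᵐ[volume.restrict Ω] v) (h2 : G =ᵐ[volume.restrict Ω] H)
    (h : IsWeakGradient Ω u G) : IsWeakGradient Ω v H := by
  intro φ a b c i
  have := h φ a b c i
  have e1 : ∫ x in Ω, u x * fderiv ℝ φ x (EuclideanSpace.single i 1) =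
      ∫ x in Ω, v x * fderiv ℝ φ x (EuclideanSpace.single i 1) :=
    integral_congr_ae (h1.mono fun x hx => by simp only [hx])
  have e2 : ∫ x in Ω, G x i * φ x = ∫ x in Ω, H x i * φ x :=
    integral_congr_ae (h2.mono fun x hx => by simp only [hx])
  rwa [e1, e2] at this

/-- The element of `H¹(Ω)` with prescribed function and weak gradient. -/
def mkH1 {u : Eu d → ℝ} {G : Eu d → Eu d} (hu : MemLp u 2 (volume.restrict Ω))
    (hG : MemLp G 2 (volume.restrict Ω)) (h : IsWeakGradient Ω u G) : H1 Ω :=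
  ⟨WithLp.toLp 2 (hu.toLp u, hG.toLp G),
    isWeakGradient_congr hu.coeFn_toLp.symm hG.coeFn_toLp.symm h⟩

theorem fn_mkH1 {u : Eu d → ℝ} {G : Eu d → Eu d} (hu : MemLp u 2 (volume.restrict Ω))
    (hG : MemLp G 2 (volume.restrict Ω)) (h : IsWeakGradient Ω u G) :
    fn (mkH1 hu hG h) =ᵐ[volume.restrict Ω] u := hu.coeFn_toLp

theorem grad_mkH1 {u : Eu d → ℝ} {G : Eu d → Eu d} (hu : MemLp u 2 (volume.restrict Ω))
    (hG : MemLp G 2 (volume.restrict Ω)) (h : IsWeakGradient Ω u G) :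
    grad (mkH1 hu hG h) =ᵐ[volume.restrict Ω] G := hG.coeFn_toLp

theorem isWeakGradient_fn_grad (u : H1 Ω) : IsWeakGradient Ω (fn u) (grad u) := u.2

/-- Each defining identity equates two `L²` inner products with fixed functions, hence two
continuous functions of the pair. Closedness gives the completeness that Lax–Milgram needs. -/
theorem isClosed_H1 : IsClosed (H1 Ω : Set (WithLp 2 (L2 Ω × L2Vec Ω))) := by
  have key : ∀ φ : Eu d → ℝ, ContDiff ℝ ∞ φ → HasCompactSupport φ → ∀ i : Fin d,
      Continuous (fun w : WithLp 2 (L2 Ω × L2Vec Ω) =>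
        ∫ x in Ω, w.fst x * fderiv ℝ φ x (EuclideanSpace.single i 1)) ∧
      Continuous (fun w : WithLp 2 (L2 Ω × L2Vec Ω) => ∫ x in Ω, w.snd x i * φ x) := by
    intro φ h1 h2 i
    have m1 : MemLp (fun x => fderiv ℝ φ x (EuclideanSpace.single i 1)) 2 (volume.restrict Ω) :=
      ((h1.continuous_fderiv (by simp)).clm_apply continuous_const).memLp_of_hasCompactSupport
        (h2.fderiv_apply (𝕜 := ℝ) _)
    have m2 : MemLp (fun x => φ x • (EuclideanSpace.single i 1 : Eu d)) 2 (volume.restrict Ω) :=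
      (h1.continuous.smul continuous_const).memLp_of_hasCompactSupport h2.smul_right
    constructor
    · have : Continuous fun w : WithLp 2 (L2 Ω × L2Vec Ω) => inner ℝ (m1.toLp _) w.fst := by
        fun_prop
      refine this.congr fun w => ?_
      rw [L2.inner_def]
      refine integral_congr_ae (m1.coeFn_toLp.mono fun x hx => ?_)
      simp only [hx]
      rfl
    · have : Continuous fun w : WithLp 2 (L2 Ω × L2Vec Ω) => inner ℝ (m2.toLp _) w.snd := by
        fun_prop
      refine this.congr fun w => ?_
      rw [L2.inner_def]
      refine integral_congr_ae (m2.coeFn_toLp.mono fun x hx => ?_)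
      simp only [hx]
      rw [inner_smul_left, EuclideanSpace.inner_single_left]
      simp [mul_comm]
  have : (H1 Ω : Set (WithLp 2 (L2 Ω × L2Vec Ω))) = ⋂ (φ : Eu d → ℝ) (_ : ContDiff ℝ ∞ φ)
      (_ : HasCompactSupport φ) (_ : tsupport φ ⊆ Ω) (i : Fin d),
      {w | ∫ x in Ω, w.fst x * fderiv ℝ φ x (EuclideanSpace.single i 1) =
        - ∫ x in Ω, w.snd x i * φ x} := by
    ext w
    simp only [mem_iInter, mem_ofPred_eq]
    rfl
  rw [this]
  refine isClosed_iInter fun φ => isClosed_iInter fun h1 => isClosed_iInter fun h2 =>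
    isClosed_iInter fun _ => isClosed_iInter fun i => ?_
  exact isClosed_eq (key φ h1 h2 i).1 (key φ h1 h2 i).2.neg

instance : CompleteSpace (H1 Ω) := isClosed_H1.completeSpace_coe

/-- The difference of two components integrates to zero against every test function, so the
fundamental lemma of the calculus of variations applies. -/
theorem isWeakGradient_unique (hΩo : IsOpen Ω) {u : Eu d → ℝ} {G H : Eu d → Eu d}
    (hG : MemLp G 2 (volume.restrict Ω)) (hH : MemLp H 2 (volume.restrict Ω))
    (h1 : IsWeakGradient Ω u G) (h2 : IsWeakGradient Ω u H) : G =ᵐ[volume.restrict Ω] H := by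
  have key : ∀ i : Fin d, ∀ᵐ x ∂(volume.restrict Ω), G x i - H x i = 0 := by
    intro i
    rw [ae_restrict_iff' hΩo.measurableSet]
    have hm : MemLp (fun x => G x i - H x i) 2 (volume.restrict Ω) :=
      (memLp_coord hG i).sub (memLp_coord hH i)
    refine IsOpen.ae_eq_zero_of_integral_contDiff_smul_eq_zero hΩo ?_ ?_
    · rw [locallyIntegrableOn_iff hΩo.isLocallyClosed]
      intro k hk hkc
      have : IsFiniteMeasure (volume.restrict k) := ⟨by
        simpa using hkc.measure_lt_top⟩
      exact (hm.mono_measure (Measure.restrict_mono hk le_rfl)).integrable one_le_two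
    · intro φ a b c
      have e1 := h1 φ a b c i
      have e2 := h2 φ a b c i
      have i1 := integrable_mul_test (memLp_coord hG i) a.continuous b
      have i2 := integrable_mul_test (memLp_coord hH i) a.continuous b
      have : ∫ x, φ x • (G x i - H x i) = ∫ x in Ω, φ x • (G x i - H x i) := by
        rw [setIntegral_eq_integral_of_forall_compl_eq_zero]
        intro x hx
        rw [image_eq_zero_of_notMem_tsupport (fun h => hx (c h)), zero_smul]
      rw [this]
      have e3 : ∫ x in Ω, φ x • (G x i - H x i) =
          ∫ x in Ω, (G x i * φ x - H x i * φ x) := by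
        congr 1; ext x; simp only [smul_eq_mul]; ring
      rw [e3, integral_sub i1 i2]
      linarith
  filter_upwards [ae_all_iff.2 key] with x hx
  ext i
  exact sub_eq_zero.1 (hx i)

theorem H1_ext (hΩo : IsOpen Ω) {u v : H1 Ω} (h : fn u = fn v) : u = v := by
  have h2 : grad u = grad v := by
    refine Lp.ext (isWeakGradient_unique hΩo (Lp.memLp _) (Lp.memLp _)
      (isWeakGradient_fn_grad u) ?_)
    rw [h]
    exact isWeakGradient_fn_grad v
  have h3 : u.1 = v.1 := by
    apply (WithLp.ofLp_injective 2)
    exact Prod.ext h h2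
  exact Subtype.ext h3

/-! ### Locally Lipschitz functions -/

/-- The mean value inequality along a segment, with slopes instead of derivatives. The comparison
principle requires a strict inequality between slopes, hence the detour through all `L' > L`. -/
theorem norm_sub_le_of_eventually {F : Eu d → ℝ} {L : ℝ}
    (h : ∀ x, ∀ᶠ y in 𝓝 x, |F y - F x| ≤ L * ‖y - x‖) (x y : Eu d) :
    |F y - F x| ≤ L * ‖y - x‖ := by
  rcases eq_or_ne x y with rfl | hxy
  · simp
  have hn : 0 < ‖y - x‖ := norm_pos_iff.2 (sub_ne_zero.2 hxy.symm)
  have hcont : Continuous F := by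
    rw [continuous_iff_continuousAt]
    intro z
    rw [ContinuousAt, tendsto_iff_norm_sub_tendsto_zero]
    refine squeeze_zero' (Eventually.of_forall fun _ => norm_nonneg _) (h z) ?_
    have : Continuous fun w : Eu d => L * ‖w - z‖ := by fun_prop
    simpa using this.tendsto z
  have main : ∀ L' > L, |F y - F x| ≤ L' * ‖y - x‖ := by
    intro L' hL'
    have := image_norm_le_of_liminf_right_slope_norm_lt_deriv_boundary
      (f := fun t : ℝ => F (x + t • (y - x)) - F x)
      (f' := fun _ => L * ‖y - x‖) (a := 0) (b := 1)
      (B := fun t => L' * ‖y - x‖ * t) (B' := fun _ => L' * ‖y - x‖) (by fun_prop) ?_ (by simp)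
      (by fun_prop) (fun t _ => ?_) ?_
      (x := 1) (by simp)
    · simpa using this
    · intro t _ r hr
      have hT : Tendsto (fun s : ℝ => x + s • (y - x)) (𝓝 t) (𝓝 (x + t • (y - x))) :=
        (by fun_prop : Continuous fun s : ℝ => x + s • (y - x)).tendsto t
      have := (hT.eventually (h _)).filter_mono (nhdsWithin_le_nhds (s := Ioi t))
      refine Eventually.frequently ?_
      filter_upwards [this, self_mem_nhdsWithin] with s hs hts
      have hts : t < s := hts
      refine lt_of_le_of_lt ?_ hr
      rw [slope_def_field, div_le_iff₀ (sub_pos.2 hts)]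
      have e : x + s • (y - x) - (x + t • (y - x)) = (s - t) • (y - x) := by
        rw [sub_smul]; abel
      rw [e, norm_smul, Real.norm_of_nonneg (sub_pos.2 hts).le] at hs
      have h3 := abs_norm_sub_norm_le (F (x + s • (y - x)) - F x) (F (x + t • (y - x)) - F x)
      have h4 : F (x + s • (y - x)) - F x - (F (x + t • (y - x)) - F x) =
        F (x + s • (y - x)) - F (x + t • (y - x)) := by ring
      rw [h4, Real.norm_eq_abs (F (x + s • (y - x)) - F (x + t • (y - x)))] at h3
      have := le_abs_self (‖F (x + s • (y - x)) - F x‖ - ‖F (x + t • (y - x)) - F x‖)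
      simp only [Function.comp_apply] at *
      nlinarith
    · simpa using ((hasDerivAt_id t).const_mul (L' * ‖y - x‖)).hasDerivWithinAt
    · intro t _ _
      exact mul_lt_mul_of_pos_right hL' hn
  refine le_of_forall_gt_imp_ge_of_dense fun a ha => ?_
  have := main (a / ‖y - x‖) (by rwa [gt_iff_lt, lt_div_iff₀ hn])
  rwa [div_mul_cancel₀ _ hn.ne'] at this

/-- Functions which are pointwise Lipschitz in `Ω`, with a uniform constant `L`. -/
def LocLip (Ω : Set (Eu d)) (L : ℝ) (v : Eu d → ℝ) : Prop :=
  ∀ x ∈ Ω, ∀ᶠ y in 𝓝 x, |v y - v x| ≤ L * ‖y - x‖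

theorem LocLip.continuousAt {L : ℝ} {v : Eu d → ℝ} (h : LocLip Ω L v) {z : Eu d} (hz : z ∈ Ω) :
    ContinuousAt v z := by
  rw [ContinuousAt, tendsto_iff_norm_sub_tendsto_zero]
  refine squeeze_zero' (Eventually.of_forall fun _ => norm_nonneg _) (h z hz) ?_
  have : Continuous fun w : Eu d => L * ‖w - z‖ := by fun_prop
  simpa using this.tendsto z

theorem norm_gradient_le_of_eventually {L : ℝ} {v : Eu d → ℝ} {x : Eu d} (hL : 0 ≤ L)
    (h : ∀ᶠ y in 𝓝 x, |v y - v x| ≤ L * ‖y - x‖) : ‖gradient v x‖ ≤ L := by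
  rw [gradient, LinearIsometryEquiv.norm_map]
  exact norm_fderiv_le_of_lip' ℝ hL h

theorem gradient_apply (v : Eu d → ℝ) (x : Eu d) (i : Fin d) :
    gradient v x i = fderiv ℝ v x (EuclideanSpace.single i 1) := by
  have : inner ℝ (EuclideanSpace.single i (1:ℝ)) (gradient v x) = gradient v x i := by
    rw [EuclideanSpace.inner_single_left]; simp
  rw [← this, real_inner_comm, gradient, InnerProductSpace.toDual_symm_apply]

/-- After multiplication by a cutoff function equal to `1` near the support of the test function,
`v` becomes globally Lipschitz. Rademacher's theorem and integration by parts for Lipschitz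
functions then apply. -/
theorem LocLip.isWeakGradient (hΩo : IsOpen Ω) {L : ℝ} {v : Eu d → ℝ} (hL : 0 ≤ L)
    (h : LocLip Ω L v) : IsWeakGradient Ω v (gradient v) := by
  intro φ h1 h2 h3 i
  obtain ⟨χ, hχ1, hχ2, hχ3, hχ4⟩ : ∃ χ : Eu d → ℝ, ContDiff ℝ ∞ χ ∧ HasCompactSupport χ ∧
      tsupport χ ⊆ Ω ∧ ∀ x ∈ tsupport φ, χ =ᶠ[𝓝 x] 1 := by
    obtain ⟨K', hK', hK1, hK2⟩ := exists_compact_between (show IsCompact (tsupport φ) from h2) hΩo h3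
    obtain ⟨K'', hK'', hK3, hK4⟩ := exists_compact_between hK' hΩo hK2
    obtain ⟨f, hf1, hf2, hf3⟩ := exists_contMDiff_zero_iff_one_iff_of_isClosed
      (modelWithCornersSelf ℝ (Eu d)) (n := (⊤ : ℕ∞)) (s := (interior K'')ᶜ) (t := K')
      isOpen_interior.isClosed_compl hK'.isClosed
      (disjoint_compl_left_iff_subset.2 hK3)
    have hsupp : Function.support f ⊆ K'' := by
      intro x hx
      by_contra hxK
      exact hx ((hf3.1 x).1 (fun hh => hxK (interior_subset hh)))
    have hts : tsupport f ⊆ K'' := closure_minimal hsupp hK''.isClosed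
    refine ⟨f, hf1.contDiff, HasCompactSupport.of_support_subset_isCompact hK'' hsupp,
      hts.trans hK4, fun x hx => ?_⟩
    filter_upwards [isOpen_interior.mem_nhds (hK1 hx)] with y hy
    exact (hf3.2 y).1 (interior_subset hy)
  set F : Eu d → ℝ := fun x => χ x * v x with hF
  obtain ⟨B, hB⟩ := (show IsCompact (tsupport χ) from hχ2).exists_bound_of_continuousOn
    (f := v) (fun x hx => (h.continuousAt (hχ3 hx)).continuousWithinAt)
  obtain ⟨Lχ, hLχ⟩ := hχ1.lipschitzWith_of_hasCompactSupport hχ2 (by simp)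
  obtain ⟨Bχ, hBχ⟩ := hχ2.exists_bound_of_continuous hχ1.continuous
  have hBχ0 : 0 ≤ Bχ := (norm_nonneg _).trans (hBχ 0)
  -- The cutoff is Lipschitz and bounded by `Bχ`, while `v` is bounded by `|B|` only on the support
  -- of the cutoff. The product increment is therefore split so that `v` is evaluated at the point
  -- of the support.
  have hlip : ∀ x, ∀ᶠ y in 𝓝 x, |F y - F x| ≤ (Lχ * |B| + Bχ * L) * ‖y - x‖ := by
    intro x
    by_cases hx : x ∈ tsupport χ
    · filter_upwards [h x (hχ3 hx)] with y hy
      have e : F y - F x = (χ y - χ x) * v x + χ y * (v y - v x) := by simp only [hF]; ring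
      rw [e]
      refine (abs_add_le _ _).trans ?_
      rw [abs_mul, abs_mul, add_mul]
      have h5 : |χ y - χ x| ≤ Lχ * ‖y - x‖ := by
        simpa [Real.dist_eq, dist_eq_norm] using hLχ.dist_le_mul y x
      have h6 : |v x| ≤ |B| := (hB x hx).trans (le_abs_self _)
      have h7 : |χ y| ≤ Bχ := hBχ y
      gcongr ?_ + ?_
      · calc _ ≤ (Lχ * ‖y - x‖) * |B| := by gcongr
          _ = _ := by ring
      · calc _ ≤ Bχ * (L * ‖y - x‖) := by gcongr
          _ = _ := by ring
    · have : ∀ᶠ y in 𝓝 x, y ∉ tsupport χ :=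
        (isClosed_tsupport χ).isOpen_compl.mem_nhds hx
      filter_upwards [this] with y hy
      simp only [hF, image_eq_zero_of_notMem_tsupport hx, image_eq_zero_of_notMem_tsupport hy]
      simp only [zero_mul, sub_zero, abs_zero]
      positivity
  have hFL : LipschitzWith (Real.toNNReal (Lχ * |B| + Bχ * L)) F := by
    refine LipschitzWith.of_dist_le_mul fun x y => ?_
    rw [Real.coe_toNNReal _ (by positivity), Real.dist_eq, dist_eq_norm]
    exact norm_sub_le_of_eventually hlip y x
  obtain ⟨Lφ, hLφ⟩ := h1.lipschitzWith_of_hasCompactSupport h2 (by simp)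
  -- The reversed direction `-e_i` on the test function carries the minus sign of the weak gradient
  -- identity.
  have main := hFL.integral_lineDeriv_mul_eq hLφ h2 (EuclideanSpace.single i 1) (μ := volume)
  have e1 : ∫ x in Ω, v x * fderiv ℝ φ x (EuclideanSpace.single i 1) =
      - ∫ x, lineDeriv ℝ φ x (-(EuclideanSpace.single i 1)) * F x := by
    rw [← integral_neg, ← setIntegral_eq_integral_of_forall_compl_eq_zero (s := Ω)
      (f := fun x => -(lineDeriv ℝ φ x (-(EuclideanSpace.single i 1)) * F x))]
    · refine integral_congr_ae (Eventually.of_forall fun x => ?_)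
      simp only
      rw [(h1.differentiable (by simp)).differentiableAt.lineDeriv_eq_fderiv, map_neg]
      by_cases hx : x ∈ tsupport φ
      · have := (hχ4 x hx).self_of_nhds
        simp only [hF, this, Pi.one_apply]; ring
      · have : fderiv ℝ φ x = 0 := image_eq_zero_of_notMem_tsupport
          (fun hh => hx (tsupport_fderiv_subset ℝ hh))
        simp [this]
    · intro x hx
      have : fderiv ℝ φ x = 0 := image_eq_zero_of_notMem_tsupport
          (fun hh => hx (h3 (tsupport_fderiv_subset ℝ hh)))
      rw [(h1.differentiable (by simp)).differentiableAt.lineDeriv_eq_fderiv, this]; simp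
  have e2 : ∫ x in Ω, gradient v x i * φ x =
      ∫ x, lineDeriv ℝ F x (EuclideanSpace.single i 1) * φ x := by
    rw [← setIntegral_eq_integral_of_forall_compl_eq_zero (s := Ω)
      (f := fun x => lineDeriv ℝ F x (EuclideanSpace.single i 1) * φ x)]
    · refine integral_congr_ae (ae_restrict_of_ae (hFL.ae_differentiableAt.mono fun x hx => ?_))
      simp only
      by_cases hxt : x ∈ tsupport φ
      · have hFv : F =ᶠ[𝓝 x] v := by
          filter_upwards [hχ4 x hxt] with y hy
          simp [hF, hy]
        rw [hx.lineDeriv_eq_fderiv, gradient_apply, hFv.fderiv_eq]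
      · rw [image_eq_zero_of_notMem_tsupport hxt, mul_zero, mul_zero]
    · intro x hx
      rw [image_eq_zero_of_notMem_tsupport (fun hh => hx (h3 hh)), mul_zero]
  rw [e1, e2, main]

theorem measurable_gradient (v : Eu d → ℝ) : Measurable (gradient v) :=
  (InnerProductSpace.toDual ℝ (Eu d)).symm.continuous.measurable.comp (measurable_fderiv ℝ v)

theorem isFiniteMeasure_restrict (hΩb : Bornology.IsBounded Ω) :
    IsFiniteMeasure (volume.restrict Ω) := ⟨by simpa using hΩb.measure_lt_top⟩

theorem memLp_of_continuousOn (hΩo : IsOpen Ω) (hΩb : Bornology.IsBounded Ω) {v : Eu d → ℝ}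
    (hc : ContinuousOn v (closure Ω)) : MemLp v 2 (volume.restrict Ω) := by
  have := isFiniteMeasure_restrict hΩb
  obtain ⟨B, hB⟩ := hΩb.isCompact_closure.exists_bound_of_continuousOn hc
  refine MemLp.of_bound ((hc.mono subset_closure).aestronglyMeasurable hΩo.measurableSet) B ?_
  filter_upwards [ae_restrict_mem hΩo.measurableSet] with x hx
  exact hB x (subset_closure hx)

theorem LocLip.memLp_gradient (hΩo : IsOpen Ω) (hΩb : Bornology.IsBounded Ω) {L : ℝ}
    {v : Eu d → ℝ} (hL : 0 ≤ L) (h : LocLip Ω L v) :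
    MemLp (gradient v) 2 (volume.restrict Ω) := by
  have := isFiniteMeasure_restrict hΩb
  refine MemLp.of_bound (measurable_gradient v).aestronglyMeasurable L ?_
  filter_upwards [ae_restrict_mem hΩo.measurableSet] with x hx
  exact norm_gradient_le_of_eventually hL (h x hx)

/-- Existence of the element of `H¹(Ω)` given by a pointwise Lipschitz function. -/
theorem LocLip.exists_H1 (hΩo : IsOpen Ω) (hΩb : Bornology.IsBounded Ω) {L : ℝ}
    {v : Eu d → ℝ} (hL : 0 ≤ L) (h : LocLip Ω L v) (hc : ContinuousOn v (closure Ω)) :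
    ∃ u : H1 Ω, fn u =ᵐ[volume.restrict Ω] v ∧ grad u =ᵐ[volume.restrict Ω] gradient v :=
  ⟨mkH1 (memLp_of_continuousOn hΩo hΩb hc) (h.memLp_gradient hΩo hΩb hL) (h.isWeakGradient hΩo hL),
    fn_mkH1 _ _ _, grad_mkH1 _ _ _⟩

theorem locLip_of_contDiff (hΩb : Bornology.IsBounded Ω) {φ : Eu d → ℝ} (hφ : ContDiff ℝ 1 φ) :
    ∃ L, 0 ≤ L ∧ LocLip Ω L φ := by
  obtain ⟨B, hB⟩ := hΩb.isCompact_closure.exists_bound_of_continuousOn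
    (f := fderiv ℝ φ) (hφ.continuous_fderiv (by simp)).continuousOn
  -- `|B|` bounds the derivative on the compact closure, and the `1` absorbs the remainder of the
  -- first order expansion.
  refine ⟨|B| + 1, by positivity, fun x hx => ?_⟩
  have h1 := (hφ.differentiable (by simp) x).hasFDerivAt.isLittleO.bound zero_lt_one
  filter_upwards [h1] with y hy
  have h2 : |fderiv ℝ φ x (y - x)| ≤ |B| * ‖y - x‖ :=
    ((fderiv ℝ φ x).le_opNorm _).trans (by
      gcongr; exact (hB x (subset_closure hx)).trans (le_abs_self _))
  have h3 : |φ y - φ x| ≤ |φ y - φ x - fderiv ℝ φ x (y - x)| + |fderiv ℝ φ x (y - x)| := by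
    have := abs_add_le (φ y - φ x - fderiv ℝ φ x (y - x)) (fderiv ℝ φ x (y - x))
    simpa using this
  rw [Real.norm_eq_abs] at hy
  linarith

theorem exists_H1_of_contDiff (hΩo : IsOpen Ω) (hΩb : Bornology.IsBounded Ω) {φ : Eu d → ℝ}
    (hφ : ContDiff ℝ 1 φ) :
    ∃ u : H1 Ω, fn u =ᵐ[volume.restrict Ω] φ ∧ grad u =ᵐ[volume.restrict Ω] gradient φ := by
  obtain ⟨L, hL, h⟩ := locLip_of_contDiff hΩb hφ
  exact h.exists_H1 hΩo hΩb hL hφ.continuous.continuousOn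

/-- The weak gradient of an element of `H¹(Ω)` given by a pointwise Lipschitz function is its
classical gradient. -/
theorem LocLip.grad_eq (hΩo : IsOpen Ω) (hΩb : Bornology.IsBounded Ω) {L : ℝ}
    {v : Eu d → ℝ} (hL : 0 ≤ L) (h : LocLip Ω L v) {u : H1 Ω}
    (hu : fn u =ᵐ[volume.restrict Ω] v) : grad u =ᵐ[volume.restrict Ω] gradient v :=
  isWeakGradient_unique hΩo (Lp.memLp _) (h.memLp_gradient hΩo hΩb hL)
    (isWeakGradient_congr hu (ae_eq_refl _) (isWeakGradient_fn_grad u)) (h.isWeakGradient hΩo hL)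

theorem grad_eq_of_contDiff (hΩo : IsOpen Ω) (hΩb : Bornology.IsBounded Ω) {φ : Eu d → ℝ}
    (hφ : ContDiff ℝ 1 φ) {u : H1 Ω} (hu : fn u =ᵐ[volume.restrict Ω] φ) :
    grad u =ᵐ[volume.restrict Ω] gradient φ := by
  obtain ⟨L, hL, h⟩ := locLip_of_contDiff hΩb hφ
  exact h.grad_eq hΩo hΩb hL hu

/-! ### Geometry of Lipschitz domains -/

/-- Graph coordinates of `Ω` in the neighbourhood `U`. -/
structure IsGraphChart (Ω : Set (Eu d)) (ν : Eu d) (ψ : Eu d → ℝ) (K : NNReal)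
    (U : Set (Eu d)) : Prop where
  norm_eq : ‖ν‖ = 1
  lip : LipschitzWith K ψ
  inv : ∀ (y : Eu d) (t : ℝ), ψ (y + t • ν) = ψ y
  isOpen : IsOpen U
  mem_iff : ∀ y ∈ U, (y ∈ Ω ↔ ψ y < inner ℝ ν y)

theorem HasLipschitzBoundary.exists_chart (h : HasLipschitzBoundary Ω) {x : Eu d}
    (hx : x ∈ frontier Ω) : ∃ ν ψ K U, IsGraphChart Ω ν ψ K U ∧ x ∈ U := by
  obtain ⟨ν, h1, ψ, K, h2, h3, U, hU, h4⟩ := h x hx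
  exact ⟨ν, ψ, K, interior U, ⟨h1, h2, h3, isOpen_interior, fun y hy => h4 y (interior_subset hy)⟩,
    mem_interior_iff_mem_nhds.2 hU⟩

namespace IsGraphChart

variable {ν : Eu d} {ψ : Eu d → ℝ} {K : NNReal} {U : Set (Eu d)}

theorem inner_add (h : IsGraphChart Ω ν ψ K U) (y : Eu d) (t : ℝ) :
    inner ℝ ν (y + t • ν) = inner ℝ ν y + t := by
  rw [inner_add_right, inner_smul_right, real_inner_self_eq_norm_sq, h.norm_eq]; ring

theorem le_of_mem_closure (h : IsGraphChart Ω ν ψ K U) {y : Eu d} (hy : y ∈ U)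
    (hyc : y ∈ closure Ω) : ψ y ≤ inner ℝ ν y := by
  by_contra! hlt
  have ho : IsOpen {z | inner ℝ ν z < ψ z} := isOpen_lt (by fun_prop) h.lip.continuous
  obtain ⟨z, ⟨hz1, hz2⟩, hz3⟩ := mem_closure_iff.1 hyc _ (h.isOpen.inter ho) ⟨hy, hlt⟩
  exact absurd ((h.mem_iff z hz1).1 hz3) (not_lt.2 (le_of_lt hz2))

theorem mem_frontier_iff (h : IsGraphChart Ω ν ψ K U) (hΩo : IsOpen Ω) {y : Eu d} (hy : y ∈ U) :
    y ∈ frontier Ω ↔ inner ℝ ν y = ψ y := by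
  rw [hΩo.frontier_eq]
  constructor
  · rintro ⟨h1, h2⟩
    rw [h.mem_iff y hy, not_lt] at h2
    exact le_antisymm h2 (h.le_of_mem_closure hy h1)
  · intro he
    refine ⟨?_, fun hh => ?_⟩
    · have hT : Tendsto (fun t : ℝ => y + t • ν) (𝓝[>] 0) (𝓝 y) := by
        have : Tendsto (fun t : ℝ => y + t • ν) (𝓝 0) (𝓝 (y + (0 : ℝ) • ν)) :=
          (by fun_prop : Continuous fun t : ℝ => y + t • ν).tendsto 0
        rw [zero_smul, add_zero] at this
        exact this.mono_left nhdsWithin_le_nhds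
      refine mem_closure_of_tendsto hT ?_
      filter_upwards [hT.eventually (h.isOpen.mem_nhds hy), self_mem_nhdsWithin] with t ht ht0
      rw [h.mem_iff _ ht, h.inv, h.inner_add, he]
      have : (0 : ℝ) < t := ht0
      linarith
    · have := (h.mem_iff y hy).1 hh
      linarith

end IsGraphChart

/-- In a chart the domain lies on one side of the graph, so moving downwards from a boundary point
leaves the closure. This is how a triangulation, which only knows the closure, gives information on
`Ω` itself. -/
theorem interior_closure_eq (hΩo : IsOpen Ω) (hΩl : HasLipschitzBoundary Ω) :
    interior (closure Ω) = Ω := by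
  refine Subset.antisymm (fun x hx => ?_) (interior_maximal subset_closure hΩo)
  by_contra hxΩ
  have hxf : x ∈ frontier Ω := by
    rw [hΩo.frontier_eq]; exact ⟨interior_subset hx, hxΩ⟩
  obtain ⟨ν, ψ, K, U, h, hxU⟩ := hΩl.exists_chart hxf
  have hT : Tendsto (fun t : ℝ => x + t • ν) (𝓝[<] 0) (𝓝 x) := by
    have : Tendsto (fun t : ℝ => x + t • ν) (𝓝 0) (𝓝 (x + (0 : ℝ) • ν)) :=
      (by fun_prop : Continuous fun t : ℝ => x + t • ν).tendsto 0
    rw [zero_smul, add_zero] at this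
    exact this.mono_left nhdsWithin_le_nhds
  obtain ⟨t, ht1, ht2, ht3⟩ := ((hT.eventually (h.isOpen.mem_nhds hxU)).and
    ((hT.eventually (mem_interior_iff_mem_nhds.1 hx)).and self_mem_nhdsWithin)).exists
  have h1 := h.le_of_mem_closure ht1 ht2
  rw [h.inv, h.inner_add, (h.mem_frontier_iff hΩo hxU).1 hxf] at h1
  have : t < 0 := ht3
  linarith

/-- The uniform interior cone property. -/
theorem exists_cone (hΩo : IsOpen Ω) (hΩl : HasLipschitzBoundary Ω) {x : Eu d}
    (hx : x ∈ closure Ω) : ∃ (e : Eu d) (r δ : ℝ), 0 < r ∧ 0 < δ ∧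
      ∀ y ∈ Metric.ball x δ ∩ closure Ω, ∀ t ∈ Ioc (0 : ℝ) 1,
        Metric.closedBall (y + t • e) (t * r) ⊆ Ω := by
  by_cases hxΩ : x ∈ Ω
  · obtain ⟨δ, hδ, hb⟩ := Metric.isOpen_iff.1 hΩo x hxΩ
    refine ⟨0, δ / 3, δ / 3, by positivity, by positivity, ?_⟩
    rintro y ⟨hy, _⟩ t ⟨ht0, ht1⟩ z hz
    apply hb
    rw [smul_zero, add_zero, Metric.mem_closedBall] at hz
    rw [Metric.mem_ball] at hy ⊢
    have := dist_triangle z y x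
    nlinarith
  · have hxf : x ∈ frontier Ω := by
      rw [hΩo.frontier_eq]; exact ⟨hx, hxΩ⟩
    obtain ⟨ν, ψ, K, U, h, hxU⟩ := hΩl.exists_chart hxf
    obtain ⟨δ, hδ, hb⟩ := Metric.isOpen_iff.1 h.isOpen x hxU
    have hK : (0 : ℝ) ≤ K := K.2
    -- The point `z` is at most `(K + 3) r = δ / 4` away from `y`, and `y` is within `δ / 2` of `x`,
    -- so everything stays in the chart.
    set r := δ / (4 * (K + 3)) with hr
    have hr0 : 0 < r := by positivity
    have hrδ : (K + 3) * r = δ / 4 := by rw [hr]; field_simp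
    -- The shift raises the height by `t (K + 2) r`. The graph rises by at most `K t r` over a ball
    -- of radius `t r`, and the ball itself reaches down by `t r`, so a margin `t r` remains.
    refine ⟨((K + 2) * r) • ν, r, δ / 2, hr0, by positivity, ?_⟩
    rintro y ⟨hy, hyc⟩ t ⟨ht0, ht1⟩ z hz
    set w := z - (y + t • ((K + 2) * r) • ν) with hw
    have hzw : z = y + w + (t * ((K + 2) * r)) • ν := by rw [hw, smul_smul]; abel
    have hwn : ‖w‖ ≤ t * r := by rwa [Metric.mem_closedBall, dist_eq_norm] at hz
    have hyU : y ∈ U := hb (Metric.ball_subset_ball (by linarith) hy)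
    have hzU : z ∈ U := by
      apply hb
      rw [Metric.mem_ball] at hy ⊢
      have h1 := dist_triangle z y x
      have h2 : dist z y ≤ t * r + t * ((K + 2) * r) := by
        rw [dist_eq_norm, hzw, show y + w + (t * ((K + 2) * r)) • ν - y =
          w + (t * ((K + 2) * r)) • ν by abel]
        refine (norm_add_le _ _).trans (add_le_add hwn ?_)
        rw [norm_smul, h.norm_eq, mul_one, Real.norm_of_nonneg (by positivity)]
      have h3 : t * ((K + 3) * r) ≤ 1 * ((K + 3) * r) := by gcongr
      nlinarith
    rw [h.mem_iff z hzU, hzw, h.inv, h.inner_add, inner_add_right]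
    have h1 := h.le_of_mem_closure hyU hyc
    have h2 : ψ (y + w) - ψ y ≤ K * (t * r) := by
      have := h.lip.dist_le_mul (y + w) y
      rw [dist_eq_norm, dist_eq_norm, add_sub_cancel_left] at this
      calc _ ≤ ‖ψ (y + w) - ψ y‖ := le_abs_self _
        _ ≤ K * ‖w‖ := this
        _ ≤ _ := by gcongr
    have h3 : -(t * r) ≤ inner ℝ ν w := by
      have := abs_real_inner_le_norm ν w
      rw [h.norm_eq, one_mul] at this
      linarith [neg_abs_le (inner ℝ ν w : ℝ)]
    have : 0 < t * r := by positivity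
    nlinarith

/-- A finite smooth partition of unity on `closure Ω`, together with directions `e i` along which
the support of `θ i` can be translated into `Ω`. -/
structure ConeCover (Ω : Set (Eu d)) where
  ι : Type
  [fintype : Fintype ι]
  θ : ι → Eu d → ℝ
  e : ι → Eu d
  r : ℝ
  r_pos : 0 < r
  smooth : ∀ i, ContDiff ℝ ∞ (θ i)
  compact : ∀ i, HasCompactSupport (θ i)
  nonneg : ∀ i x, 0 ≤ θ i x
  le_one : ∀ i x, θ i x ≤ 1
  sum_eq : ∀ x ∈ closure Ω, ∑ i, θ i x = 1
  cone : ∀ i, ∀ y ∈ tsupport (θ i) ∩ closure Ω, ∀ t ∈ Ioc (0 : ℝ) 1,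
    Metric.closedBall (y + t • e i) (t * r) ⊆ Ω

attribute [instance] ConeCover.fintype

/-- Compactness of the closure leaves finitely many cones. A subordinate smooth partition of unity
and the smallest of their radii give the structure. -/
theorem exists_coneCover (hΩo : IsOpen Ω) (hΩb : Bornology.IsBounded Ω)
    (hΩl : HasLipschitzBoundary Ω) : Nonempty (ConeCover Ω) := by
  choose! e r δ hr hδ hc using fun (x : Eu d) (hx : x ∈ closure Ω) => exists_cone hΩo hΩl hx
  obtain ⟨t, ht1, ht2⟩ := hΩb.isCompact_closure.elim_nhds_subcover (fun x => Metric.ball x (δ x))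
    (fun x hx => Metric.ball_mem_nhds x (hδ x hx))
  obtain ⟨f, hf⟩ := SmoothPartitionOfUnity.exists_isSubordinate
    (modelWithCornersSelf ℝ (Eu d)) hΩb.isCompact_closure.isClosed
    (fun x : t => Metric.ball (x : Eu d) (δ x)) (fun x => Metric.isOpen_ball) (by
      intro y hy
      obtain ⟨x, hx, hxy⟩ := mem_iUnion₂.1 (ht2 hy)
      exact mem_iUnion.2 ⟨⟨x, hx⟩, hxy⟩)
  -- The common radius is the minimum over the finite cover; the value `1` serves only the empty
  -- cover.
  obtain ⟨ε, hε, hεr⟩ : ∃ ε > 0, ∀ x ∈ t, ε ≤ r x := by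
    rcases t.eq_empty_or_nonempty with h | h
    · exact ⟨1, one_pos, by simp [h]⟩
    · exact ⟨t.inf' h r, by
        rw [gt_iff_lt, Finset.lt_inf'_iff]; exact fun x hx => hr x (ht1 x hx),
        fun x hx => Finset.inf'_le _ hx⟩
  refine ⟨{ ι := Fin t.card
            θ := fun i => f (t.equivFin.symm i), e := fun i => e (t.equivFin.symm i)
            r := ε, r_pos := hε, smooth := fun i => (f _).contMDiff.contDiff
            compact := fun i => ?_
            nonneg := fun i x => f.nonneg _ x
            le_one := fun i x => f.le_one _ x, sum_eq := fun x hx => ?_, cone := ?_ }⟩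
  · refine HasCompactSupport.of_support_subset_isCompact
      (isCompact_closedBall (t.equivFin.symm i : Eu d) (δ (t.equivFin.symm i))) ?_
    exact (subset_tsupport _).trans ((hf _).trans Metric.ball_subset_closedBall)
  · rw [← f.sum_eq_one hx, finsum_eq_sum_of_fintype]
    exact t.equivFin.symm.sum_comp (fun i => f i x)
  · rintro i y ⟨hy1, hy2⟩ s hs
    refine Subset.trans (Metric.closedBall_subset_closedBall ?_)
      (hc _ (ht1 _ (t.equivFin.symm i).2) y ⟨hf _ hy1, hy2⟩ s hs)
    exact mul_le_mul_of_nonneg_left (hεr _ (t.equivFin.symm i).2) hs.1.le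

/-! ### Surface measure -/

open Module

/-- The hyperplane orthogonal to `ν`. -/
abbrev Hyp (ν : Eu d) : Type := ((ℝ ∙ ν)ᗮ : Submodule ℝ (Eu d))

/-- The surface measure of a hyperplane. -/
abbrev hypMeasure (ν : Eu d) : Measure (Hyp ν) := Measure.hausdorffMeasure ((d : ℝ) - 1)

theorem finrank_hyp (hd : 1 ≤ d) {ν : Eu d} (hν : ‖ν‖ = 1) : (finrank ℝ (Hyp ν) : ℝ) = d - 1 := by
  have : Fact (finrank ℝ (Eu d) = (d - 1) + 1) := ⟨by simp; omega⟩
  rw [Submodule.finrank_orthogonal_span_singleton (n := d - 1) (by rintro rfl; simp at hν)]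
  push_cast [hd]
  ring

theorem isAddHaar_hypMeasure (hd : 1 ≤ d) {ν : Eu d} (hν : ‖ν‖ = 1) :
    (hypMeasure ν).IsAddHaarMeasure := by
  have := isAddHaarMeasure_hausdorffMeasure (E := Hyp ν)
  rwa [finrank_hyp hd hν] at this

/-- Orthogonal coordinates with respect to the unit vector `ν`. -/
def hypEquiv {ν : Eu d} (hν : ‖ν‖ = 1) : (Hyp ν × ℝ) ≃L[ℝ] Eu d :=
  LinearEquiv.toContinuousLinearEquiv
    { toFun := fun p => (p.1 : Eu d) + p.2 • ν
      map_add' := fun p q => by simp only [Prod.fst_add, Prod.snd_add, Submodule.coe_add]; module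
      map_smul' := fun c p => by
        simp only [Prod.smul_fst, Prod.smul_snd, Submodule.coe_smul, RingHom.id_apply, smul_eq_mul]
        module
      invFun := fun y => ((ℝ ∙ ν)ᗮ.orthogonalProjectionOnto y, inner ℝ ν y)
      left_inv := fun p => by
        have h1 : inner ℝ ν (p.1 : Eu d) = 0 :=
          Submodule.mem_orthogonal_singleton_iff_inner_right.1 p.1.2
        have h2 : (ℝ ∙ ν)ᗮ.orthogonalProjectionOnto (p.2 • ν) = 0 := by
          rw [map_smul, Submodule.orthogonalProjectionOnto_orthogonalComplement_singleton_eq_zero,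
            smul_zero]
        ext1
        · simp only [map_add, h2, add_zero]
          exact Submodule.orthogonalProjectionOnto_mem_subspace_eq_self _
        · simp only [inner_add_right, h1, inner_smul_right, real_inner_self_eq_norm_sq, hν]
          ring
      right_inv := fun y => by
        have := (ℝ ∙ ν).starProjection_add_starProjection_orthogonal y
        rw [Submodule.starProjection_unit_singleton ℝ hν] at this
        exact (add_comm _ _).trans this }

theorem hypEquiv_apply {ν : Eu d} (hν : ‖ν‖ = 1) (p : Hyp ν × ℝ) :
    hypEquiv hν p = (p.1 : Eu d) + p.2 • ν := rfl

theorem hypEquiv_symm_apply {ν : Eu d} (hν : ‖ν‖ = 1) (y : Eu d) :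
    (hypEquiv hν).symm y = ((ℝ ∙ ν)ᗮ.orthogonalProjectionOnto y, inner ℝ ν y) := rfl

/-- Fubini in orthogonal coordinates. The product of the surface measure of the hyperplane with
Lebesgue measure is a Haar measure, hence a multiple `c` of the volume; the normalization of
Hausdorff measure hides in `c`. -/
theorem exists_lintegral_hyp_eq (hd : 1 ≤ d) {ν : Eu d} (hν : ‖ν‖ = 1) :
    ∃ c : NNReal, ∀ G : Eu d → ENNReal, Measurable G →
      ∫⁻ z, (∫⁻ t : ℝ, G ((z : Eu d) + t • ν)) ∂(hypMeasure ν) = c * ∫⁻ y, G y := by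
  have := isAddHaar_hypMeasure hd hν
  set m : Measure (Eu d) := ((hypMeasure ν).prod volume).map (hypEquiv hν) with hm
  have hH : m.IsAddHaarMeasure := ContinuousLinearEquiv.isAddHaarMeasure_map _ _
  obtain hc := Measure.isAddLeftInvariant_eq_smul m (volume : Measure (Eu d))
  refine ⟨m.addHaarScalarFactor volume, fun G hG => ?_⟩
  have h1 : ∫⁻ y, G y ∂m = (m.addHaarScalarFactor volume) * ∫⁻ y, G y := by
    conv_lhs => rw [hc]
    rw [lintegral_smul_measure]; rfl
  rw [← h1, hm, lintegral_map hG (hypEquiv hν).continuous.measurable, lintegral_prod]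
  · rfl
  · exact (hG.comp (hypEquiv hν).continuous.measurable).aemeasurable

namespace IsGraphChart

variable {ν : Eu d} {ψ : Eu d → ℝ} {K : NNReal} {U : Set (Eu d)}

/-- The parametrization of the graph of `ψ`. -/
def param (ν : Eu d) (ψ : Eu d → ℝ) (z : Hyp ν) : Eu d := (z : Eu d) + ψ z • ν

theorem lipschitzWith_param (h : IsGraphChart Ω ν ψ K U) : LipschitzWith (1 + K) (param ν ψ) := by
  refine LipschitzWith.add (LipschitzWith.subtype_val _) ?_
  refine LipschitzWith.of_dist_le_mul fun x y => ?_
  rw [dist_eq_norm, ← sub_smul, norm_smul, h.norm_eq, mul_one, ← dist_eq_norm]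
  exact h.lip.dist_le_mul _ _

theorem param_proj (h : IsGraphChart Ω ν ψ K U) {y : Eu d} (hy : inner ℝ ν y = ψ y) :
    param ν ψ ((ℝ ∙ ν)ᗮ.orthogonalProjectionOnto y) = y := by
  have h1 := (hypEquiv h.norm_eq).apply_symm_apply y
  rw [hypEquiv_symm_apply, hypEquiv_apply] at h1
  have h2 : ψ ((ℝ ∙ ν)ᗮ.orthogonalProjectionOnto y : Eu d) = ψ y := by
    conv_rhs => rw [← h1]
    exact (h.inv _ _).symm
  rw [param, h2, ← hy]
  exact h1

theorem inner_param (h : IsGraphChart Ω ν ψ K U) (z : Hyp ν) :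
    inner ℝ ν (param ν ψ z) = ψ (param ν ψ z) := by
  have h1 : inner ℝ ν (z : Eu d) = 0 := Submodule.mem_orthogonal_singleton_iff_inner_right.1 z.2
  rw [param, h.inner_add, h1, zero_add, h.inv]

/-- A piece of the graph is the image of its projection to the hyperplane under the `(1 +
K)`-Lipschitz parametrization, and a Lipschitz image enlarges `(d - 1)`-dimensional measure by at
most `(1 + K)^(d - 1)`. -/
theorem restrict_le (hd : 1 ≤ d) (h : IsGraphChart Ω ν ψ K U) {A : Set (Eu d)}
    (hA : ∀ y ∈ A, inner ℝ ν y = ψ y) (hAm : MeasurableSet A) :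
    (Measure.hausdorffMeasure ((d : ℝ) - 1)).restrict A ≤
      (((1 + K : NNReal) : ENNReal) ^ ((d : ℝ) - 1)) •
        ((hypMeasure ν).map (param ν ψ)).restrict A := by
  have hd' : (0 : ℝ) ≤ (d : ℝ) - 1 := by
    have : (1 : ℝ) ≤ d := by exact_mod_cast hd
    linarith
  refine Measure.le_iff.2 fun B hB => ?_
  rw [Measure.restrict_apply hB, Measure.smul_apply, Measure.restrict_apply hB,
    Measure.map_apply h.lipschitzWith_param.continuous.measurable (hB.inter hAm), smul_eq_mul]
  refine le_trans (measure_mono ?_) (h.lipschitzWith_param.hausdorffMeasure_image_le hd' _)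
  intro y hy
  exact ⟨_, by rw [mem_preimage, h.param_proj (hA y hy.2)]; exact hy, h.param_proj (hA y hy.2)⟩

/-- The graph is replaced by the hyperplane below it. On each line in direction `ν` the starting
height `ψ` is removed by translation invariance, and Fubini remains. -/
theorem exists_lintegral_graph_le (hd : 1 ≤ d) (h : IsGraphChart Ω ν ψ K U) :
    ∃ C : NNReal, ∀ A : Set (Eu d), (∀ y ∈ A, inner ℝ ν y = ψ y) → MeasurableSet A →
      ∀ G : Eu d → ENNReal, Measurable G →
      ∫⁻ y in A, (∫⁻ t : ℝ, G (y + t • ν)) ∂(Measure.hausdorffMeasure ((d : ℝ) - 1)) ≤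
        C * ∫⁻ y, G y := by
  obtain ⟨c, hc⟩ := exists_lintegral_hyp_eq hd h.norm_eq
  have hd' : (0 : ℝ) ≤ (d : ℝ) - 1 := by
    have : (1 : ℝ) ≤ d := by exact_mod_cast hd
    linarith
  refine ⟨(1 + K) ^ ((d : ℝ) - 1) * c, fun A hA hAm G hG => ?_⟩
  have hmeas : Measurable fun y : Eu d => ∫⁻ t : ℝ, G (y + t • ν) := by
    refine Measurable.lintegral_prod_right' (f := fun p : Eu d × ℝ => G (p.1 + p.2 • ν)) ?_
    exact hG.comp (by fun_prop)
  refine (lintegral_mono' (h.restrict_le hd hA hAm) le_rfl).trans ?_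
  rw [lintegral_smul_measure, smul_eq_mul, ENNReal.coe_mul, mul_assoc,
    ENNReal.coe_rpow_of_nonneg _ hd', ← hc G hG]
  gcongr
  refine (setLIntegral_le_lintegral _ _).trans ?_
  rw [lintegral_map hmeas h.lipschitzWith_param.continuous.measurable]
  refine le_of_eq (lintegral_congr fun z => ?_)
  simp only [param]
  rw [← lintegral_add_left_eq_self (fun t : ℝ => G ((z : Eu d) + t • ν)) (ψ z)]
  refine lintegral_congr fun t => ?_
  rw [add_smul, add_assoc]

end IsGraphChart

/-- The orthogonal projection to the hyperplane of a chart does not increase Hausdorff measure, and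
the image of a boundary piece contains an open set there. -/
theorem hausdorffMeasure_frontier_inter_pos (hd : 1 ≤ d) (hΩo : IsOpen Ω)
    (hΩl : HasLipschitzBoundary Ω) {x : Eu d} (hx : x ∈ frontier Ω) {V : Set (Eu d)}
    (hV : V ∈ 𝓝 x) : 0 < Measure.hausdorffMeasure ((d : ℝ) - 1) (frontier Ω ∩ V) := by
  obtain ⟨ν, ψ, K, U, h, hxU⟩ := hΩl.exists_chart hx
  have := isAddHaar_hypMeasure hd h.norm_eq
  have hd' : (0 : ℝ) ≤ (d : ℝ) - 1 := by
    have : (1 : ℝ) ≤ d := by exact_mod_cast hd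
    linarith
  set p := (ℝ ∙ ν)ᗮ.orthogonalProjectionOnto
  have hp : LipschitzWith 1 p :=
    p.lipschitz.weaken (Submodule.orthogonalProjectionOnto_norm_le _)
  have h1 := h.param_proj ((h.mem_frontier_iff hΩo hxU).1 hx)
  have h2 : (IsGraphChart.param ν ψ) ⁻¹' (U ∩ V) ∈ 𝓝 (p x) := by
    refine h.lipschitzWith_param.continuous.continuousAt.preimage_mem_nhds ?_
    rw [h1]
    exact inter_mem (h.isOpen.mem_nhds hxU) hV
  have h3 : (IsGraphChart.param ν ψ) ⁻¹' (U ∩ V) ⊆ p '' (frontier Ω ∩ V) := by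
    intro z hz
    refine ⟨IsGraphChart.param ν ψ z, ⟨(h.mem_frontier_iff hΩo hz.1).2 (h.inner_param z), hz.2⟩, ?_⟩
    have := congrArg Prod.fst ((hypEquiv h.norm_eq).symm_apply_apply (z, ψ z))
    exact this
  have h4 := hp.hausdorffMeasure_image_le hd' (frontier Ω ∩ V)
  simp only [ENNReal.coe_one, ENNReal.one_rpow, one_mul] at h4
  exact (Measure.measure_pos_of_mem_nhds _ h2).trans_le ((measure_mono h3).trans h4)

/-! ### The trace inequality for smooth functions -/

/-- The inequality `f 0 ≤ f t + ∫ |f'|` is averaged over `t` in `[0, s]`. In the application `f` is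
the square of a function along a ray that enters the domain. -/
theorem sq_le_intervalIntegral {f f' : ℝ → ℝ} {s : ℝ} (hs : 0 < s)
    (hf : ∀ t, HasDerivAt f (f' t) t) (hf' : Continuous f') :
    f 0 ≤ ∫ t in (0 : ℝ)..s, (f t / s + |f' t|) := by
  have hfc : Continuous f := continuous_iff_continuousAt.2 fun t => (hf t).continuousAt
  have h1 : ∀ t ∈ Icc 0 s, f 0 - ∫ τ in (0 : ℝ)..s, |f' τ| ≤ f t := by
    intro t ht
    have e : ∫ τ in (0 : ℝ)..t, f' τ = f t - f 0 :=
      intervalIntegral.integral_eq_sub_of_hasDerivAt (fun τ _ => hf τ)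
        (hf'.intervalIntegrable _ _)
    have h2 : |∫ τ in (0 : ℝ)..t, f' τ| ≤ ∫ τ in (0 : ℝ)..t, |f' τ| :=
      intervalIntegral.abs_integral_le_integral_abs ht.1
    have h3 : ∫ τ in (0 : ℝ)..t, |f' τ| ≤ ∫ τ in (0 : ℝ)..s, |f' τ| :=
      intervalIntegral.integral_mono_interval le_rfl ht.1 ht.2
        (Eventually.of_forall fun _ => abs_nonneg _) (hf'.abs.intervalIntegrable _ _)
    have := neg_abs_le (∫ τ in (0 : ℝ)..t, f' τ)
    linarith
  have h4 := intervalIntegral.integral_mono_on hs.le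
    ((continuous_const (y := f 0 - ∫ τ in (0 : ℝ)..s, |f' τ|)).intervalIntegrable (μ := volume) 0 s)
    (hfc.intervalIntegrable 0 s) h1
  rw [intervalIntegral.integral_const, smul_eq_mul, sub_zero] at h4
  rw [intervalIntegral.integral_add ((hfc.div_const s).intervalIntegrable _ _)
    (hf'.abs.intervalIntegrable _ _), intervalIntegral.integral_div]
  have h5 : f 0 - ∫ τ in (0 : ℝ)..s, |f' τ| ≤ (∫ t in (0 : ℝ)..s, f t) / s := by
    rw [le_div_iff₀ hs]; linarith
  linarith

theorem continuous_gradient {φ : Eu d → ℝ} (hφ : ContDiff ℝ 1 φ) : Continuous (gradient φ) :=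
  (InnerProductSpace.toDual ℝ (Eu d)).symm.continuous.comp (hφ.continuous_fderiv (by simp))

theorem fderiv_apply_le_gradient (φ : Eu d → ℝ) (x v : Eu d) :
    |fderiv ℝ φ x v| ≤ ‖gradient φ x‖ * ‖v‖ := by
  rw [gradient, LinearIsometryEquiv.norm_map]
  exact (fderiv ℝ φ x).le_opNorm v

/-- The one-dimensional inequality is applied to `φ²` along rays in direction `ν`, which enter `Ω`
from the boundary, and integrated over the graph. Keeping the product `|φ| ‖∇φ‖`, instead of
splitting it into squares, is what makes the trace inequality multiplicative. -/
theorem exists_local_trace_le (hd : 1 ≤ d) (hΩo : IsOpen Ω) (hΩl : HasLipschitzBoundary Ω)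
    {x : Eu d} (hx : x ∈ frontier Ω) : ∃ W ∈ 𝓝 x, ∃ C : NNReal, ∀ φ : Eu d → ℝ, ContDiff ℝ 1 φ →
      ∫⁻ y in frontier Ω ∩ W, ‖φ y‖ₑ ^ 2 ∂(Measure.hausdorffMeasure ((d : ℝ) - 1)) ≤
        C * ∫⁻ y in Ω, ENNReal.ofReal (φ y ^ 2 + |φ y| * ‖gradient φ y‖) := by
  obtain ⟨ν, ψ, K, U, h, hxU⟩ := hΩl.exists_chart hx
  obtain ⟨C, hC⟩ := h.exists_lintegral_graph_le hd
  obtain ⟨δ, hδ, hb⟩ := Metric.isOpen_iff.1 h.isOpen x hxU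
  set s := δ / 2 with hs
  have hs0 : 0 < s := by positivity
  -- In the constant, `1 / s` comes from averaging over a ray of length `s` and `2` from the
  -- derivative of `φ²`.
  refine ⟨Metric.ball x s, Metric.ball_mem_nhds x hs0, C * Real.toNNReal (1 / s + 2),
    fun φ hφ => ?_⟩
  have hmem : ∀ z ∈ frontier Ω ∩ Metric.ball x s, ∀ τ ∈ Ioc (0 : ℝ) s, z + τ • ν ∈ Ω := by
    rintro z ⟨hz1, hz2⟩ τ ⟨ht1, ht2⟩
    have hzU : z ∈ U := hb (Metric.ball_subset_ball (by linarith) hz2)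
    have hzU' : z + τ • ν ∈ U := by
      apply hb
      rw [Metric.mem_ball] at hz2 ⊢
      have h1 := dist_triangle (z + τ • ν) z x
      have h2 : dist (z + τ • ν) z = τ := by
        rw [dist_eq_norm, add_sub_cancel_left, norm_smul, h.norm_eq, mul_one,
          Real.norm_of_nonneg ht1.le]
      linarith
    rw [h.mem_iff _ hzU', h.inv, h.inner_add, (h.mem_frontier_iff hΩo hzU).1 hz1]
    linarith
  set G : Eu d → ENNReal := Ω.indicator fun y =>
    ENNReal.ofReal ((1 / s + 2) * (φ y ^ 2 + |φ y| * ‖gradient φ y‖)) with hG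
  have hcont : Continuous fun y => (1 / s + 2) * (φ y ^ 2 + |φ y| * ‖gradient φ y‖) := by
    have := continuous_gradient hφ
    have := hφ.continuous
    fun_prop
  have hGm : Measurable G := (hcont.measurable.ennreal_ofReal).indicator hΩo.measurableSet
  have key : ∀ z ∈ frontier Ω ∩ Metric.ball x s, ‖φ z‖ₑ ^ 2 ≤ ∫⁻ t : ℝ, G (z + t • ν) := by
    intro z hz
    have hder : ∀ t : ℝ, HasDerivAt (fun t : ℝ => φ (z + t • ν) ^ 2)
        (2 * φ (z + t • ν) * fderiv ℝ φ (z + t • ν) ν) t := by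
      intro t
      have h1 : HasDerivAt (fun t : ℝ => z + t • ν) ν t := by
        simpa using ((hasDerivAt_id t).smul_const ν).const_add z
      have h2 := ((hφ.differentiable (by simp) (z + t • ν)).hasFDerivAt.comp_hasDerivAt t h1).pow 2
      convert! h2 using 1
      simp
    have hl : Continuous fun t : ℝ => z + t • ν := by fun_prop
    have hder' : Continuous fun t : ℝ => 2 * φ (z + t • ν) * fderiv ℝ φ (z + t • ν) ν :=
      (continuous_const.mul (hφ.continuous.comp hl)).mul
        (((hφ.continuous_fderiv (by simp)).comp hl).clm_apply continuous_const)
    have h3 := sq_le_intervalIntegral hs0 hder hder'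
    simp only [zero_smul, add_zero] at h3
    have h4 : ‖φ z‖ₑ ^ 2 = ENNReal.ofReal (φ z ^ 2) := by
      rw [← sq_abs, ENNReal.ofReal_pow (abs_nonneg _), ← Real.norm_eq_abs, ofReal_norm]
    have h5 : ∫ t in (0 : ℝ)..s, (φ (z + t • ν) ^ 2 / s +
        |2 * φ (z + t • ν) * fderiv ℝ φ (z + t • ν) ν|) ≤
        ∫ t in (0 : ℝ)..s, (1 / s + 2) *
          (φ (z + t • ν) ^ 2 + |φ (z + t • ν)| * ‖gradient φ (z + t • ν)‖) := by
      refine intervalIntegral.integral_mono_on hs0.le ?_ ?_ ?_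
      · refine Continuous.intervalIntegrable ?_ _ _
        exact (((hφ.continuous.comp hl).pow 2).div_const s).add hder'.abs
      · exact (hcont.comp hl).intervalIntegrable _ _
      · intro t _
        have h6 := fderiv_apply_le_gradient φ (z + t • ν) ν
        rw [h.norm_eq, mul_one] at h6
        rw [abs_mul, abs_mul, abs_two]
        have h7 : |φ (z + t • ν)| * |fderiv ℝ φ (z + t • ν) ν| ≤
          |φ (z + t • ν)| * ‖gradient φ (z + t • ν)‖ := by gcongr
        have h8 : 0 ≤ 1 / s * (|φ (z + t • ν)| * ‖gradient φ (z + t • ν)‖) := by positivity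
        have h9 : φ (z + t • ν) ^ 2 / s = 1 / s * φ (z + t • ν) ^ 2 := by ring
        rw [h9]
        nlinarith [sq_nonneg (φ (z + t • ν))]
    rw [h4]
    refine (ENNReal.ofReal_le_ofReal (h3.trans h5)).trans ?_
    rw [intervalIntegral.integral_of_le hs0.le, ofReal_integral_eq_lintegral_ofReal]
    · refine le_trans (le_of_eq ?_) (setLIntegral_le_lintegral (Ioc 0 s) _)
      refine setLIntegral_congr_fun measurableSet_Ioc fun t ht => ?_
      simp only [hG, indicator_of_mem (hmem z hz t ht)]
    · exact ((hcont.comp hl).integrableOn_Icc).mono_set Ioc_subset_Icc_self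
    · exact Eventually.of_forall fun t => by positivity
  have hA : MeasurableSet (frontier Ω ∩ Metric.ball x s) :=
    measurableSet_frontier.inter measurableSet_ball
  calc ∫⁻ y in frontier Ω ∩ Metric.ball x s, ‖φ y‖ₑ ^ 2 ∂(Measure.hausdorffMeasure ((d : ℝ) - 1))
      ≤ ∫⁻ y in frontier Ω ∩ Metric.ball x s, (∫⁻ t : ℝ, G (y + t • ν))
          ∂(Measure.hausdorffMeasure ((d : ℝ) - 1)) :=
        setLIntegral_mono' hA key
    _ ≤ C * ∫⁻ y, G y := by
        refine hC _ (fun y hy => ?_) hA G hGm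
        exact (h.mem_frontier_iff hΩo (hb (Metric.ball_subset_ball (by linarith) hy.2))).1 hy.1
    _ = _ := by
        rw [hG, lintegral_indicator hΩo.measurableSet, ENNReal.coe_mul, mul_assoc]
        congr 1
        rw [← lintegral_const_mul _ (by
          have := continuous_gradient hφ
          have := hφ.continuous
          exact (by fun_prop : Continuous fun y => φ y ^ 2 + |φ y| * ‖gradient φ y‖).measurable.ennreal_ofReal)]
        refine lintegral_congr fun y => ?_
        rw [ENNReal.ofReal_mul (by positivity)]
        rfl

theorem lintegral_biUnion_finset_le {α ι : Type*} [MeasurableSpace α] {μ : Measure α}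
    (t : Finset ι) (s : ι → Set α) (f : α → ENNReal) :
    ∫⁻ x in ⋃ i ∈ t, s i, f x ∂μ ≤ ∑ i ∈ t, ∫⁻ x in s i, f x ∂μ := by
  classical
  induction t using Finset.induction_on with
  | empty => simp
  | insert a t ha ih =>
    rw [Finset.set_biUnion_insert, Finset.sum_insert ha]
    exact (lintegral_union_le _ _ _).trans (by gcongr)

theorem exists_trace_le (hd : 1 ≤ d) (hΩo : IsOpen Ω) (hΩb : Bornology.IsBounded Ω)
    (hΩl : HasLipschitzBoundary Ω) : ∃ C : NNReal, ∀ φ : Eu d → ℝ, ContDiff ℝ 1 φ →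
      ∫⁻ y, ‖φ y‖ₑ ^ 2 ∂(surfaceMeasure Ω) ≤
        C * ∫⁻ y in Ω, ENNReal.ofReal (φ y ^ 2 + |φ y| * ‖gradient φ y‖) := by
  choose! W hW C hC using fun (x : Eu d) (hx : x ∈ frontier Ω) =>
    exists_local_trace_le hd hΩo hΩl hx
  have hcomp : IsCompact (frontier Ω) :=
    hΩb.isCompact_closure.of_isClosed_subset isClosed_frontier frontier_subset_closure
  obtain ⟨t, ht1, ht2⟩ := hcomp.elim_nhds_subcover W hW
  refine ⟨∑ x ∈ t, C x, fun φ hφ => ?_⟩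
  have hsub : frontier Ω ⊆ ⋃ x ∈ t, (frontier Ω ∩ W x) := by
    intro y hy
    obtain ⟨x, hx, hxy⟩ := mem_iUnion₂.1 (ht2 hy)
    exact mem_iUnion₂.2 ⟨x, hx, hy, hxy⟩
  rw [surfaceMeasure]
  refine (lintegral_mono_set hsub).trans ((lintegral_biUnion_finset_le t _ _).trans ?_)
  rw [ENNReal.ofNNReal_finsetSum, Finset.sum_mul]
  exact Finset.sum_le_sum fun x hx => hC x (ht1 x hx) φ hφ

/-- This is the trace inequality for `φ = 1`. -/
theorem isFiniteMeasure_surfaceMeasure (hd : 1 ≤ d) (hΩo : IsOpen Ω) (hΩb : Bornology.IsBounded Ω)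
    (hΩl : HasLipschitzBoundary Ω) : IsFiniteMeasure (surfaceMeasure Ω) := by
  obtain ⟨C, hC⟩ := exists_trace_le hd hΩo hΩb hΩl
  have := hC (fun _ => 1) contDiff_const
  simp only [enorm_one, one_pow, lintegral_one] at this
  have hg : ∀ y : Eu d, gradient (fun _ : Eu d => (1 : ℝ)) y = 0 := fun y => by simp [gradient]
  simp only [hg, norm_zero, mul_zero, add_zero, ENNReal.ofReal_one, lintegral_one,
    Measure.restrict_apply_univ] at this
  exact ⟨this.trans_lt (ENNReal.mul_lt_top ENNReal.coe_lt_top hΩb.measure_lt_top)⟩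

/-- A nonempty bounded set in a space of positive dimension has a boundary point, and every
neighbourhood of it carries surface measure. Without this the boundary mean would not see constants
and the Poincaré inequality would fail. -/
theorem surfaceMeasure_ne_zero (hd : 1 ≤ d) (hΩo : IsOpen Ω) (hΩb : Bornology.IsBounded Ω)
    (hne : Ω.Nonempty) (hΩl : HasLipschitzBoundary Ω) : surfaceMeasure Ω ≠ 0 := by
  have : Nontrivial (Eu d) := by
    have : Nonempty (Fin d) := ⟨⟨0, hd⟩⟩
    infer_instance
  obtain ⟨x, hx⟩ : (frontier Ω).Nonempty := by
    rw [nonempty_frontier_iff]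
    refine ⟨hne, fun h => ?_⟩
    rw [h] at hΩb
    exact NormedSpace.unbounded_univ ℝ (Eu d) hΩb
  have := hausdorffMeasure_frontier_inter_pos hd hΩo hΩl hx univ_mem
  rw [inter_univ] at this
  intro h
  have h2 : surfaceMeasure Ω univ = 0 := by rw [h]; rfl
  rw [surfaceMeasure, Measure.restrict_apply_univ] at h2
  exact this.ne' h2

/-! ### Averages against a bump function -/

section Average

variable {F : Type*} [NormedAddCommGroup F] [NormedSpace ℝ F]

/-- The average of `u` near `x` with respect to the normalized bump function `b`. -/
def avg (b : ContDiffBump (0 : Eu d)) (u : Eu d → F) (x : Eu d) : F :=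
  ∫ t, b.normed volume t • u (x - t)

theorem avg_eq_convolution (b : ContDiffBump (0 : Eu d)) (u : Eu d → F) :
    avg b u = convolution (b.normed volume) u (ContinuousLinearMap.lsmul ℝ ℝ) volume := rfl

theorem integrable_avg [CompleteSpace F] (b : ContDiffBump (0 : Eu d)) {u : Eu d → F}
    (hu : LocallyIntegrable u) (x : Eu d) : Integrable fun t => b.normed volume t • u (x - t) :=
  (b.hasCompactSupport_normed.convolutionExists_left (ContinuousLinearMap.lsmul ℝ ℝ)
    b.continuous_normed hu) x

theorem avg_sub_eq [CompleteSpace F] (b : ContDiffBump (0 : Eu d)) {u : Eu d → F}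
    (hu : LocallyIntegrable u) (x : Eu d) (c : F) :
    avg b u x - c = ∫ t, b.normed volume t • (u (x - t) - c) := by
  have h1 : ∫ t, b.normed volume t • c = c := by
    rw [integral_smul_const, b.integral_normed, one_smul]
  conv_lhs => rw [← h1]
  rw [avg, ← integral_sub (integrable_avg b hu x) (b.integrable_normed.smul_const c)]
  simp only [smul_sub]

theorem lintegral_ofReal_normed (b : ContDiffBump (0 : Eu d)) :
    ∫⁻ t, ENNReal.ofReal (b.normed volume t) = 1 := by
  rw [← ofReal_integral_eq_lintegral_ofReal b.integrable_normed
    (Eventually.of_forall b.nonneg_normed), b.integral_normed, ENNReal.ofReal_one]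

/-- Jensen's inequality for averages. -/
theorem enorm_avg_sub_sq_le [CompleteSpace F] (b : ContDiffBump (0 : Eu d)) {u : Eu d → F}
    (hu : LocallyIntegrable u) (hum : StronglyMeasurable u) (x : Eu d) (c : F) :
    ‖avg b u x - c‖ₑ ^ 2 ≤
      ∫⁻ t, ENNReal.ofReal (b.normed volume t) * ‖u (x - t) - c‖ₑ ^ 2 := by
  have h1 : ‖avg b u x - c‖ₑ ≤ ∫⁻ t, ENNReal.ofReal (b.normed volume t) * ‖u (x - t) - c‖ₑ := by
    rw [avg_sub_eq b hu]
    refine (enorm_integral_le_lintegral_enorm _).trans (le_of_eq (lintegral_congr fun t => ?_))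
    rw [enorm_smul, Real.enorm_eq_ofReal (b.nonneg_normed t)]
  have hm1 : Measurable fun t => ENNReal.ofReal (b.normed volume t) :=
    b.continuous_normed.measurable.ennreal_ofReal
  have hm2 : Measurable fun t => ‖u (x - t) - c‖ₑ :=
    ((hum.comp_measurable (measurable_const.sub measurable_id)).sub
      stronglyMeasurable_const).enorm
  -- Cauchy–Schwarz with the weight split evenly into two square roots; one factor integrates to
  -- `1`.
  have h2 := ENNReal.lintegral_mul_le_Lp_mul_Lq volume Real.HolderConjugate.two_two
    (f := fun t => ENNReal.ofReal (b.normed volume t) ^ (1 / 2 : ℝ))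
    (g := fun t => ENNReal.ofReal (b.normed volume t) ^ (1 / 2 : ℝ) * ‖u (x - t) - c‖ₑ)
    (hm1.pow_const _).aemeasurable ((hm1.pow_const _).mul hm2).aemeasurable
  have e1 : ∀ a : ENNReal, a ^ (1 / 2 : ℝ) * a ^ (1 / 2 : ℝ) = a := fun a => by
    rw [← ENNReal.rpow_add_of_nonneg _ _ (by norm_num) (by norm_num)]; norm_num
  have e2 : ∀ a : ENNReal, (a ^ (1 / 2 : ℝ)) ^ (2 : ℝ) = a := fun a => by
    rw [← ENNReal.rpow_mul]; norm_num
  simp only [Pi.mul_apply, ← mul_assoc, e1, e2, ENNReal.mul_rpow_of_nonneg _ _ zero_le_two,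
    lintegral_ofReal_normed, ENNReal.one_rpow, one_mul] at h2
  calc ‖avg b u x - c‖ₑ ^ 2 ≤ ((∫⁻ t, ENNReal.ofReal (b.normed volume t) *
        ‖u (x - t) - c‖ₑ ^ (2 : ℝ)) ^ (1 / 2 : ℝ)) ^ (2 : ℝ) := by
        rw [ENNReal.rpow_two]; gcongr; exact h1.trans h2
    _ = _ := by rw [e2]; simp only [ENNReal.rpow_two]

/-- By Jensen and Fubini, the error of an average is a weighted mean of translation errors, so a
bound for each translation in the support of the bump suffices. It serves smooth functions, with a
rate in `h`, and general `L²` functions, without one. -/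
theorem lintegral_avg_sub_sq_le [CompleteSpace F] (b : ContDiffBump (0 : Eu d)) {u : Eu d → F}
    (hu : LocallyIntegrable u) (hum : StronglyMeasurable u) (A : Set (Eu d)) (e : Eu d)
    {C : ENNReal} (hC : ∀ t ∈ Metric.ball (0 : Eu d) b.rOut,
      ∫⁻ x in A, ‖u (x + e - t) - u x‖ₑ ^ 2 ≤ C) :
    ∫⁻ x in A, ‖avg b u (x + e) - u x‖ₑ ^ 2 ≤ C := by
  have hm1 : Measurable fun t => ENNReal.ofReal (b.normed volume t) :=
    b.continuous_normed.measurable.ennreal_ofReal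
  have hm2 : Measurable fun p : Eu d × Eu d => ‖u (p.1 + e - p.2) - u p.1‖ₑ :=
    ((hum.comp_measurable (by fun_prop)).sub (hum.comp_measurable measurable_fst)).enorm
  calc ∫⁻ x in A, ‖avg b u (x + e) - u x‖ₑ ^ 2
      ≤ ∫⁻ x in A, ∫⁻ t, ENNReal.ofReal (b.normed volume t) * ‖u (x + e - t) - u x‖ₑ ^ 2 :=
        lintegral_mono fun x => enorm_avg_sub_sq_le b hu hum (x + e) (u x)
    _ = ∫⁻ t, ∫⁻ x in A, ENNReal.ofReal (b.normed volume t) * ‖u (x + e - t) - u x‖ₑ ^ 2 := by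
        refine lintegral_lintegral_swap (Measurable.aemeasurable ?_)
        exact (hm1.comp measurable_snd).mul (hm2.pow_const 2)
    _ ≤ ∫⁻ t, ENNReal.ofReal (b.normed volume t) * C := by
        refine lintegral_mono fun t => ?_
        simp only
        rw [lintegral_const_mul _ (by
          exact (hm2.comp (measurable_id.prodMk measurable_const)).pow_const 2)]
        by_cases ht : t ∈ Metric.ball (0 : Eu d) b.rOut
        · gcongr; exact hC t ht
        · have : b.normed volume t = 0 := by
            rw [← Function.notMem_support, b.support_normed_eq]; exact ht
          simp [this]
    _ = C := by
        rw [lintegral_mul_const _ hm1, lintegral_ofReal_normed, one_mul]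

/-- Jensen with `c = 0`; the weight is then replaced by its maximum, which is at most the inverse
volume of the inner ball. -/
theorem enorm_avg_sq_le [CompleteSpace F] (b : ContDiffBump (0 : Eu d)) {u : Eu d → F}
    (hu : LocallyIntegrable u) (hum : StronglyMeasurable u) (x : Eu d) :
    ‖avg b u x‖ₑ ^ 2 ≤
      ENNReal.ofReal (1 / (volume.real (Metric.closedBall (0 : Eu d) b.rIn))) *
        ∫⁻ y in Metric.ball x b.rOut, ‖u y‖ₑ ^ 2 := by
  have h := enorm_avg_sub_sq_le b hu hum x 0
  simp only [sub_zero] at h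
  refine h.trans ?_
  have hm : Measurable fun y => ‖u y‖ₑ ^ 2 := hum.enorm.pow_const 2
  rw [← lintegral_const_mul _ hm, ← lintegral_indicator measurableSet_ball,
    ← lintegral_sub_left_eq_self (fun y => (Metric.ball x b.rOut).indicator _ y) x]
  refine lintegral_mono fun t => ?_
  by_cases ht : t ∈ Metric.ball (0 : Eu d) b.rOut
  · rw [indicator_of_mem (by simpa [dist_eq_norm] using ht)]
    gcongr
    exact b.normed_le_div_measure_closedBall_rIn volume t
  · have : b.normed volume t = 0 := by
      rw [← Function.notMem_support, b.support_normed_eq]; exact ht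
    simp [this]

end Average

theorem contDiff_avg (b : ContDiffBump (0 : Eu d)) {u : Eu d → ℝ} (hu : LocallyIntegrable u) :
    ContDiff ℝ ∞ (avg b u) :=
  b.hasCompactSupport_normed.contDiff_convolution_left (n := (⊤ : ℕ∞))
    (ContinuousLinearMap.lsmul ℝ ℝ) b.contDiff_normed hu

/-- Differentiating the kernel gives an integral against the derivative of `w ↦ η (y - w)`. This is
an admissible test function because its support, a ball about `y`, lies in `Ω`. -/
theorem gradient_avg (b : ContDiffBump (0 : Eu d)) {u : Eu d → ℝ} {G : Eu d → Eu d}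
    (hu : LocallyIntegrable u) (hG : LocallyIntegrable G) (h : IsWeakGradient Ω u G) {y : Eu d}
    (hy : Metric.closedBall y b.rOut ⊆ Ω) : gradient (avg b u) y = avg b G y := by
  ext i
  set η := b.normed (volume : Measure (Eu d)) with hη
  have hηd : ContDiff ℝ ∞ η := b.contDiff_normed
  have h1 := (b.hasCompactSupport_normed (μ := volume)).hasFDerivAt_convolution_left
    (ContinuousLinearMap.lsmul ℝ ℝ) (b.contDiff_normed (n := 1)) hu y
  rw [← avg_eq_convolution] at h1
  have hex : Integrable fun t => ((ContinuousLinearMap.lsmul ℝ ℝ).precompL (Eu d)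
      (fderiv ℝ η t)) (u (y - t)) :=
    (HasCompactSupport.convolutionExists_left _ (b.hasCompactSupport_normed.fderiv (𝕜 := ℝ))
      (hηd.continuous_fderiv (by simp)) hu) y
  have h2 : fderiv ℝ (avg b u) y (EuclideanSpace.single i 1) =
      ∫ t, fderiv ℝ η t (EuclideanSpace.single i 1) * u (y - t) := by
    rw [h1.fderiv, convolution_def, ContinuousLinearMap.integral_apply hex]
    rfl
  have h3 : ∫ t, fderiv ℝ η t (EuclideanSpace.single i 1) * u (y - t) =
      ∫ w, fderiv ℝ η (y - w) (EuclideanSpace.single i 1) * u w := by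
    rw [← integral_sub_left_eq_self _ volume y]
    simp only [sub_sub_cancel]
  have h4 : ∀ w, fderiv ℝ (fun w => η (y - w)) w (EuclideanSpace.single i 1) =
      - fderiv ℝ η (y - w) (EuclideanSpace.single i 1) := by
    intro w
    have := (hηd.differentiable (by simp) (y - w)).hasFDerivAt.comp w
      ((hasFDerivAt_id w).const_sub y)
    have h5 : HasFDerivAt (fun w => η (y - w)) _ w := this
    rw [h5.fderiv]
    simp
  have hts : tsupport (fun w => η (y - w)) ⊆ Metric.closedBall y b.rOut := by
    refine closure_minimal (fun w hw => ?_) Metric.isClosed_closedBall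
    have : y - w ∈ Function.support η := hw
    rw [hη, b.support_normed_eq, mem_ball_zero_iff, ← dist_eq_norm, dist_comm] at this
    exact this.le
  have h6 := h (fun w => η (y - w)) (hηd.comp (contDiff_const.sub contDiff_id))
    (HasCompactSupport.of_support_subset_isCompact (isCompact_closedBall y b.rOut)
      ((subset_tsupport _).trans hts)) (hts.trans hy) i
  simp only [h4] at h6
  have hz1 : ∀ w ∉ Ω, η (y - w) = 0 := fun w hw => by
    by_contra hne
    exact hw (hy (hts (subset_tsupport _ hne)))
  have hz2 : ∀ w ∉ Ω, fderiv ℝ η (y - w) (EuclideanSpace.single i 1) = 0 := fun w hw => by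
    have : fderiv ℝ (fun w => η (y - w)) w = 0 := image_eq_zero_of_notMem_tsupport
      (fun hh => hw (hy (hts (tsupport_fderiv_subset ℝ hh))))
    have h7 := h4 w
    rw [this] at h7
    simpa using h7.symm
  rw [setIntegral_eq_integral_of_forall_compl_eq_zero (fun w hw => by rw [hz2 w hw]; simp),
    setIntegral_eq_integral_of_forall_compl_eq_zero (fun w hw => by rw [hz1 w hw, mul_zero])] at h6
  have h8 : (avg b G y) i = ∫ t, η t * G (y - t) i := by
    have := (EuclideanSpace.proj i : Eu d →L[ℝ] ℝ).integral_comp_comm (integrable_avg b hG y)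
    simp only [PiLp.proj_apply, PiLp.smul_apply, smul_eq_mul] at this
    rw [avg, ← this]
  have h9 : ∫ t, η t * G (y - t) i = ∫ w, G w i * η (y - w) := by
    rw [← integral_sub_left_eq_self _ volume y]
    simp only [sub_sub_cancel, mul_comm]
  rw [gradient_apply, h2, h3, h8, h9, ← neg_inj, ← h6, ← integral_neg]
  congr 1
  ext w
  ring

/-! ### Translations in `L²` -/

/-- Continuity of the translation action on `L²`, written with integrals. -/
theorem tendsto_eLpNorm_translate {F : Type*} [NormedAddCommGroup F]
    {u : Eu d → F} (hu : MemLp u 2) :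
    Tendsto (fun a : Eu d => ∫⁻ x, ‖u (x + a) - u x‖ₑ ^ 2) (𝓝 0) (𝓝 0) := by
  have : Fact ((2 : ENNReal) ≠ ⊤) := ⟨by simp⟩
  have h1 : Continuous fun a : Eu d => (DomAddAct.mk a +ᵥ hu.toLp u : Lp F 2 volume) :=
    (DomAddAct.continuous_mk).vadd continuous_const
  have h2 : Tendsto (fun a : Eu d => ‖(DomAddAct.mk a +ᵥ hu.toLp u : Lp F 2 volume) - hu.toLp u‖ ^ 2)
      (𝓝 0) (𝓝 0) := by
    have hc : Continuous fun a : Eu d =>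
        ‖(DomAddAct.mk a +ᵥ hu.toLp u : Lp F 2 volume) - hu.toLp u‖ ^ 2 :=
      (h1.sub continuous_const).norm.pow 2
    simpa using hc.tendsto 0
  have h3 := (ENNReal.continuous_ofReal.tendsto 0).comp h2
  rw [ENNReal.ofReal_zero] at h3
  refine h3.congr fun a => ?_
  simp only [Function.comp_apply]
  rw [ofReal_norm_sq_eq_lintegral]
  refine lintegral_congr_ae ?_
  have h4 := Lp.coeFn_sub (DomAddAct.mk a +ᵥ hu.toLp u : Lp F 2 volume) (hu.toLp u)
  have h5 := DomAddAct.vadd_Lp_ae_eq (DomAddAct.mk a) (hu.toLp u)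
  have h6 := hu.coeFn_toLp
  have h7 : ∀ᵐ x, (hu.toLp u) (x + a) = u (x + a) :=
    (measurePreserving_add_right volume a).quasiMeasurePreserving.ae h6
  filter_upwards [h4, h5, h6, h7] with x h4 h5 h6 h7
  rw [h4, Pi.sub_apply, h5, h6]
  simp only [Equiv.symm_apply_apply, vadd_eq_add]
  rw [add_comm a x, h7]

/-! ### Regularization by shifted averages -/

theorem enorm_sq_eq_ofReal {F : Type*} [NormedAddCommGroup F] (a : F) :
    ‖a‖ₑ ^ 2 = ENNReal.ofReal (‖a‖ ^ 2) := by
  rw [ENNReal.ofReal_pow (norm_nonneg _), ofReal_norm]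

theorem enorm_sum_sq_le {F ι : Type*} [NormedAddCommGroup F] (s : Finset ι) (a : ι → F) :
    ‖∑ i ∈ s, a i‖ₑ ^ 2 ≤ s.card * ∑ i ∈ s, ‖a i‖ₑ ^ 2 := by
  have h1 : ‖∑ i ∈ s, a i‖ ^ 2 ≤ s.card * ∑ i ∈ s, ‖a i‖ ^ 2 := by
    have := norm_sum_le s a
    calc ‖∑ i ∈ s, a i‖ ^ 2 ≤ (∑ i ∈ s, ‖a i‖) ^ 2 := by gcongr
      _ ≤ _ := sq_sum_le_card_mul_sum_sq
  simp only [enorm_sq_eq_ofReal]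
  rw [← ENNReal.ofReal_sum_of_nonneg (fun i _ => by positivity), ← ENNReal.ofReal_natCast,
    ← ENNReal.ofReal_mul (by positivity)]
  exact ENNReal.ofReal_le_ofReal h1

theorem enorm_add_sq_le {F : Type*} [NormedAddCommGroup F] (a b : F) :
    ‖a + b‖ₑ ^ 2 ≤ 2 * (‖a‖ₑ ^ 2 + ‖b‖ₑ ^ 2) := by
  have := enorm_sum_sq_le Finset.univ ![a, b]
  simpa using this

theorem lintegral_sq_le {α : Type*} [MeasurableSpace α] {μ : Measure α} {f : α → ENNReal}
    (hf : AEMeasurable f μ) : (∫⁻ x, f x ∂μ) ^ 2 ≤ μ univ * ∫⁻ x, f x ^ 2 ∂μ := by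
  have h := ENNReal.lintegral_mul_le_Lp_mul_Lq μ Real.HolderConjugate.two_two
    (f := fun _ => 1) (g := f) aemeasurable_const hf
  simp only [Pi.mul_apply, one_mul, ENNReal.one_rpow, lintegral_one] at h
  have e2 : ∀ a : ENNReal, (a ^ (1 / 2 : ℝ)) ^ (2 : ℝ) = a := fun a => by
    rw [← ENNReal.rpow_mul]; norm_num
  calc _ ≤ (μ univ ^ (1 / 2 : ℝ) * (∫⁻ x, f x ^ (2 : ℝ) ∂μ) ^ (1 / 2 : ℝ)) ^ (2 : ℝ) := by
        rw [ENNReal.rpow_two]; gcongr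
    _ = _ := by
        rw [ENNReal.mul_rpow_of_nonneg _ _ zero_le_two, e2, e2]; simp only [ENNReal.rpow_two]

/-- The fundamental theorem of calculus on the segment, followed by Cauchy–Schwarz on an interval of
length one. -/
theorem enorm_sub_sq_le_lintegral {φ : Eu d → ℝ} (hφ : ContDiff ℝ 1 φ) (x a : Eu d) :
    ‖φ (x + a) - φ x‖ₑ ^ 2 ≤
      ‖a‖ₑ ^ 2 * ∫⁻ s in Ioc (0 : ℝ) 1, ‖gradient φ (x + s • a)‖ₑ ^ 2 := by
  have hl : Continuous fun t : ℝ => x + t • a := by fun_prop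
  have hg := (continuous_gradient hφ).comp hl
  have hc : Continuous fun t : ℝ => fderiv ℝ φ (x + t • a) a :=
    ((hφ.continuous_fderiv (by simp)).comp hl).clm_apply continuous_const
  have h1 : φ (x + a) - φ x = ∫ s in Ioc (0 : ℝ) 1, fderiv ℝ φ (x + s • a) a := by
    rw [← intervalIntegral.integral_of_le zero_le_one,
      intervalIntegral.integral_eq_sub_of_hasDerivAt (f := fun t : ℝ => φ (x + t • a))
        (fun t _ => ?_) (hc.intervalIntegrable _ _)]
    · simp
    · have h1 : HasDerivAt (fun t : ℝ => x + t • a) a t := by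
        simpa using ((hasDerivAt_id t).smul_const a).const_add x
      exact (hφ.differentiable (by simp) (x + t • a)).hasFDerivAt.comp_hasDerivAt t h1
  have h2 : ‖φ (x + a) - φ x‖ₑ ≤ ∫⁻ s in Ioc (0 : ℝ) 1, ‖gradient φ (x + s • a)‖ₑ * ‖a‖ₑ := by
    rw [h1]
    refine (enorm_integral_le_lintegral_enorm _).trans (lintegral_mono fun s => ?_)
    rw [← ofReal_norm, ← ofReal_norm, ← ofReal_norm, ← ENNReal.ofReal_mul (norm_nonneg _)]
    exact ENNReal.ofReal_le_ofReal (fderiv_apply_le_gradient _ _ _)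
  have hgm : Measurable fun s : ℝ => ‖gradient φ (x + s • a)‖ₑ := hg.enorm.measurable
  rw [lintegral_mul_const _ hgm] at h2
  calc _ ≤ ((∫⁻ s in Ioc (0 : ℝ) 1, ‖gradient φ (x + s • a)‖ₑ) * ‖a‖ₑ) ^ 2 := by gcongr
    _ = ‖a‖ₑ ^ 2 * (∫⁻ s in Ioc (0 : ℝ) 1, ‖gradient φ (x + s • a)‖ₑ) ^ 2 := by
        rw [mul_pow, mul_comm]
    _ ≤ _ := by
        gcongr
        refine (lintegral_sq_le hgm.aemeasurable).trans ?_
        simp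

/-- The gradient is extended by zero outside `Ω`. Then the integral over `A` may be enlarged to the
whole space, where each translate by `s • a` has the same integral. -/
theorem lintegral_translate_sub_sq_le (hΩo : IsOpen Ω) {φ : Eu d → ℝ} (hφ : ContDiff ℝ 1 φ)
    {A : Set (Eu d)} (hAm : MeasurableSet A) {a : Eu d}
    (hA : ∀ x ∈ A, ∀ s ∈ Ioc (0 : ℝ) 1, x + s • a ∈ Ω) :
    ∫⁻ x in A, ‖φ (x + a) - φ x‖ₑ ^ 2 ≤ ‖a‖ₑ ^ 2 * ∫⁻ x in Ω, ‖gradient φ x‖ₑ ^ 2 := by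
  have hm : Measurable fun y => ‖gradient φ y‖ₑ ^ 2 :=
    (continuous_gradient hφ).enorm.measurable.pow_const 2
  set G : Eu d → ENNReal := Ω.indicator fun y => ‖gradient φ y‖ₑ ^ 2 with hG
  have hGm : Measurable G := hm.indicator hΩo.measurableSet
  calc ∫⁻ x in A, ‖φ (x + a) - φ x‖ₑ ^ 2
      ≤ ∫⁻ x in A, ‖a‖ₑ ^ 2 * ∫⁻ s in Ioc (0 : ℝ) 1, G (x + s • a) := by
        refine setLIntegral_mono' hAm fun x hx => (enorm_sub_sq_le_lintegral hφ x a).trans ?_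
        refine mul_le_mul_right ?_ _
        refine le_of_eq (setLIntegral_congr_fun measurableSet_Ioc fun s hs => ?_)
        simp only [hG, indicator_of_mem (hA x hx s hs)]
    _ ≤ ∫⁻ x, ‖a‖ₑ ^ 2 * ∫⁻ s in Ioc (0 : ℝ) 1, G (x + s • a) := setLIntegral_le_lintegral _ _
    _ = ‖a‖ₑ ^ 2 * ∫⁻ x, ∫⁻ s in Ioc (0 : ℝ) 1, G (x + s • a) := by
        rw [lintegral_const_mul']
        exact ENNReal.pow_ne_top enorm_ne_top
    _ = ‖a‖ₑ ^ 2 * ∫⁻ s in Ioc (0 : ℝ) 1, ∫⁻ x, G (x + s • a) := by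
        rw [lintegral_lintegral_swap]
        exact (hGm.comp (by fun_prop : Measurable fun p : Eu d × ℝ => p.1 + p.2 • a)).aemeasurable
    _ = _ := by
        simp only [lintegral_add_right_eq_self]
        rw [lintegral_const, hG, lintegral_indicator hΩo.measurableSet]
        simp

/-! ### Regularization at scale `h` and its error estimates -/

namespace ConeCover

variable (C : ConeCover Ω) {h : ℝ} (hh : 0 < h)

/-- The bump function of radius `h * C.r`. -/
def bump : ContDiffBump (0 : Eu d) where
  rIn := h * C.r / 2
  rOut := h * C.r
  rIn_pos := by have := C.r_pos; positivity
  rIn_lt_rOut := by have := mul_pos hh C.r_pos; linarith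

/-- The regularization of `u` at scale `h`. -/
def moll (u : Eu d → ℝ) (x : Eu d) : ℝ :=
  ∑ i, C.θ i x * avg (C.bump hh) u (x + h • C.e i)

theorem contDiff_moll {u : Eu d → ℝ} (hu : LocallyIntegrable u) : ContDiff ℝ ∞ (C.moll hh u) :=
  ContDiff.sum fun i _ => (C.smooth i).mul ((contDiff_avg _ hu).comp (contDiff_id.add contDiff_const))

theorem closedBall_subset {i : C.ι} (h1 : h ≤ 1) {x : Eu d} (hx : x ∈ tsupport (C.θ i))
    (hxc : x ∈ closure Ω) : Metric.closedBall (x + h • C.e i) (C.bump hh).rOut ⊆ Ω :=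
  C.cone i x ⟨hx, hxc⟩ h ⟨hh, h1⟩

theorem gradient_sum_mul {ι : Type*} (s : Finset ι) {a b : ι → Eu d → ℝ} {x : Eu d}
    (ha : ∀ i, DifferentiableAt ℝ (a i) x) (hb : ∀ i, DifferentiableAt ℝ (b i) x) :
    gradient (fun y => ∑ i ∈ s, a i y * b i y) x =
      ∑ i ∈ s, (b i x • gradient (a i) x + a i x • gradient (b i) x) := by
  have h := HasFDerivAt.fun_sum (u := s) fun i _ => (ha i).hasFDerivAt.mul (hb i).hasFDerivAt
  have h2 : HasFDerivAt (fun y => ∑ i ∈ s, a i y * b i y) _ x := h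
  rw [gradient, h2.fderiv, map_sum]
  refine Finset.sum_congr rfl fun i _ => ?_
  rw [map_add, LinearIsometryEquiv.map_smul, LinearIsometryEquiv.map_smul, add_comm]
  rfl

theorem gradient_θ_eq_zero {i : C.ι} {x : Eu d} (hx : x ∉ tsupport (C.θ i)) :
    gradient (C.θ i) x = 0 := by
  have : fderiv ℝ (C.θ i) x = 0 :=
    image_eq_zero_of_notMem_tsupport (fun hh => hx (tsupport_fderiv_subset ℝ hh))
  rw [gradient, this, map_zero]

theorem gradient_avg_comp (b : ContDiffBump (0 : Eu d)) {u : Eu d → ℝ} (a x : Eu d) :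
    gradient (fun y => avg b u (y + a)) x = gradient (avg b u) (x + a) := by
  rw [gradient, gradient, fderiv_comp_add_right]

/-- Where `θ i` does not vanish, the ball over which the shifted average is taken lies in `Ω`, so
the gradient of the average is the average of the weak gradient. Elsewhere the factor `θ i` removes
the term. -/
theorem gradient_moll {u : Eu d → ℝ} {G : Eu d → Eu d} (hu : LocallyIntegrable u)
    (hG : LocallyIntegrable G) (hw : IsWeakGradient Ω u G) (h1 : h ≤ 1) {x : Eu d}
    (hx : x ∈ closure Ω) :
    gradient (C.moll hh u) x = ∑ i, (avg (C.bump hh) u (x + h • C.e i) • gradient (C.θ i) x +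
      C.θ i x • avg (C.bump hh) G (x + h • C.e i)) := by
  have : C.moll hh u = fun y => ∑ i, C.θ i y * avg (C.bump hh) u (y + h • C.e i) := rfl
  rw [this, gradient_sum_mul Finset.univ (b := fun i y => avg (C.bump hh) u (y + h • C.e i))
    (fun i => ((C.smooth i).differentiable (by simp)) x)
    (fun i => (((contDiff_avg _ hu).comp (contDiff_id.add contDiff_const)).differentiable
      (by simp)) x)]
  refine Finset.sum_congr rfl fun i _ => ?_
  congr 1
  by_cases hxi : x ∈ tsupport (C.θ i)
  · rw [gradient_avg_comp, gradient_avg _ hu hG hw (C.closedBall_subset hh h1 hxi hx)]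
  · rw [image_eq_zero_of_notMem_tsupport hxi, zero_smul, zero_smul]

/-- Used in `exists_moll_close` to subtract the value of `u` from every average that multiplies a
`gradient (C.θ i)`, so that only averaging errors remain. -/
theorem sum_gradient_eq_zero (hΩo : IsOpen Ω) {x : Eu d} (hx : x ∈ Ω) :
    ∑ i, gradient (C.θ i) x = 0 := by
  have h1 : (fun y => ∑ i, C.θ i y * (1 : ℝ)) =ᶠ[𝓝 x] fun _ => (1 : ℝ) := by
    filter_upwards [hΩo.mem_nhds hx] with y hy
    simp [C.sum_eq y (subset_closure hy)]
  have h2 := gradient_sum_mul Finset.univ (a := C.θ) (b := fun _ _ => (1 : ℝ)) (x := x)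
    (fun i => ((C.smooth i).differentiable (by simp)) x) (fun i => differentiableAt_const _)
  have h3 : gradient (fun _ : Eu d => (1 : ℝ)) x = 0 := by simp [gradient]
  have h4 : gradient (fun y => ∑ i, C.θ i y * (1 : ℝ)) x = 0 := by
    rw [← h3, gradient, gradient, h1.fderiv_eq]
  rw [h4] at h2
  simpa [h3] using h2.symm

theorem moll_sub {u : Eu d → ℝ} {x : Eu d} (hx : x ∈ closure Ω) (c : ℝ) :
    C.moll hh u x - c = ∑ i, C.θ i x * (avg (C.bump hh) u (x + h • C.e i) - c) := by
  simp only [mul_sub, Finset.sum_sub_distrib, ← Finset.sum_mul, C.sum_eq x hx, one_mul]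
  rfl

theorem exists_bound_gradient_θ : ∃ B : ℝ, 0 ≤ B ∧ ∀ i x, ‖gradient (C.θ i) x‖ ≤ B := by
  have : ∀ i, ∃ B, ∀ x, ‖gradient (C.θ i) x‖ ≤ B := fun i => by
    obtain ⟨B, hB⟩ := ((C.compact i).fderiv (𝕜 := ℝ)).exists_bound_of_continuous
      ((C.smooth i).continuous_fderiv (by simp))
    exact ⟨B, fun x => by rw [gradient, LinearIsometryEquiv.norm_map]; exact hB x⟩
  choose B hB using this
  refine ⟨∑ i, |B i|, by positivity, fun i x => ?_⟩
  exact (hB i x).trans ((le_abs_self _).trans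
    (Finset.single_le_sum (f := fun i => |B i|) (fun i _ => abs_nonneg _) (Finset.mem_univ i)))

theorem enorm_θ_le (i : C.ι) (x : Eu d) : ‖C.θ i x‖ₑ ≤ 1 := by
  rw [Real.enorm_eq_ofReal (C.nonneg i x)]
  exact ENNReal.ofReal_le_one.2 (C.le_one i x)

theorem exists_radius : ∃ R : ℝ, 0 < R ∧ ∀ i, ‖C.e i‖ + C.r ≤ R := by
  refine ⟨∑ i, ‖C.e i‖ + C.r, by have := C.r_pos; positivity, fun i => ?_⟩
  gcongr
  exact Finset.single_le_sum (f := fun i => ‖C.e i‖) (fun i _ => norm_nonneg _) (Finset.mem_univ i)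

/-- The regularization error of a smooth function. -/
theorem exists_lintegral_moll_sub_le (hΩo : IsOpen Ω) : ∃ K : NNReal,
    ∀ {h : ℝ} (hh : 0 < h), h ≤ 1 → ∀ φ : Eu d → ℝ, ContDiff ℝ 1 φ →
      ∫⁻ x in Ω, ‖C.moll hh φ x - φ x‖ₑ ^ 2 ≤
        K * ENNReal.ofReal (h ^ 2) * ∫⁻ x in Ω, ‖gradient φ x‖ₑ ^ 2 := by
  obtain ⟨R, hR0, hR⟩ := C.exists_radius
  refine ⟨Fintype.card C.ι * (Fintype.card C.ι * Real.toNNReal (R ^ 2)),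
    fun {h} hh h1 φ hφ => ?_⟩
  set n : ENNReal := (Fintype.card C.ι : ENNReal) with hn
  set I := ∫⁻ x in Ω, ‖gradient φ x‖ₑ ^ 2 with hI
  have hloc : LocallyIntegrable φ := hφ.continuous.locallyIntegrable
  have hcavg : ∀ i, Continuous fun x => avg (C.bump hh) φ (x + h • C.e i) := fun i =>
    ((contDiff_avg _ hloc).continuous).comp (by fun_prop)
  have h2 : ∀ i, ∫⁻ x in Ω ∩ tsupport (C.θ i),
      ‖avg (C.bump hh) φ (x + h • C.e i) - φ x‖ₑ ^ 2 ≤ ENNReal.ofReal ((h * R) ^ 2) * I := by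
    intro i
    -- Every translation involved is `h • e i - t` with `‖t‖ ≤ h r`, hence of length at most `h R`.
    refine lintegral_avg_sub_sq_le _ hloc hφ.continuous.stronglyMeasurable _ _ fun t ht => ?_
    have ht' : ‖t‖ ≤ h * C.r := by
      rw [mem_ball_zero_iff] at ht; exact ht.le
    have h3 := lintegral_translate_sub_sq_le hΩo hφ (A := Ω ∩ tsupport (C.θ i))
      (hΩo.measurableSet.inter (isClosed_tsupport _).measurableSet) (a := h • C.e i - t) ?_
    · refine le_trans (le_of_eq ?_) (h3.trans ?_)
      · simp only [add_sub_assoc]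
      · rw [enorm_sq_eq_ofReal]
        gcongr
        refine (norm_sub_le _ _).trans ?_
        rw [norm_smul, Real.norm_of_nonneg hh.le]
        nlinarith [hR i]
    · rintro x ⟨hx1, hx2⟩ s ⟨hs0, hs1⟩
      -- The point at parameter `s` of the translation segment lies in the cone ball of parameter `s
      -- h`, whose radius `s h r` shrinks at the same rate as the deviation `s t`.
      refine C.cone i x ⟨hx2, subset_closure hx1⟩ (s * h) ⟨by positivity, by nlinarith⟩ ?_
      rw [Metric.mem_closedBall, dist_eq_norm,
        show x + s • (h • C.e i - t) - (x + (s * h) • C.e i) = -(s • t) by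
          rw [smul_sub, smul_smul]; abel, norm_neg, norm_smul, Real.norm_of_nonneg hs0.le, mul_assoc]
      gcongr
  calc ∫⁻ x in Ω, ‖C.moll hh φ x - φ x‖ₑ ^ 2
      ≤ ∫⁻ x in Ω, n * ∑ i, (tsupport (C.θ i)).indicator
          (fun x => ‖avg (C.bump hh) φ (x + h • C.e i) - φ x‖ₑ ^ 2) x := by
        refine setLIntegral_mono' hΩo.measurableSet fun x hx => ?_
        rw [C.moll_sub hh (subset_closure hx)]
        refine (enorm_sum_sq_le _ _).trans ?_
        rw [Finset.card_univ]
        gcongr with i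
        by_cases hxi : x ∈ tsupport (C.θ i)
        · rw [indicator_of_mem hxi, enorm_mul, mul_pow]
          calc _ ≤ 1 ^ 2 * ‖avg (C.bump hh) φ (x + h • C.e i) - φ x‖ₑ ^ 2 := by
                gcongr; exact C.enorm_θ_le i x
            _ = _ := by rw [one_pow, one_mul]
        · rw [image_eq_zero_of_notMem_tsupport hxi]
          simp
    _ = n * ∑ i, ∫⁻ x in Ω ∩ tsupport (C.θ i),
          ‖avg (C.bump hh) φ (x + h • C.e i) - φ x‖ₑ ^ 2 := by
        have hm : ∀ i, Measurable ((tsupport (C.θ i)).indicator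
            (fun x => ‖avg (C.bump hh) φ (x + h • C.e i) - φ x‖ₑ ^ 2)) := fun i =>
          ((((hcavg i).sub hφ.continuous).enorm.measurable.pow_const 2)).indicator
            (isClosed_tsupport _).measurableSet
        rw [lintegral_const_mul _ (Finset.measurable_sum _ fun i _ => hm i),
          lintegral_finsetSum _ fun i _ => hm i]
        congr 1
        refine Finset.sum_congr rfl fun i _ => ?_
        rw [lintegral_indicator (isClosed_tsupport _).measurableSet,
          Measure.restrict_restrict (isClosed_tsupport _).measurableSet, inter_comm]
    _ ≤ n * ∑ i : C.ι, ENNReal.ofReal ((h * R) ^ 2) * I := by gcongr with i; exact h2 i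
    _ = _ := by
        rw [Finset.sum_const, Finset.card_univ, nsmul_eq_mul, mul_pow, mul_comm (h ^ 2),
          ENNReal.ofReal_mul (by positivity)]
        push_cast
        rw [← ENNReal.ofReal]
        ring

/-- A pointwise bound for the gradient of the regularization of a smooth function. -/
theorem exists_enorm_gradient_moll_le (hΩo : IsOpen Ω) (hΩb : Bornology.IsBounded Ω) :
    ∃ (K : NNReal) (R : ℝ), 0 < R ∧
    ∀ {h : ℝ} (hh : 0 < h), h ≤ 1 → ∀ φ : Eu d → ℝ, ContDiff ℝ 1 φ → ∀ x ∈ closure Ω,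
      ‖gradient (C.moll hh φ) x‖ₑ ^ 2 ≤ K * ENNReal.ofReal ((h ^ d)⁻¹) *
        ∫⁻ y in Ω ∩ Metric.ball x (h * R), (‖φ y‖ₑ ^ 2 + ‖gradient φ y‖ₑ ^ 2) := by
  obtain ⟨R, hR0, hR⟩ := C.exists_radius
  obtain ⟨B, hB0, hB⟩ := C.exists_bound_gradient_θ
  set vB := volume.real (Metric.ball (0 : Eu d) 1) with hvB
  have hvB0 : 0 < vB := by
    rw [hvB, Measure.real, ENNReal.toReal_pos_iff]
    exact ⟨Metric.measure_ball_pos _ _ one_pos, measure_ball_lt_top⟩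
  have hr := C.r_pos
  set M : ℝ := 1 / ((C.r / 2) ^ d * vB) with hM
  refine ⟨Fintype.card C.ι * (Fintype.card C.ι * (2 * ((Real.toNNReal B ^ 2 + 1) *
    Real.toNNReal M))), R, hR0, fun {h} hh h1 φ hφ x hx => ?_⟩
  set n : ENNReal := (Fintype.card C.ι : ENNReal) with hn
  set I := ∫⁻ y in Ω ∩ Metric.ball x (h * R), (‖φ y‖ₑ ^ 2 + ‖gradient φ y‖ₑ ^ 2) with hI
  have hgc := continuous_gradient hφ
  have hwg : IsWeakGradient Ω φ (gradient φ) := by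
    obtain ⟨L, hL, hl⟩ := locLip_of_contDiff hΩb hφ
    exact hl.isWeakGradient hΩo hL
  -- The inner ball has radius `h r / 2`; its volume is the source of the factor `h⁻ᵈ`.
  have hvol : ENNReal.ofReal (1 / volume.real (Metric.closedBall (0 : Eu d) (C.bump hh).rIn)) =
      ENNReal.ofReal M * ENNReal.ofReal ((h ^ d)⁻¹) := by
    rw [← ENNReal.ofReal_mul (by positivity)]
    congr 1
    have : (C.bump hh).rIn = h * C.r / 2 := rfl
    rw [this, Measure.addHaar_real_closedBall _ _ (by positivity), finrank_euclideanSpace_fin, hM, ← hvB,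
      mul_div_assoc, mul_pow]
    field_simp
  -- Stated for a general target space so that it covers both `φ` and its gradient.
  have key : ∀ {F : Type} [NormedAddCommGroup F] [NormedSpace ℝ F] [CompleteSpace F] (u : Eu d → F),
      LocallyIntegrable u → StronglyMeasurable u →
      (∀ y, ‖u y‖ₑ ^ 2 ≤ ‖φ y‖ₑ ^ 2 + ‖gradient φ y‖ₑ ^ 2) → ∀ i, x ∈ tsupport (C.θ i) →
      ‖avg (C.bump hh) u (x + h • C.e i)‖ₑ ^ 2 ≤
        ENNReal.ofReal M * ENNReal.ofReal ((h ^ d)⁻¹) * I := by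
    intro F _ _ _ u hu hum hle i hxi
    refine (enorm_avg_sq_le _ hu hum _).trans ?_
    rw [hvol]
    refine mul_le_mul_right ?_ _
    refine (lintegral_mono hle).trans (lintegral_mono_set fun y hy => ?_)
    refine ⟨C.closedBall_subset hh h1 hxi hx (Metric.ball_subset_closedBall hy), ?_⟩
    rw [Metric.mem_ball] at hy ⊢
    have h3 := dist_triangle y (x + h • C.e i) x
    have h4 : dist (x + h • C.e i) x = h * ‖C.e i‖ := by
      rw [dist_eq_norm, add_sub_cancel_left, norm_smul, Real.norm_of_nonneg hh.le]
    have h5 : (C.bump hh).rOut = h * C.r := rfl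
    nlinarith [hR i]
  rw [C.gradient_moll hh hφ.continuous.locallyIntegrable hgc.locallyIntegrable hwg h1 hx]
  refine (enorm_sum_sq_le _ _).trans ?_
  rw [Finset.card_univ]
  have hB' : ∀ i, ‖gradient (C.θ i) x‖ₑ ^ 2 ≤ ENNReal.ofReal B ^ 2 := fun i => by
    rw [enorm_sq_eq_ofReal, ← ENNReal.ofReal_pow hB0]
    exact ENNReal.ofReal_le_ofReal (pow_le_pow_left₀ (norm_nonneg _) (hB i x) 2)
  have hterm : ∀ i, ‖avg (C.bump hh) φ (x + h • C.e i) • gradient (C.θ i) x +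
      C.θ i x • avg (C.bump hh) (gradient φ) (x + h • C.e i)‖ₑ ^ 2 ≤
      2 * ((ENNReal.ofReal B ^ 2 + 1) * (ENNReal.ofReal M * ENNReal.ofReal ((h ^ d)⁻¹) * I)) := by
    intro i
    refine (enorm_add_sq_le _ _).trans ?_
    gcongr
    rw [enorm_smul, enorm_smul, mul_pow, mul_pow, add_mul]
    by_cases hxi : x ∈ tsupport (C.θ i)
    · gcongr ?_ + ?_
      · rw [mul_comm]
        refine mul_le_mul' (hB' i) ?_
        · exact key φ hφ.continuous.locallyIntegrable hφ.continuous.stronglyMeasurable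
            (fun y => le_self_add) i hxi
      · gcongr
        · exact pow_le_one₀ (by simp) (C.enorm_θ_le i x)
        · exact key (gradient φ) hgc.locallyIntegrable hgc.stronglyMeasurable
            (fun y => le_add_self) i hxi
    · rw [C.gradient_θ_eq_zero hxi, image_eq_zero_of_notMem_tsupport hxi]
      simp
  calc _ ≤ n * ∑ i : C.ι, 2 * ((ENNReal.ofReal B ^ 2 + 1) *
        (ENNReal.ofReal M * ENNReal.ofReal ((h ^ d)⁻¹) * I)) := by
        gcongr with i; exact hterm i
    _ = _ := by
        rw [Finset.sum_const, Finset.card_univ, nsmul_eq_mul]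
        push_cast
        rw [← ENNReal.ofReal, ← ENNReal.ofReal]
        ring

end ConeCover

/-! ### Density of smooth functions -/

/-- The extension by zero of a function on `Ω`. -/
def ext0 {F : Type*} [NormedAddCommGroup F] (f : Lp F 2 (volume.restrict Ω)) : Eu d → F :=
  Ω.indicator f

section

variable {F : Type*} [NormedAddCommGroup F]

theorem memLp_ext0 (hΩo : IsOpen Ω) (f : Lp F 2 (volume.restrict Ω)) : MemLp (ext0 f) 2 :=
  (memLp_indicator_iff_restrict hΩo.measurableSet).2 (Lp.memLp f)

theorem stronglyMeasurable_ext0 (hΩo : IsOpen Ω) (f : Lp F 2 (volume.restrict Ω)) :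
    StronglyMeasurable (ext0 f) :=
  (Lp.stronglyMeasurable f).indicator hΩo.measurableSet

theorem locallyIntegrable_ext0 (hΩo : IsOpen Ω) (f : Lp F 2 (volume.restrict Ω)) :
    LocallyIntegrable (ext0 f) :=
  (memLp_ext0 hΩo f).locallyIntegrable one_le_two

theorem ext0_ae_eq (hΩo : IsOpen Ω) (f : Lp F 2 (volume.restrict Ω)) :
    ext0 f =ᵐ[volume.restrict Ω] f := by
  filter_upwards [ae_restrict_mem hΩo.measurableSet] with x hx
  exact indicator_of_mem hx _

end

/-! ### Convergence of the regularizations in `H¹` and uniformly -/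

namespace ConeCover

variable (C : ConeCover Ω)

/-- All translations in play have length less than `h R`, so continuity of translations of the
extension by zero in `L²` of the whole space is enough. -/
theorem exists_lintegral_avg_sub_le {F : Type*} [NormedAddCommGroup F] [NormedSpace ℝ F]
    [CompleteSpace F] (hΩo : IsOpen Ω) (f : Lp F 2 (volume.restrict Ω)) {ε : ENNReal} (hε : 0 < ε) :
    ∃ h₀ > 0, ∀ {h : ℝ} (hh : 0 < h), h ≤ h₀ → ∀ i,
      ∫⁻ x, ‖avg (C.bump hh) (ext0 f) (x + h • C.e i) - ext0 f x‖ₑ ^ 2 ≤ ε := by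
  obtain ⟨R, hR0, hR⟩ := C.exists_radius
  have h1 := (tendsto_eLpNorm_translate (memLp_ext0 hΩo f)).eventually_lt_const hε
  obtain ⟨δ, hδ, hb⟩ := Metric.eventually_nhds_iff_ball.1 h1
  refine ⟨δ / R, by positivity, fun {h} hh hle i => ?_⟩
  rw [← setLIntegral_univ]
  refine lintegral_avg_sub_sq_le _ (locallyIntegrable_ext0 hΩo f) (stronglyMeasurable_ext0 hΩo f)
    _ _ fun t ht => ?_
  rw [setLIntegral_univ]
  have := (hb (h • C.e i - t) ?_).le
  · simpa only [add_sub_assoc] using this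
  · rw [mem_ball_zero_iff] at ht ⊢
    have h2 : (C.bump hh).rOut = h * C.r := rfl
    rw [h2] at ht
    have h3 := norm_sub_le (h • C.e i) t
    rw [norm_smul, Real.norm_of_nonneg hh.le] at h3
    rw [le_div_iff₀ hR0] at hle
    nlinarith [hR i]

/-- The extension by zero is not in `H¹` of the whole space, but the shifts keep the averages inside
`Ω`, where the jump is not seen. The errors in function and gradient are then combinations of the
averaging errors `a i` of `u` and `b i` of `∇u`. -/
theorem exists_moll_close (hΩo : IsOpen Ω) (hΩb : Bornology.IsBounded Ω) (u : H1 Ω) {ε : ℝ}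
    (hε : 0 < ε) : ∃ h₀ > 0, ∀ {h : ℝ} (hh : 0 < h), h ≤ h₀ → ∀ w : H1 Ω,
      fn w =ᵐ[volume.restrict Ω] C.moll hh (ext0 (fn u)) → ‖w - u‖ ≤ ε := by
  obtain ⟨B, hB0, hB⟩ := C.exists_bound_gradient_θ
  set n : ℝ := ((Fintype.card C.ι : ℕ) : ℝ) with hn
  -- The two squared errors found below add up to `(M - 1) δ`, which is less than `M δ = ε² / 2`.
  set M : ℝ := n * (n + n * (2 * (B ^ 2 + 1))) + 1 with hM
  have hM0 : 0 < M := by positivity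
  set δ : ℝ := ε ^ 2 / (2 * M) with hδ
  have hδ0 : 0 < δ := by positivity
  obtain ⟨h₁, hh₁, H1'⟩ := C.exists_lintegral_avg_sub_le hΩo (fn u) (ENNReal.ofReal_pos.2 hδ0)
  obtain ⟨h₂, hh₂, H2⟩ := C.exists_lintegral_avg_sub_le hΩo (grad u) (ENNReal.ofReal_pos.2 hδ0)
  refine ⟨min 1 (min h₁ h₂), by positivity, fun {h} hh hle w hw => ?_⟩
  have hle1 : h ≤ 1 := hle.trans (min_le_left _ _)
  have hD1 := H1' hh (hle.trans ((min_le_right _ _).trans (min_le_left _ _)))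
  have hD2 := H2 hh (hle.trans ((min_le_right _ _).trans (min_le_right _ _)))
  set U := ext0 (fn u) with hU
  set G := ext0 (grad u) with hG
  set a : C.ι → Eu d → ℝ := fun i x => avg (C.bump hh) U (x + h • C.e i) - U x with ha
  set b : C.ι → Eu d → Eu d := fun i x => avg (C.bump hh) G (x + h • C.e i) - G x with hb
  have hUl := locallyIntegrable_ext0 hΩo (fn u)
  have hGl := locallyIntegrable_ext0 hΩo (grad u)
  have hwg : IsWeakGradient Ω U G :=
    isWeakGradient_congr (ext0_ae_eq hΩo _).symm (ext0_ae_eq hΩo _).symm (isWeakGradient_fn_grad u)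
  have hgw := grad_eq_of_contDiff hΩo hΩb ((C.contDiff_moll hh hUl).of_le (by simp)) hw
  have e1 : fn (w - u) =ᵐ[volume.restrict Ω] fun x => ∑ i, C.θ i x * a i x := by
    filter_upwards [Lp.coeFn_sub (fn w) (fn u), hw, ext0_ae_eq hΩo (fn u),
      ae_restrict_mem hΩo.measurableSet] with x h1 h2 h3 hx
    rw [fn_sub, h1, Pi.sub_apply, h2, ← h3, C.moll_sub hh (subset_closure hx)]
  have e2 : grad (w - u) =ᵐ[volume.restrict Ω]
      fun x => ∑ i, (a i x • gradient (C.θ i) x + C.θ i x • b i x) := by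
    filter_upwards [Lp.coeFn_sub (grad w) (grad u), hgw, ext0_ae_eq hΩo (grad u),
      ae_restrict_mem hΩo.measurableSet] with x h1 h2 h3 hx
    rw [grad_sub, h1, Pi.sub_apply, h2, ← h3,
      C.gradient_moll hh hUl hGl hwg hle1 (subset_closure hx)]
    simp only [ha, hb, sub_smul, smul_sub, Finset.sum_add_distrib, Finset.sum_sub_distrib,
      ← Finset.smul_sum, ← Finset.sum_smul, C.sum_gradient_eq_zero hΩo hx,
      C.sum_eq x (subset_closure hx), one_smul, smul_zero, sub_zero]
    abel
  have hnn : (Fintype.card C.ι : ENNReal) = ENNReal.ofReal n := by rw [hn, ENNReal.ofReal_natCast]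
  have ma : ∀ i, Measurable fun x => ‖a i x‖ₑ ^ 2 := fun i =>
    (((contDiff_avg _ hUl).continuous.comp
      (by fun_prop : Continuous fun x => x + h • C.e i)).measurable.sub
      (stronglyMeasurable_ext0 hΩo _).measurable).enorm.pow_const 2
  have mb : ∀ i, AEMeasurable (fun x => ‖b i x‖ₑ ^ 2) := fun i => by
    have h1 : Continuous (avg (C.bump hh) G) :=
      (C.bump hh).hasCompactSupport_normed.continuous_convolution_left
        (ContinuousLinearMap.lsmul ℝ ℝ) (C.bump hh).continuous_normed hGl
    exact (((h1.comp (by fun_prop : Continuous fun x => x + h • C.e i)).measurable.sub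
      (stronglyMeasurable_ext0 hΩo _).measurable).enorm.pow_const 2).aemeasurable
  have k1 : ‖fn (w - u)‖ ^ 2 ≤ n * (n * δ) := by
    refine norm_sq_le_of_lintegral_le e1 (by positivity) ?_
    calc ∫⁻ x in Ω, ‖∑ i, C.θ i x * a i x‖ₑ ^ 2
        ≤ ∫⁻ x in Ω, ENNReal.ofReal n * ∑ i, ‖a i x‖ₑ ^ 2 := by
          refine lintegral_mono fun x => (enorm_sum_sq_le _ _).trans ?_
          rw [Finset.card_univ, hnn]
          gcongr with i
          rw [enorm_mul]
          exact mul_le_of_le_one_left' (C.enorm_θ_le i x)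
      _ = ENNReal.ofReal n * ∑ i, ∫⁻ x in Ω, ‖a i x‖ₑ ^ 2 := by
          rw [lintegral_const_mul _ (Finset.measurable_sum _ fun i _ => ma i),
            lintegral_finsetSum _ fun i _ => ma i]
      _ ≤ ENNReal.ofReal n * ∑ i : C.ι, ENNReal.ofReal δ := by
          gcongr with i
          exact (setLIntegral_le_lintegral _ _).trans (hD1 i)
      _ = _ := by
          rw [Finset.sum_const, Finset.card_univ, nsmul_eq_mul, hnn,
            ← ENNReal.ofReal_mul (by positivity), ← ENNReal.ofReal_mul (by positivity)]
  have k2 : ‖grad (w - u)‖ ^ 2 ≤ n * (n * (2 * (B ^ 2 * δ + δ))) := by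
    refine norm_sq_le_of_lintegral_le e2 (by positivity) ?_
    calc ∫⁻ x in Ω, ‖∑ i, (a i x • gradient (C.θ i) x + C.θ i x • b i x)‖ₑ ^ 2
        ≤ ∫⁻ x in Ω, ENNReal.ofReal n *
            ∑ i, 2 * (ENNReal.ofReal (B ^ 2) * ‖a i x‖ₑ ^ 2 + ‖b i x‖ₑ ^ 2) := by
          refine lintegral_mono fun x => (enorm_sum_sq_le _ _).trans ?_
          rw [Finset.card_univ, hnn]
          gcongr with i
          refine (enorm_add_sq_le _ _).trans ?_
          rw [enorm_smul, enorm_smul, mul_pow, mul_pow]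
          refine mul_le_mul_right (add_le_add ?_ ?_) _
          · rw [mul_comm]
            gcongr
            rw [enorm_sq_eq_ofReal]
            exact ENNReal.ofReal_le_ofReal (pow_le_pow_left₀ (norm_nonneg _) (hB i x) 2)
          · exact mul_le_of_le_one_left' (pow_le_one₀ (by simp) (C.enorm_θ_le i x))
      _ = ENNReal.ofReal n * ∑ i, 2 * (ENNReal.ofReal (B ^ 2) * (∫⁻ x in Ω, ‖a i x‖ₑ ^ 2) +
            ∫⁻ x in Ω, ‖b i x‖ₑ ^ 2) := by
          rw [lintegral_const_mul' _ _ ENNReal.ofReal_ne_top, lintegral_finsetSum']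
          · congr 1
            refine Finset.sum_congr rfl fun i _ => ?_
            rw [lintegral_const_mul' _ _ (by simp),
              lintegral_add_left ((ma i).const_mul _), lintegral_const_mul _ (ma i)]
          · exact fun i _ => (((ma i).const_mul _).aemeasurable.add (mb i).restrict).const_mul _
      _ ≤ ENNReal.ofReal n * ∑ i : C.ι, 2 * (ENNReal.ofReal (B ^ 2) * ENNReal.ofReal δ +
            ENNReal.ofReal δ) := by
          gcongr with i
          · exact (setLIntegral_le_lintegral _ _).trans (hD1 i)
          · exact (setLIntegral_le_lintegral _ _).trans (hD2 i)
      _ = _ := by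
          rw [Finset.sum_const, Finset.card_univ, nsmul_eq_mul, hnn,
            ← ENNReal.ofReal_mul (by positivity), ← ENNReal.ofReal_add (by positivity) hδ0.le,
            ENNReal.ofReal_mul (p := n) (by positivity), ENNReal.ofReal_mul (p := n) (by positivity),
            ENNReal.ofReal_mul (p := 2) (by positivity), ENNReal.ofReal_ofNat]
  have k3 : ‖w - u‖ ^ 2 ≤ ε ^ 2 := by
    rw [norm_sq_eq]
    have h1 : M * δ = ε ^ 2 / 2 := by rw [hδ]; field_simp
    nlinarith [sq_nonneg ε]
  exact (pow_le_pow_iff_left₀ (norm_nonneg _) hε.le two_ne_zero).1 k3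

/-- Each active average uses only values of `v` in `Ω` at distance less than `h R` from `x`, so
uniform continuity on the compact closure controls it. -/
theorem exists_moll_uniform (hΩo : IsOpen Ω) (hΩb : Bornology.IsBounded Ω) {u : H1 Ω}
    {v : Eu d → ℝ} (hv : ContinuousOn v (closure Ω)) (huv : fn u =ᵐ[volume.restrict Ω] v) {ε : ℝ}
    (hε : 0 < ε) : ∃ h₀ > 0, ∀ {h : ℝ} (hh : 0 < h), h ≤ h₀ → ∀ x ∈ closure Ω,
      |C.moll hh (ext0 (fn u)) x - v x| ≤ ε := by
  obtain ⟨R, hR0, hR⟩ := C.exists_radius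
  have huc := hΩb.isCompact_closure.uniformContinuousOn_of_continuous hv
  obtain ⟨δ, hδ, hb⟩ := Metric.uniformContinuousOn_iff.1 huc ε hε
  refine ⟨min 1 (δ / R), by positivity, fun {h} hh hle x hx => ?_⟩
  have hle1 : h ≤ 1 := hle.trans (min_le_left _ _)
  have hle2 : h * R ≤ δ := (le_div_iff₀ hR0).1 (hle.trans (min_le_right _ _))
  rw [C.moll_sub hh hx]
  have key : ∀ i, |C.θ i x * (avg (C.bump hh) (ext0 (fn u)) (x + h • C.e i) - v x)| ≤
      C.θ i x * ε := by
    intro i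
    rw [abs_mul, abs_of_nonneg (C.nonneg i x)]
    by_cases hxi : x ∈ tsupport (C.θ i)
    · refine mul_le_mul_of_nonneg_left ?_ (C.nonneg i x)
      set b := C.bump hh with hbdef
      rw [avg_sub_eq b (locallyIntegrable_ext0 hΩo _), ← Real.norm_eq_abs]
      have h1 : ∫ t, b.normed volume t * ε = ε := by
        rw [integral_mul_const, b.integral_normed, one_mul]
      refine (norm_integral_le_of_norm_le (b.integrable_normed.mul_const ε) ?_).trans h1.le
      have h2 : ∀ᵐ y : Eu d, y ∈ Ω → ext0 (fn u) y = v y := by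
        have := (ext0_ae_eq hΩo (fn u)).trans huv
        rwa [Filter.EventuallyEq, ae_restrict_iff' hΩo.measurableSet] at this
      have h3 : ∀ᵐ t : Eu d, x + h • C.e i - t ∈ Ω →
          ext0 (fn u) (x + h • C.e i - t) = v (x + h • C.e i - t) :=
        (Measure.measurePreserving_sub_left volume (x + h • C.e i)).quasiMeasurePreserving.ae h2
      filter_upwards [h3] with t ht
      rw [norm_smul, Real.norm_of_nonneg (b.nonneg_normed t)]
      by_cases htb : t ∈ Metric.ball (0 : Eu d) b.rOut
      · refine mul_le_mul_of_nonneg_left ?_ (b.nonneg_normed t)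
        rw [mem_ball_zero_iff] at htb
        have h4 : x + h • C.e i - t ∈ Ω := by
          refine C.closedBall_subset hh hle1 hxi hx ?_
          rw [Metric.mem_closedBall, dist_eq_norm, sub_sub_cancel_left, norm_neg]
          exact htb.le
        rw [ht h4, Real.norm_eq_abs, ← Real.dist_eq]
        refine (hb _ (subset_closure h4) _ hx ?_).le
        have h5 : b.rOut = h * C.r := rfl
        rw [dist_eq_norm, show x + h • C.e i - t - x = h • C.e i - t by abel]
        have h6 := norm_sub_le (h • C.e i) t
        rw [norm_smul, Real.norm_of_nonneg hh.le] at h6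
        nlinarith [hR i]
      · have : b.normed volume t = 0 := by
          rw [← Function.notMem_support, b.support_normed_eq]; exact htb
        simp [this]
    · rw [image_eq_zero_of_notMem_tsupport hxi, zero_mul, zero_mul]
  refine (Finset.abs_sum_le_sum_abs _ _).trans ((Finset.sum_le_sum fun i _ => key i).trans ?_)
  rw [← Finset.sum_mul, C.sum_eq x hx, one_mul]

end ConeCover

theorem exists_H1_moll (hΩo : IsOpen Ω) (hΩb : Bornology.IsBounded Ω) (C : ConeCover Ω) {h : ℝ}
    (hh : 0 < h) (u : H1 Ω) :
    ∃ w : H1 Ω, fn w =ᵐ[volume.restrict Ω] C.moll hh (ext0 (fn u)) := by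
  obtain ⟨w, hw, _⟩ := exists_H1_of_contDiff hΩo hΩb
    ((C.contDiff_moll hh (locallyIntegrable_ext0 hΩo (fn u))).of_le (by simp))
  exact ⟨w, hw⟩

/-- Smooth functions are dense in `H¹(Ω)`. -/
theorem exists_smooth_close (hΩo : IsOpen Ω) (hΩb : Bornology.IsBounded Ω)
    (hΩl : HasLipschitzBoundary Ω) (u : H1 Ω) {ε : ℝ} (hε : 0 < ε) :
    ∃ (φ : Eu d → ℝ) (w : H1 Ω), ContDiff ℝ ∞ φ ∧ fn w =ᵐ[volume.restrict Ω] φ ∧ ‖w - u‖ ≤ ε := by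
  obtain ⟨C⟩ := exists_coneCover hΩo hΩb hΩl
  obtain ⟨h₁, hh₁, H⟩ := C.exists_moll_close hΩo hΩb u hε
  obtain ⟨w, hw⟩ := exists_H1_moll hΩo hΩb C hh₁ u
  exact ⟨_, w, C.contDiff_moll hh₁ (locallyIntegrable_ext0 hΩo (fn u)), hw, H hh₁ le_rfl w hw⟩

/-- A function in `H¹(Ω)` which is continuous up to the boundary is the limit of smooth functions
in `H¹(Ω)` and uniformly. -/
theorem exists_smooth_close_uniform (hΩo : IsOpen Ω) (hΩb : Bornology.IsBounded Ω)
    (hΩl : HasLipschitzBoundary Ω) {u : H1 Ω} {v : Eu d → ℝ} (hv : ContinuousOn v (closure Ω))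
    (huv : fn u =ᵐ[volume.restrict Ω] v) {ε : ℝ} (hε : 0 < ε) :
    ∃ (φ : Eu d → ℝ) (w : H1 Ω), ContDiff ℝ ∞ φ ∧ fn w =ᵐ[volume.restrict Ω] φ ∧ ‖w - u‖ ≤ ε ∧
      ∀ x ∈ closure Ω, |φ x - v x| ≤ ε := by
  obtain ⟨C⟩ := exists_coneCover hΩo hΩb hΩl
  obtain ⟨h₁, hh₁, H⟩ := C.exists_moll_close hΩo hΩb u hε
  obtain ⟨h₂, hh₂, H'⟩ := C.exists_moll_uniform hΩo hΩb hv huv hε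
  have hm : 0 < min h₁ h₂ := lt_min hh₁ hh₂
  obtain ⟨w, hw⟩ := exists_H1_moll hΩo hΩb C hm u
  exact ⟨_, w, C.contDiff_moll hm (locallyIntegrable_ext0 hΩo (fn u)), hw,
    H hm (min_le_left _ _) w hw, H' hm (min_le_right _ _)⟩

/-! ### The trace operator -/

/-- A bounded Lipschitz domain in `ℝ^d`, `d ≥ 1`. -/
structure IsLipDomain (Ω : Set (Eu d)) : Prop where
  one_le : 1 ≤ d
  isOpen : IsOpen Ω
  bounded : Bornology.IsBounded Ω
  lip : HasLipschitzBoundary Ω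
  connected : IsConnected Ω

namespace IsLipDomain

theorem isFiniteMeasure_surface (hΩ : IsLipDomain Ω) : IsFiniteMeasure (surfaceMeasure Ω) :=
  isFiniteMeasure_surfaceMeasure hΩ.one_le hΩ.isOpen hΩ.bounded hΩ.lip

theorem memLp_surface (hΩ : IsLipDomain Ω) {v : Eu d → ℝ} (hv : ContinuousOn v (closure Ω)) :
    MemLp v 2 (surfaceMeasure Ω) := by
  have := hΩ.isFiniteMeasure_surface
  obtain ⟨B, hB⟩ := hΩ.bounded.isCompact_closure.exists_bound_of_continuousOn hv
  refine MemLp.of_bound ((hv.mono frontier_subset_closure).aestronglyMeasurable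
    measurableSet_frontier) B ?_
  filter_upwards [ae_restrict_mem measurableSet_frontier] with x hx
  exact hB x (frontier_subset_closure hx)

theorem mem_traceGraph_of_contDiff (hΩ : IsLipDomain Ω) {φ : Eu d → ℝ} (hφ : ContDiff ℝ ∞ φ) {u : H1 Ω}
    (hu : fn u =ᵐ[volume.restrict Ω] φ) :
    (u, (hΩ.memLp_surface hφ.continuous.continuousOn).toLp φ) ∈ traceGraph Ω :=
  Submodule.le_topologicalClosure _ ⟨φ, hφ, hu,
    (hΩ.memLp_surface hφ.continuous.continuousOn).coeFn_toLp⟩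

/-- The multiplicative trace inequality. For smooth pairs it follows from `exists_trace_le` and
Cauchy–Schwarz; both sides are continuous, so it extends to the closure. The weaker factor `‖fn
p.1‖` later supplies the power of `h` that makes the discrete extension stable. -/
theorem exists_norm_sq_le (hΩ : IsLipDomain Ω) : ∃ K : ℝ, 0 ≤ K ∧ ∀ p ∈ traceGraph Ω,
    ‖p.2‖ ^ 2 ≤ K * (‖fn p.1‖ * ‖p.1‖) := by
  obtain ⟨C, hC⟩ := exists_trace_le hΩ.one_le hΩ.isOpen hΩ.bounded hΩ.lip
  refine ⟨2 * C, by positivity, ?_⟩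
  have hcl : IsClosed {p : H1 Ω × L2Bd Ω | ‖p.2‖ ^ 2 ≤ 2 * C * (‖fn p.1‖ * ‖p.1‖)} := by
    refine isClosed_le (by fun_prop) ?_
    exact continuous_const.mul ((((fnL Ω).continuous.comp continuous_fst).norm).mul
      continuous_fst.norm)
  refine fun p hp => closure_minimal (t := {p : H1 Ω × L2Bd Ω | _}) ?_ hcl hp
  rintro ⟨u, t⟩ ⟨φ, h1, h2, h3⟩
  have hφ1 : ContDiff ℝ 1 φ := h1.of_le (by simp)
  have hg := grad_eq_of_contDiff hΩ.isOpen hΩ.bounded hφ1 h2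
  refine norm_sq_le_of_lintegral_le h3 (by positivity) ((hC φ hφ1).trans ?_)
  have e1 : ∫⁻ y in Ω, ENNReal.ofReal (φ y ^ 2 + |φ y| * ‖gradient φ y‖) =
      ∫⁻ y in Ω, (‖fn u y‖ₑ ^ 2 + ‖fn u y‖ₑ * ‖grad u y‖ₑ) := by
    refine lintegral_congr_ae ?_
    filter_upwards [h2, hg] with y h4 h5
    rw [← h4, ← h5, ENNReal.ofReal_add (by positivity) (by positivity), ← sq_abs,
      ← Real.norm_eq_abs, ← enorm_sq_eq_ofReal, ENNReal.ofReal_mul (norm_nonneg _), ofReal_norm,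
      ofReal_norm]
  have m1 : AEMeasurable (fun y => ‖fn u y‖ₑ) (volume.restrict Ω) :=
    (Lp.stronglyMeasurable (fn u)).enorm.aemeasurable
  have m2 : AEMeasurable (fun y => ‖grad u y‖ₑ) (volume.restrict Ω) :=
    (Lp.stronglyMeasurable (grad u)).enorm.aemeasurable
  have e2 : ∀ {F : Type} [NormedAddCommGroup F] (f : Lp F 2 (volume.restrict Ω)),
      (∫⁻ y in Ω, ‖f y‖ₑ ^ (2 : ℝ)) ^ (1 / 2 : ℝ) = ENNReal.ofReal ‖f‖ := by
    intro F _ f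
    simp only [ENNReal.rpow_two]
    rw [← ofReal_norm_sq_eq_lintegral, ENNReal.ofReal_pow (norm_nonneg _), ← ENNReal.rpow_two,
      ← ENNReal.rpow_mul]
    norm_num
  have h6 := ENNReal.lintegral_mul_le_Lp_mul_Lq _ Real.HolderConjugate.two_two m1 m2
  rw [e2, e2] at h6
  rw [e1, lintegral_add_left' (m1.pow_const 2), ← ofReal_norm_sq_eq_lintegral]
  calc _ ≤ (C : ENNReal) * (ENNReal.ofReal (‖fn u‖ ^ 2) +
        ENNReal.ofReal ‖fn u‖ * ENNReal.ofReal ‖grad u‖) := by gcongr; exact h6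
    _ = ENNReal.ofReal (C * (‖fn u‖ ^ 2 + ‖fn u‖ * ‖grad u‖)) := by
        rw [ENNReal.ofReal_mul (NNReal.coe_nonneg C), ENNReal.ofReal_add (by positivity) (by positivity),
          ENNReal.ofReal_mul (norm_nonneg _), ENNReal.ofReal_coe_nnreal]
    _ ≤ _ := by
        refine ENNReal.ofReal_le_ofReal ?_
        rw [mul_assoc, mul_left_comm 2]
        refine mul_le_mul_of_nonneg_left ?_ C.2
        have h7 := norm_fn_le u
        have h8 := norm_grad_le u
        nlinarith [norm_nonneg (fn u)]

/-- By the trace inequality, the projection of the graph to `H¹(Ω)` is antilipschitz. As the graph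
is complete the range is closed, and it contains the dense set of smooth functions. -/
theorem exists_mem_traceGraph (hΩ : IsLipDomain Ω) (u : H1 Ω) : ∃ t, (u, t) ∈ traceGraph Ω := by
  obtain ⟨K, hK0, hK⟩ := hΩ.exists_norm_sq_le
  have hcomp : CompleteSpace (traceGraph Ω) :=
    (Submodule.isClosed_topologicalClosure _).completeSpace_coe
  let P : traceGraph Ω → H1 Ω := fun p => p.1.1
  have hanti : AntilipschitzWith (Real.toNNReal (K + 1)) P := by
    refine AntilipschitzWith.of_le_mul_dist fun p q => ?_
    rw [Real.coe_toNNReal _ (by positivity)]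
    have h1 := hK (p.1 - q.1) (sub_mem p.2 q.2)
    rw [Prod.snd_sub, Prod.fst_sub] at h1
    have h2 := norm_fn_le (p.1.1 - q.1.1)
    rw [Subtype.dist_eq, Prod.dist_eq, dist_eq_norm, dist_eq_norm]
    have h3 : 0 ≤ ‖p.1.1 - q.1.1‖ := norm_nonneg _
    refine max_le (by change _ ≤ (K + 1) * ‖p.1.1 - q.1.1‖; nlinarith) ?_
    change _ ≤ (K + 1) * ‖p.1.1 - q.1.1‖
    refine (pow_le_pow_iff_left₀ (norm_nonneg _) (by positivity) two_ne_zero).1 (h1.trans ?_)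
    rw [mul_pow]
    calc K * (‖fn (p.1.1 - q.1.1)‖ * ‖p.1.1 - q.1.1‖) ≤
        K * (‖p.1.1 - q.1.1‖ * ‖p.1.1 - q.1.1‖) := by gcongr
      _ ≤ _ := by rw [← sq]; gcongr; nlinarith
  have hcl : IsClosed (range P) :=
    hanti.isClosed_range (uniformContinuous_fst.comp uniformContinuous_subtype_val)
  have : u ∈ closure (range P) := by
    rw [Metric.mem_closure_iff]
    intro ε hε
    obtain ⟨φ, w, h1, h2, h3⟩ := exists_smooth_close hΩ.isOpen hΩ.bounded hΩ.lip u (half_pos hε)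
    refine ⟨w, ⟨⟨_, hΩ.mem_traceGraph_of_contDiff h1 h2⟩, rfl⟩, ?_⟩
    rw [dist_comm, dist_eq_norm]
    linarith
  rw [hcl.closure_eq] at this
  obtain ⟨p, hp⟩ := this
  exact ⟨p.1.2, by rw [← hp]; exact p.2⟩

theorem mem_traceGraph (hΩ : IsLipDomain Ω) (u : H1 Ω) : (u, (trace u : L2Bd Ω)) ∈ traceGraph Ω := by
  obtain ⟨t, ht⟩ := hΩ.exists_mem_traceGraph u
  exact Classical.epsilon_spec (p := fun t : HHalf Ω => (u, (t : L2Bd Ω)) ∈ traceGraph Ω)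
    ⟨⟨t, (u, t), ht, rfl⟩, ht⟩

/-- The difference of two traces of `u` is paired with the function `0`, and the trace inequality
makes it vanish. -/
theorem trace_unique (hΩ : IsLipDomain Ω) {u : H1 Ω} {t : L2Bd Ω} (h : (u, t) ∈ traceGraph Ω) :
    (trace u : L2Bd Ω) = t := by
  obtain ⟨K, hK0, hK⟩ := hΩ.exists_norm_sq_le
  have h1 := hK _ (sub_mem (hΩ.mem_traceGraph u) h)
  simp only [Prod.mk_sub_mk, sub_self, norm_zero, mul_zero] at h1
  have : ‖(trace u : L2Bd Ω) - t‖ = 0 := by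
    nlinarith [norm_nonneg ((trace u : L2Bd Ω) - t)]
  exact sub_eq_zero.1 (norm_eq_zero.1 this)

theorem trace_add (hΩ : IsLipDomain Ω) (u v : H1 Ω) : trace (u + v) = trace u + trace v :=
  Subtype.ext (hΩ.trace_unique (add_mem (hΩ.mem_traceGraph u) (hΩ.mem_traceGraph v)))

theorem trace_smul (hΩ : IsLipDomain Ω) (c : ℝ) (u : H1 Ω) : trace (c • u) = c • trace u :=
  Subtype.ext (hΩ.trace_unique (Submodule.smul_mem _ c (hΩ.mem_traceGraph u)))

theorem trace_sub (hΩ : IsLipDomain Ω) (u v : H1 Ω) : trace (u - v) = trace u - trace v :=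
  Subtype.ext (hΩ.trace_unique (sub_mem (hΩ.mem_traceGraph u) (hΩ.mem_traceGraph v)))

theorem exists_norm_trace_sq_le (hΩ : IsLipDomain Ω) : ∃ K : ℝ, 0 ≤ K ∧ ∀ u : H1 Ω,
    ‖(trace u : L2Bd Ω)‖ ^ 2 ≤ K * (‖fn u‖ * ‖u‖) := by
  obtain ⟨K, hK0, hK⟩ := hΩ.exists_norm_sq_le
  refine ⟨K, hK0, fun u => ?_⟩
  have h := hK (u, (trace u : L2Bd Ω)) (hΩ.mem_traceGraph u)
  exact h

theorem exists_norm_trace_le (hΩ : IsLipDomain Ω) : ∃ K : ℝ, 0 ≤ K ∧ ∀ u : H1 Ω, ‖(trace u : L2Bd Ω)‖ ≤ K * ‖u‖ := by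
  obtain ⟨K, hK0, hK⟩ := hΩ.exists_norm_trace_sq_le
  refine ⟨K + 1, by positivity, fun u => ?_⟩
  refine (pow_le_pow_iff_left₀ (norm_nonneg _) (by positivity) two_ne_zero).1 ((hK u).trans ?_)
  have := norm_fn_le u
  rw [mul_pow]
  calc K * (‖fn u‖ * ‖u‖) ≤ K * (‖u‖ * ‖u‖) := by gcongr
    _ ≤ _ := by rw [← sq]; gcongr; nlinarith

/-- The trace as a linear map onto `H^{1/2}(∂Ω)`. -/
def traceLin (hΩ : IsLipDomain Ω) : H1 Ω →ₗ[ℝ] HHalf Ω where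
  toFun := trace
  map_add' := hΩ.trace_add
  map_smul' := hΩ.trace_smul

/-- The trace as a bounded operator into `L²(∂Ω)`. -/
def traceL (hΩ : IsLipDomain Ω) : H1 Ω →L[ℝ] L2Bd Ω :=
  LinearMap.mkContinuousOfExistsBound ((HHalf Ω).subtype ∘ₗ hΩ.traceLin) (by
    obtain ⟨K, _, hK⟩ := hΩ.exists_norm_trace_le
    exact ⟨K, hK⟩)

/-- The trace of a function which is continuous up to the boundary is its restriction. -/
theorem trace_ae_eq (hΩ : IsLipDomain Ω) {u : H1 Ω} {v : Eu d → ℝ} (hv : ContinuousOn v (closure Ω))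
    (huv : fn u =ᵐ[volume.restrict Ω] v) : (trace u : L2Bd Ω) =ᵐ[surfaceMeasure Ω] v := by
  have := hΩ.isFiniteMeasure_surface
  have hmem := hΩ.memLp_surface hv
  suffices h : (u, hmem.toLp v) ∈ traceGraph Ω by
    rw [hΩ.trace_unique h]; exact hmem.coeFn_toLp
  have hcl : IsClosed (traceGraph Ω : Set (H1 Ω × L2Bd Ω)) :=
    Submodule.isClosed_topologicalClosure _
  rw [← SetLike.mem_coe, ← hcl.closure_eq, Metric.mem_closure_iff]
  intro ε hε
  set M : ℝ := (surfaceMeasure Ω).real univ with hM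
  have hM0 : 0 ≤ M := measureReal_nonneg
  -- The first bound serves the `H¹` distance; the second makes `M δ² ≤ (ε / 2)²` for the boundary
  -- measure `M`.
  set δ := min (ε / 2) (ε / (2 * (M + 1))) with hδ
  have hδ0 : 0 < δ := by positivity
  obtain ⟨φ, w, h1, h2, h3, h4⟩ :=
    exists_smooth_close_uniform hΩ.isOpen hΩ.bounded hΩ.lip hv huv hδ0
  refine ⟨_, hΩ.mem_traceGraph_of_contDiff h1 h2, ?_⟩
  rw [Prod.dist_eq, max_lt_iff]
  constructor
  · rw [dist_comm, dist_eq_norm]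
    exact h3.trans_lt ((min_le_left _ _).trans_lt (half_lt_self hε))
  · rw [dist_comm, dist_eq_norm]
    have h5 : ‖(hΩ.memLp_surface h1.continuous.continuousOn).toLp φ - hmem.toLp v‖ ^ 2 ≤
        M * δ ^ 2 := by
      rw [← MemLp.toLp_sub]
      refine norm_sq_le_of_lintegral_le (MemLp.coeFn_toLp _) (by positivity) ?_
      calc ∫⁻ x, ‖(φ - v) x‖ₑ ^ 2 ∂(surfaceMeasure Ω)
          ≤ ∫⁻ x, ENNReal.ofReal (δ ^ 2) ∂(surfaceMeasure Ω) := by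
            refine lintegral_mono_ae ?_
            filter_upwards [ae_restrict_mem measurableSet_frontier] with x hx
            rw [enorm_sq_eq_ofReal]
            refine ENNReal.ofReal_le_ofReal (pow_le_pow_left₀ (norm_nonneg _) ?_ 2)
            exact h4 x (frontier_subset_closure hx)
        _ = _ := by
            rw [lintegral_const, ENNReal.ofReal_mul hM0, mul_comm, hM, ofReal_measureReal]
    have h6 : δ * (M + 1) ≤ ε / 2 := by
      have := (le_div_iff₀ (by positivity)).1 (min_le_right (ε / 2) (ε / (2 * (M + 1))))
      rw [← hδ] at this
      linarith
    have h7 : M * δ ^ 2 ≤ (ε / 2) ^ 2 := by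
      calc M * δ ^ 2 ≤ (δ * (M + 1)) ^ 2 := by rw [mul_pow, mul_comm]; gcongr; nlinarith
        _ ≤ _ := by gcongr
    have h8 := (pow_le_pow_iff_left₀ (norm_nonneg _) (by positivity) two_ne_zero).1 (h5.trans h7)
    linarith

theorem normHalf_trace_le (hΩ : IsLipDomain Ω) (u : H1 Ω) : normHalf (trace u) ≤ ‖u‖ := by
  refine csInf_le ⟨0, ?_⟩ ⟨u, hΩ.mem_traceGraph u, rfl⟩
  rintro r ⟨w, _, rfl⟩
  exact norm_nonneg _

/-- Extensions that are minimal up to `ε` suffice everywhere, so attainment of the infimum is not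
needed. -/
theorem exists_extension (hΩ : IsLipDomain Ω) (g : HHalf Ω) {ε : ℝ} (hε : 0 < ε) :
    ∃ u : H1 Ω, trace u = g ∧ ‖u‖ < normHalf g + ε := by
  have hne : {r | ∃ u : H1 Ω, (u, (g : L2Bd Ω)) ∈ traceGraph Ω ∧ r = ‖u‖}.Nonempty := by
    obtain ⟨⟨u, t⟩, h1, h2⟩ := g.2
    refine ⟨_, u, ?_, rfl⟩
    rw [← h2]; exact h1
  obtain ⟨r, ⟨u, h1, rfl⟩, h2⟩ := exists_lt_of_csInf_lt hne (lt_add_of_pos_right (normHalf g) hε)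
  exact ⟨u, Subtype.ext (hΩ.trace_unique h1), h2⟩

end IsLipDomain

/-! ### Simplices -/

theorem affineMap_sum (A : Eu d →ᵃ[ℝ] ℝ) (s : Finset (Eu d)) (w : Eu d → ℝ)
    (hw : ∑ p ∈ s, w p = 1) : A (∑ p ∈ s, w p • p) = ∑ p ∈ s, w p * A p := by
  have h : ∀ x, A x = A.linear x + A 0 := fun x => by
    have := A.map_vadd 0 x
    simpa using this
  rw [h, map_sum]
  have h' : ∀ p ∈ s, w p * A p = A.linear (w p • p) + w p * A 0 := fun p _ => by
    rw [h p, map_smul, smul_eq_mul]; ring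
  rw [Finset.sum_congr rfl h', Finset.sum_add_distrib, ← Finset.sum_mul, hw, one_mul]

theorem affineMap_eqOn_convexHull {A B : Eu d →ᵃ[ℝ] ℝ} {s : Set (Eu d)}
    (h : EqOn A B s) : EqOn A B (convexHull ℝ s) := by
  refine convexHull_min h ?_
  intro x hx y hy a b ha hb hab
  have e : ∀ C : Eu d →ᵃ[ℝ] ℝ, C (a • x + b • y) = a • C x + b • C y := fun C =>
    Convex.combo_affine_apply hab
  have hx : A x = B x := hx
  have hy : A y = B y := hy
  change A _ = B _
  rw [e, e, hx, hy]

theorem weights_unique {t : Finset (Eu d)} (ht : AffineIndependent ℝ ((↑) : t → Eu d))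
    {w w' : Eu d → ℝ} (h1 : ∑ p ∈ t, w p = ∑ p ∈ t, w' p)
    (h2 : ∑ p ∈ t, w p • p = ∑ p ∈ t, w' p • p) : ∀ p ∈ t, w p = w' p := by
  intro p hp
  have := (affineIndependent_iff.1 ht) Finset.univ (fun q => w q - w' q) ?_ ?_ ⟨p, hp⟩
    (Finset.mem_univ _)
  · exact sub_eq_zero.1 this
  · rw [Finset.sum_coe_sort t (fun q => w q - w' q), Finset.sum_sub_distrib, h1, sub_self]
  · simp only [sub_smul]
    rw [Finset.sum_coe_sort t (fun q => w q • q - w' q • q), Finset.sum_sub_distrib, h2, sub_self]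

/-- `y` is in the relative interior of the simplex with vertices `t`. -/
def InRelInt (t : Finset (Eu d)) (y : Eu d) : Prop :=
  ∃ w : Eu d → ℝ, (∀ p ∈ t, 0 < w p) ∧ ∑ p ∈ t, w p = 1 ∧ ∑ p ∈ t, w p • p = y

theorem InRelInt.mem {t : Finset (Eu d)} {y : Eu d} (h : InRelInt t y) :
    y ∈ convexHull ℝ (t : Set (Eu d)) := by
  obtain ⟨w, h1, h2, h3⟩ := h
  exact Finset.mem_convexHull'.2 ⟨w, fun p hp => (h1 p hp).le, h2, h3⟩

theorem exists_inRelInt {s : Finset (Eu d)} {y : Eu d} (hy : y ∈ convexHull ℝ (s : Set (Eu d))) :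
    ∃ t ⊆ s, t.Nonempty ∧ InRelInt t y := by
  classical
  obtain ⟨w, h1, h2, h3⟩ := Finset.mem_convexHull'.1 hy
  refine ⟨s.filter fun p => w p ≠ 0, Finset.filter_subset _ _, ?_, w, ?_, ?_, ?_⟩
  · by_contra hne
    rw [Finset.not_nonempty_iff_eq_empty] at hne
    have : ∑ p ∈ s, w p = 0 := by
      rw [← Finset.sum_filter_ne_zero, hne, Finset.sum_empty]
    rw [this] at h2
    exact zero_ne_one h2
  · intro p hp
    rw [Finset.mem_filter] at hp
    exact lt_of_le_of_ne (h1 p hp.1) hp.2.symm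
  · rw [Finset.sum_filter_ne_zero, h2]
  · rw [← h3, Finset.sum_filter]
    refine Finset.sum_congr rfl fun p _ => ?_
    split_ifs with h
    · rfl
    · rw [not_not.1 h, zero_smul]

theorem volume_convexHull_eq_zero {t : Finset (Eu d)} (ht : t.card ≤ d) :
    volume (convexHull ℝ (t : Set (Eu d))) = 0 := by
  refine measure_mono_null (convexHull_subset_affineSpan _)
    (Measure.addHaar_affineSubspace _ _ fun h => ?_)
  rcases t.eq_empty_or_nonempty with rfl | hne
  · simp at h
  obtain ⟨n, hn⟩ : ∃ n, t.card = n + 1 := ⟨t.card - 1, by have := hne.card_pos; omega⟩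
  have h1 := finrank_vectorSpan_range_le ℝ ((↑) : t → Eu d) (n := n) (by simpa using hn)
  rw [Subtype.range_coe_subtype] at h1
  have h2 : vectorSpan ℝ (t : Set (Eu d)) = ⊤ := by
    rw [← direction_affineSpan, h, AffineSubspace.direction_top]
  have h3 : {x | x ∈ t} = (t : Set (Eu d)) := rfl
  rw [h3, h2, finrank_top, finrank_euclideanSpace_fin] at h1
  omega

theorem affineMap_finset_sum_apply {ι : Type*} (t : Finset ι) (c : ι → ℝ) (A : ι → Eu d →ᵃ[ℝ] ℝ)
    (x : Eu d) : (∑ i ∈ t, c i • A i) x = ∑ i ∈ t, c i * A i x := by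
  classical
  induction t using Finset.induction_on with
  | empty => simp
  | insert a t ha ih =>
    rw [Finset.sum_insert ha, Finset.sum_insert ha, AffineMap.coe_add, Pi.add_apply, ih,
      AffineMap.coe_smul, Pi.smul_apply, smul_eq_mul]

theorem exists_affineMap {s : Finset (Eu d)} (hs : AffineIndependent ℝ ((↑) : s → Eu d))
    (hc : s.card = d + 1) (c : Eu d → ℝ) : ∃ A : Eu d →ᵃ[ℝ] ℝ, ∀ p ∈ s, A p = c p := by
  classical
  have hspan : affineSpan ℝ (range ((↑) : s → Eu d)) = ⊤ := by
    rw [hs.affineSpan_eq_top_iff_card_eq_finrank_add_one]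
    simpa using hc
  obtain ⟨b, hb⟩ : ∃ b : AffineBasis s ℝ (Eu d), ∀ i, b i = i := ⟨⟨_, hs, hspan⟩, fun _ => rfl⟩
  refine ⟨∑ i : s, c i • b.coord i, fun p hp => ?_⟩
  rw [affineMap_finset_sum_apply, Finset.sum_eq_single ⟨p, hp⟩]
  · have := b.coord_apply_eq ⟨p, hp⟩
    rw [hb] at this
    rw [this, mul_one]
  · intro i _ hi
    have := b.coord_apply_ne hi
    rw [hb] at this
    rw [this, mul_zero]
  · intro h
    exact absurd (Finset.mem_univ _) h

/-- A step of length `ρ` from the centre stays in `S`, where `A` oscillates by at most `δ`. This is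
the inverse estimate; shape regularity enters through the radius `ρ`. -/
theorem norm_linear_le {A : Eu d →ᵃ[ℝ] ℝ} {S : Set (Eu d)} {c : Eu d} {ρ δ : ℝ} (hρ : 0 < ρ)
    (hball : Metric.closedBall c ρ ⊆ S) (hosc : ∀ x ∈ S, ∀ y ∈ S, |A x - A y| ≤ δ) (x y : Eu d) :
    |A y - A x| ≤ δ / ρ * ‖y - x‖ := by
  rcases eq_or_ne x y with rfl | hne
  · simp
  have hn : 0 < ‖y - x‖ := norm_pos_iff.2 (sub_ne_zero.2 hne.symm)
  set z := (ρ / ‖y - x‖) • (y - x) with hz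
  have hzn : ‖z‖ = ρ := by
    rw [hz, norm_smul, Real.norm_of_nonneg (by positivity)]; field_simp
  have h1 := hosc (c + z) (hball (by simp [hzn])) c (hball (by simp [hρ.le]))
  have h2 : A (c + z) - A c = A.linear z := by
    have := A.linearMap_vsub (c + z) c
    simpa using this.symm
  have h3 : A y - A x = A.linear (y - x) := by
    have := A.linearMap_vsub y x
    simpa using this.symm
  rw [h2, hz, map_smul, smul_eq_mul, abs_mul, abs_of_nonneg (by positivity)] at h1
  rw [h3]
  rw [div_mul_eq_mul_div, div_le_iff₀ hn] at h1
  rw [div_mul_eq_mul_div, le_div_iff₀ hρ]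
  linarith

/-! ### Triangulations -/

/-- The vertex sets of the elements of `K`. -/
def topFaces (K : Geometry.SimplicialComplex ℝ (Eu d)) : Set (Finset (Eu d)) :=
  {s | s ∈ K.faces ∧ s.card = d + 1}

/-- A triangulated Lipschitz domain. -/
structure IsTri (Ω : Set (Eu d)) (K : Geometry.SimplicialComplex ℝ (Eu d)) : Prop where
  dom : IsLipDomain Ω
  tri : IsTriangulation Ω K

namespace IsTri

variable {K : Geometry.SimplicialComplex ℝ (Eu d)}

theorem finite_topFaces (h : IsTri Ω K) : (topFaces K).Finite :=
  h.tri.1.subset fun _ hs => hs.1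

theorem convexHull_subset (h : IsTri Ω K) {s : Finset (Eu d)} (hs : s ∈ K.faces) :
    convexHull ℝ (s : Set (Eu d)) ⊆ closure Ω := by
  rw [← h.tri.2]; exact K.convexHull_subset_space hs

theorem isClosed_convexHull (s : Finset (Eu d)) : IsClosed (convexHull ℝ (s : Set (Eu d))) :=
  s.finite_toSet.isClosed_convexHull ℝ

theorem exists_face (h : IsTri Ω K) {y : Eu d} (hy : y ∈ closure Ω) :
    ∃ t ∈ K.faces, InRelInt t y := by
  rw [← h.tri.2, K.mem_space_iff] at hy
  obtain ⟨s, hs, hys⟩ := hy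
  obtain ⟨t, hts, hne, ht⟩ := exists_inRelInt hys
  exact ⟨t, K.down_closed hs hts hne, ht⟩

/-- The point lies in the common face of both simplices. By uniqueness of barycentric coordinates,
the coordinates in `t` of vertices outside `s` vanish, while all of them are positive. -/
theorem subset_of_inRelInt {s t : Finset (Eu d)} (ht : t ∈ K.faces) (hs : s ∈ K.faces) {y : Eu d}
    (hy : InRelInt t y) (hys : y ∈ convexHull ℝ (s : Set (Eu d))) : t ⊆ s := by
  classical
  have hyt := hy.mem
  obtain ⟨w, h1, h2, h3⟩ := hy
  have h4 := K.inter_subset_convexHull hs ht ⟨hys, hyt⟩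
  rw [← Finset.coe_inter, Finset.mem_convexHull'] at h4
  obtain ⟨w', k1, k2, k3⟩ := h4
  have e : ∀ p ∈ t, w p = if p ∈ s then w' p else 0 := by
    refine weights_unique (K.indep ht) ?_ ?_
    · rw [h2, ← k2, ← Finset.sum_filter, Finset.filter_mem_eq_inter, Finset.inter_comm]
    · rw [h3, ← k3]
      simp only [ite_smul, zero_smul]
      rw [← Finset.sum_filter, Finset.filter_mem_eq_inter, Finset.inter_comm]
  intro p hp
  by_contra hps
  have := e p hp
  rw [if_neg hps] at this
  exact (h1 p hp).ne' this

/-- Near `x`, every face meeting a small ball contains `x`. -/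
theorem eventually_mem_of_mem (h : IsTri Ω K) (x : Eu d) : ∀ᶠ y in 𝓝 x, ∀ s ∈ K.faces,
    y ∈ convexHull ℝ (s : Set (Eu d)) → x ∈ convexHull ℝ (s : Set (Eu d)) := by
  rw [eventually_all_finite h.tri.1]
  intro s _
  by_cases hx : x ∈ convexHull ℝ (s : Set (Eu d))
  · exact Eventually.of_forall fun _ _ => hx
  · filter_upwards [(isClosed_convexHull s).isOpen_compl.mem_nhds hx] with y hy hy'
    exact absurd hy' hy

/-- The triangulation looks the same near all points of the relative interior of a face, up to
scaling. A small ball about `y` is filled by simplices that contain `t`; its copy scaled by `η`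
about `y'` is filled by the same simplices. So `y'` is interior to the closure, hence lies in `Ω`.
-/
theorem mem_of_inRelInt (h : IsTri Ω K) {t : Finset (Eu d)} (ht : t ∈ K.faces) {y y' : Eu d}
    (hy : InRelInt t y) (hy' : InRelInt t y') (hyΩ : y ∈ Ω) : y' ∈ Ω := by
  classical
  have hev := (h.eventually_mem_of_mem y).and (h.dom.isOpen.mem_nhds hyΩ)
  obtain ⟨ε, hε, hb⟩ := Metric.eventually_nhds_iff_ball.1 hev
  have hy2 := hy
  obtain ⟨w, h1, h2, h3⟩ := hy
  obtain ⟨w', k1, k2, k3⟩ := hy'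
  -- The scale `η` keeps the coordinates `w' - η w` nonnegative after the displacement.
  obtain ⟨η, hη, hηw⟩ : ∃ η > 0, ∀ p ∈ t, η * w p ≤ w' p := by
    have hne : t.Nonempty := K.nonempty_of_mem_faces ht
    refine ⟨t.inf' hne fun p => w' p / w p, ?_, fun p hp => ?_⟩
    · rw [gt_iff_lt, Finset.lt_inf'_iff]
      exact fun p hp => div_pos (k1 p hp) (h1 p hp)
    · rw [← le_div_iff₀ (h1 p hp)]
      exact Finset.inf'_le _ hp
  rw [← interior_closure_eq h.dom.isOpen h.dom.lip, mem_interior]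
  refine ⟨Metric.ball y' (η * ε), fun x hx => ?_, Metric.isOpen_ball,
    Metric.mem_ball_self (by positivity)⟩
  set z := η⁻¹ • (x - y') with hz
  have hyz : y + z ∈ Metric.ball y ε := by
    rw [Metric.mem_ball, dist_eq_norm, add_sub_cancel_left, hz, norm_smul, norm_inv,
      Real.norm_of_nonneg hη.le, inv_mul_lt_iff₀ hη]
    rwa [Metric.mem_ball, dist_eq_norm] at hx
  obtain ⟨hf, hyzΩ⟩ := hb _ hyz
  have hcl := subset_closure hyzΩ
  rw [← h.tri.2, K.mem_space_iff] at hcl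
  obtain ⟨s, hs, hyzs⟩ := hcl
  have hts : t ⊆ s := subset_of_inRelInt ht hs hy2 (hf s hs hyzs)
  apply h.convexHull_subset hs
  obtain ⟨l, l1, l2, l3⟩ := Finset.mem_convexHull'.1 hyzs
  have hext : ∀ (f : Eu d → ℝ), ∑ p ∈ s, (if p ∈ t then f p else 0) = ∑ p ∈ t, f p := fun f => by
    rw [← Finset.sum_filter, Finset.filter_mem_eq_inter, Finset.inter_eq_right.2 hts]
  have hext' : ∀ (f : Eu d → ℝ), ∑ p ∈ s, (if p ∈ t then f p else 0) • p = ∑ p ∈ t, f p • p :=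
    fun f => by
      simp only [ite_smul, zero_smul]
      rw [← Finset.sum_filter, Finset.filter_mem_eq_inter, Finset.inter_eq_right.2 hts]
  refine Finset.mem_convexHull'.2
    ⟨fun p => (if p ∈ t then w' p - η * w p else 0) + η * l p, fun p hp => ?_, ?_, ?_⟩
  · refine add_nonneg ?_ (mul_nonneg hη.le (l1 p hp))
    split_ifs with hpt
    · linarith [hηw p hpt]
    · exact le_rfl
  · rw [Finset.sum_add_distrib, hext (fun p => w' p - η * w p), Finset.sum_sub_distrib,
      ← Finset.mul_sum, ← Finset.mul_sum, h2, k2, l2]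
    ring
  · simp only [add_smul]
    rw [Finset.sum_add_distrib, hext' (fun p => w' p - η * w p)]
    simp only [sub_smul, mul_smul]
    rw [Finset.sum_sub_distrib, ← Finset.smul_sum, ← Finset.smul_sum, h3, k3, l3, hz, smul_add,
      smul_smul, mul_inv_cancel₀ hη.ne', one_smul]
    abel

/-- A simplex whose relative interior meets `∂Ω` lies in `∂Ω`. -/
theorem subset_frontier (h : IsTri Ω K) {t : Finset (Eu d)} (ht : t ∈ K.faces) {y : Eu d}
    (hy : InRelInt t y) (hyf : y ∈ frontier Ω) :
    convexHull ℝ (t : Set (Eu d)) ⊆ frontier Ω := by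
  intro x hx
  rw [h.dom.isOpen.frontier_eq] at hyf ⊢
  refine ⟨h.convexHull_subset ht hx, fun hxΩ => ?_⟩
  -- If `x` were in `Ω`, then so would be points of the segment to `y` close to `x`. These are in
  -- the relative interior, which would force `y ∈ Ω`.
  have hT : Tendsto (fun a : ℝ => (1 - a) • x + a • y) (𝓝[>] 0) (𝓝 x) := by
    have : Tendsto (fun a : ℝ => (1 - a) • x + a • y) (𝓝 0) (𝓝 ((1 - (0 : ℝ)) • x + (0 : ℝ) • y)) :=
      (by fun_prop : Continuous fun a : ℝ => (1 - a) • x + a • y).tendsto 0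
    simp only [sub_zero, one_smul, zero_smul, add_zero] at this
    exact this.mono_left nhdsWithin_le_nhds
  obtain ⟨a, ha1, ha2⟩ := ((hT.eventually (h.dom.isOpen.mem_nhds hxΩ)).and
    (Ioo_mem_nhdsGT (zero_lt_one' ℝ))).exists
  have hr : InRelInt t ((1 - a) • x + a • y) := by
    obtain ⟨w, h1, h2, h3⟩ := Finset.mem_convexHull'.1 hx
    obtain ⟨w', k1, k2, k3⟩ := hy
    refine ⟨fun p => (1 - a) * w p + a * w' p, fun p hp => ?_, ?_, ?_⟩
    · have := mul_nonneg (sub_nonneg.2 ha2.2.le) (h1 p hp)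
      have := mul_pos ha2.1 (k1 p hp)
      linarith
    · rw [Finset.sum_add_distrib, ← Finset.mul_sum, ← Finset.mul_sum, h2, k2]; ring
    · simp only [add_smul, mul_smul]
      rw [Finset.sum_add_distrib, ← Finset.smul_sum, ← Finset.smul_sum, h3, k3]
  exact hyf.2 (h.mem_of_inRelInt ht hr hy ha1)

/-- The simplices of lower dimension have volume zero, so they cannot cover the open part of `Ω`
missed by the closed union of the elements. -/
theorem exists_topFace (h : IsTri Ω K) {y : Eu d} (hy : y ∈ closure Ω) :
    ∃ s ∈ topFaces K, y ∈ convexHull ℝ (s : Set (Eu d)) := by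
  have hcl : IsClosed (⋃ s ∈ topFaces K, convexHull ℝ (s : Set (Eu d))) :=
    h.finite_topFaces.isClosed_biUnion fun s _ => isClosed_convexHull s
  suffices hsub : Ω ⊆ ⋃ s ∈ topFaces K, convexHull ℝ (s : Set (Eu d)) by
    have := closure_minimal hsub hcl hy
    simpa using this
  by_contra hne
  obtain ⟨x, hxΩ, hx⟩ := not_subset.1 hne
  have ho : IsOpen (Ω ∩ (⋃ s ∈ topFaces K, convexHull ℝ (s : Set (Eu d)))ᶜ) :=
    h.dom.isOpen.inter hcl.isOpen_compl
  have hpos := ho.measure_pos volume ⟨x, hxΩ, hx⟩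
  have hzero : volume (⋃ s ∈ K.faces \ topFaces K, convexHull ℝ (s : Set (Eu d))) = 0 := by
    rw [measure_biUnion_null_iff (h.tri.1.subset sdiff_subset).countable]
    intro s hs
    apply volume_convexHull_eq_zero
    have h1 := (K.indep hs.1).card_le_finrank_succ
    have h2 : Module.finrank ℝ (vectorSpan ℝ (range ((↑) : s → Eu d))) ≤ d := by
      have := Submodule.finrank_le (vectorSpan ℝ (range ((↑) : s → Eu d)))
      simpa using this
    have h3 : s.card ≠ d + 1 := fun hc => hs.2 ⟨hs.1, hc⟩
    rw [Fintype.card_coe] at h1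
    omega
  refine hpos.ne' (measure_mono_null ?_ hzero)
  rintro z ⟨hz1, hz2⟩
  have hz3 := subset_closure hz1
  rw [← h.tri.2, K.mem_space_iff] at hz3
  obtain ⟨s, hs, hzs⟩ := hz3
  refine mem_iUnion₂.2 ⟨s, ⟨hs, fun hst => hz2 (mem_iUnion₂.2 ⟨s, hst, hzs⟩)⟩, hzs⟩

/-- Some element contains the barycentre of `t`, which is a relative interior point, and hence
contains all vertices of `t`. -/
theorem exists_topFace_of_face (h : IsTri Ω K) {t : Finset (Eu d)} (ht : t ∈ K.faces) :
    ∃ s ∈ topFaces K, t ⊆ s := by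
  have hne := K.nonempty_of_mem_faces ht
  have hc : (0 : ℝ) < t.card := by exact_mod_cast hne.card_pos
  have hr : InRelInt t (∑ p ∈ t, (t.card : ℝ)⁻¹ • p) := by
    refine ⟨fun _ => (t.card : ℝ)⁻¹, fun _ _ => by positivity, ?_, rfl⟩
    rw [Finset.sum_const, nsmul_eq_mul, mul_inv_cancel₀ hc.ne']
  obtain ⟨s, hs, hys⟩ := h.exists_topFace (h.convexHull_subset ht hr.mem)
  exact ⟨s, hs, subset_of_inRelInt ht hs.1 hr hys⟩

theorem interior_subset (h : IsTri Ω K) {s : Finset (Eu d)} (hs : s ∈ K.faces) :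
    interior (convexHull ℝ (s : Set (Eu d))) ⊆ Ω := by
  rw [← interior_closure_eq h.dom.isOpen h.dom.lip]
  exact interior_mono (h.convexHull_subset hs)

theorem interior_ae_eq (s : Finset (Eu d)) :
    interior (convexHull ℝ (s : Set (Eu d))) =ᵐ[volume] convexHull ℝ (s : Set (Eu d)) :=
  interior_ae_eq_of_null_frontier ((convex_convexHull ℝ _).addHaar_frontier volume)

/-- Two different elements meet in the hull of at most `d` common vertices. This hull has volume
zero and so contains no open set. -/
theorem disjoint_interior {s s' : Finset (Eu d)} (hs : s ∈ topFaces K) (hs' : s' ∈ topFaces K)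
    (hne : s ≠ s') : Disjoint (interior (convexHull ℝ (s : Set (Eu d))))
      (interior (convexHull ℝ (s' : Set (Eu d)))) := by
  classical
  rw [Set.disjoint_iff_inter_eq_empty]
  by_contra hcon
  rw [← ne_eq, ← nonempty_iff_ne_empty] at hcon
  have hpos := (isOpen_interior.inter isOpen_interior).measure_pos volume hcon
  refine hpos.ne' (measure_mono_null (t := convexHull ℝ ((s ∩ s' : Finset (Eu d)) : Set (Eu d))) ?_
    (volume_convexHull_eq_zero ?_))
  · rw [Finset.coe_inter]
    exact (inter_subset_inter _root_.interior_subset _root_.interior_subset).trans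
      (K.inter_subset_convexHull hs.1 hs'.1)
  · by_contra hlt
    have h1 := Finset.card_le_card (Finset.inter_subset_left (s₁ := s) (s₂ := s'))
    have h2 : (s ∩ s').card = s.card := by have := hs.2; omega
    have h3 := Finset.eq_of_subset_of_card_le (Finset.inter_subset_left (s₁ := s) (s₂ := s')) h2.ge
    have h4 := Finset.eq_of_subset_of_card_le (Finset.inter_subset_right (s₁ := s) (s₂ := s'))
      (by rw [h2, hs.2, hs'.2])
    exact hne (h3.symm.trans h4)

/-- The elements of `K` as a finite set. -/
def tops (h : IsTri Ω K) : Finset (Finset (Eu d)) := h.finite_topFaces.toFinset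

theorem mem_tops (h : IsTri Ω K) {s : Finset (Eu d)} : s ∈ h.tops ↔ s ∈ topFaces K :=
  h.finite_topFaces.mem_toFinset

/-- Boundaries of convex sets are null, so the integral may be taken over the interiors of the
elements, where piecewise affine functions have a classical gradient. -/
theorem lintegral_le_sum (h : IsTri Ω K) (F : Eu d → ENNReal) :
    ∫⁻ x in Ω, F x ≤ ∑ s ∈ h.tops, ∫⁻ x in interior (convexHull ℝ (s : Set (Eu d))), F x := by
  have hsub : Ω ⊆ ⋃ s ∈ h.tops, convexHull ℝ (s : Set (Eu d)) := fun x hx => by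
    obtain ⟨s, hs, hxs⟩ := h.exists_topFace (subset_closure hx)
    exact mem_iUnion₂.2 ⟨s, h.mem_tops.2 hs, hxs⟩
  refine (lintegral_mono_set hsub).trans ((lintegral_biUnion_finset_le _ _ _).trans ?_)
  refine Finset.sum_le_sum fun s _ => le_of_eq ?_
  rw [Measure.restrict_congr_set (interior_ae_eq s)]

end IsTri

/-! ### Piecewise affine functions -/

/-- Continuous functions on `closure Ω` which are affine on each element. -/
structure IsPWAffine (Ω : Set (Eu d)) (K : Geometry.SimplicialComplex ℝ (Eu d)) (v : Eu d → ℝ) :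
    Prop where
  cont : ContinuousOn v (closure Ω)
  affine : ∀ s ∈ topFaces K, ∃ A : Eu d →ᵃ[ℝ] ℝ, EqOn v A (convexHull ℝ (s : Set (Eu d)))

namespace IsPWAffine

variable {K : Geometry.SimplicialComplex ℝ (Eu d)} {v v' : Eu d → ℝ}

theorem add (hv : IsPWAffine Ω K v) (hv' : IsPWAffine Ω K v') : IsPWAffine Ω K (v + v') := by
  refine ⟨hv.cont.add hv'.cont, fun s hs => ?_⟩
  obtain ⟨A, hA⟩ := hv.affine s hs
  obtain ⟨B, hB⟩ := hv'.affine s hs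
  exact ⟨A + B, fun x hx => by simp [hA hx, hB hx]⟩

theorem const_smul (hv : IsPWAffine Ω K v) (c : ℝ) : IsPWAffine Ω K (c • v) := by
  refine ⟨hv.cont.const_smul c, fun s hs => ?_⟩
  obtain ⟨A, hA⟩ := hv.affine s hs
  exact ⟨c • A, fun x hx => by simp [hA hx]⟩

theorem sub (hv : IsPWAffine Ω K v) (hv' : IsPWAffine Ω K v') : IsPWAffine Ω K (v - v') := by
  have := hv.add (hv'.const_smul (-1))
  rwa [neg_one_smul, ← sub_eq_add_neg] at this

theorem const (c : ℝ) : IsPWAffine Ω K (fun _ => c) :=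
  ⟨continuousOn_const, fun _ _ => ⟨AffineMap.const ℝ _ c, fun _ _ => rfl⟩⟩

theorem apply_sum (hv : IsPWAffine Ω K v) {s : Finset (Eu d)} (hs : s ∈ topFaces K)
    {w : Eu d → ℝ} {t : Finset (Eu d)} (hts : t ⊆ s) (h0 : ∀ p ∈ t, 0 ≤ w p)
    (h1 : ∑ p ∈ t, w p = 1) : v (∑ p ∈ t, w p • p) = ∑ p ∈ t, w p * v p := by
  obtain ⟨A, hA⟩ := hv.affine s hs
  rw [hA (convexHull_mono (by exact_mod_cast hts) (Finset.mem_convexHull'.2 ⟨w, h0, h1, rfl⟩)),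
    affineMap_sum A t w h1]
  exact Finset.sum_congr rfl fun p hp => by rw [hA (subset_convexHull ℝ _ (hts hp))]

/-- The values of a piecewise affine function on an element lie between its nodal values. -/
theorem abs_le_of_forall (hv : IsPWAffine Ω K v) {s : Finset (Eu d)} (hs : s ∈ topFaces K)
    {c δ : ℝ} (h : ∀ p ∈ s, |v p - c| ≤ δ) {x : Eu d} (hx : x ∈ convexHull ℝ (s : Set (Eu d))) :
    |v x - c| ≤ δ := by
  obtain ⟨w, h1, h2, h3⟩ := Finset.mem_convexHull'.1 hx
  have e : v x - c = ∑ p ∈ s, w p * (v p - c) := by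
    rw [← h3, hv.apply_sum hs subset_rfl h1 h2]
    simp only [mul_sub, Finset.sum_sub_distrib, ← Finset.sum_mul, h2, one_mul]
  rw [e]
  calc _ ≤ ∑ p ∈ s, |w p * (v p - c)| := Finset.abs_sum_le_sum_abs _ _
    _ ≤ ∑ p ∈ s, w p * δ := Finset.sum_le_sum fun p hp => by
        rw [abs_mul, abs_of_nonneg (h1 p hp)]
        exact mul_le_mul_of_nonneg_left (h p hp) (h1 p hp)
    _ = δ := by rw [← Finset.sum_mul, h2, one_mul]

/-- Close to `x`, an element that contains `y` also contains `x`; an estimate within single elements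
is therefore enough. -/
theorem locLip (h : IsTri Ω K) {L : ℝ} (hv : ∀ s ∈ topFaces K,
    ∀ x ∈ convexHull ℝ (s : Set (Eu d)), ∀ y ∈ convexHull ℝ (s : Set (Eu d)),
      |v y - v x| ≤ L * ‖y - x‖) : LocLip Ω L v := by
  intro x hx
  filter_upwards [h.eventually_mem_of_mem x, h.dom.isOpen.mem_nhds hx] with y hy hyΩ
  obtain ⟨s, hs, hys⟩ := h.exists_topFace (subset_closure hyΩ)
  exact hv s hs x (hy s hs.1 hys) y hys

theorem exists_locLip (h : IsTri Ω K) (hv : IsPWAffine Ω K v) : ∃ L, 0 ≤ L ∧ LocLip Ω L v := by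
  choose! A hA using hv.affine
  refine ⟨∑ s ∈ h.tops, ‖(A s).linear.toContinuousLinearMap‖, by positivity,
    locLip h fun s hs x hx y hy => ?_⟩
  rw [hA s hs hx, hA s hs hy]
  have h3 : A s y - A s x = (A s).linear.toContinuousLinearMap (y - x) := by
    have := (A s).linearMap_vsub y x
    simpa using this.symm
  rw [h3, ← Real.norm_eq_abs]
  refine (ContinuousLinearMap.le_opNorm _ _).trans ?_
  gcongr
  exact Finset.single_le_sum (f := fun s => ‖(A s).linear.toContinuousLinearMap‖)
    (fun _ _ => norm_nonneg _) (h.mem_tops.2 hs)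

theorem exists_H1 (h : IsTri Ω K) (hv : IsPWAffine Ω K v) :
    ∃ u : H1 Ω, fn u =ᵐ[volume.restrict Ω] v ∧ grad u =ᵐ[volume.restrict Ω] gradient v := by
  obtain ⟨L, hL, hl⟩ := hv.exists_locLip h
  exact hl.exists_H1 h.dom.isOpen h.dom.bounded hL hv.cont

/-- The gradient of a piecewise affine function on an element is controlled by its oscillation. -/
theorem norm_gradient_le (hv : IsPWAffine Ω K v) {s : Finset (Eu d)} (hs : s ∈ topFaces K)
    {c : Eu d} {ρ δ : ℝ} (hρ : 0 < ρ) (hδ : 0 ≤ δ)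
    (hball : Metric.closedBall c ρ ⊆ convexHull ℝ (s : Set (Eu d)))
    (hosc : ∀ p ∈ s, ∀ q ∈ s, |v p - v q| ≤ δ) {x : Eu d}
    (hx : x ∈ interior (convexHull ℝ (s : Set (Eu d)))) : ‖gradient v x‖ ≤ δ / ρ := by
  obtain ⟨A, hA⟩ := hv.affine s hs
  refine norm_gradient_le_of_eventually (by positivity) ?_
  filter_upwards [isOpen_interior.mem_nhds hx] with y hy
  rw [hA (interior_subset hx), hA (interior_subset hy)]
  refine norm_linear_le hρ hball (fun a ha b hb => ?_) x y
  rw [← hA ha, ← hA hb]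
  refine hv.abs_le_of_forall hs (fun p hp => ?_) ha
  rw [abs_sub_comm]
  exact hv.abs_le_of_forall hs (fun q hq => by rw [abs_sub_comm]; exact hosc p hp q hq) hb

theorem mem_V1_iff {u : H1 Ω} :
    u ∈ V1 Ω K ↔ ∃ v, IsPWAffine Ω K v ∧ fn u =ᵐ[volume.restrict Ω] v := by
  constructor
  · rintro ⟨v, h1, h2, h3⟩
    exact ⟨v, ⟨h1, fun s hs => h2 _ ⟨s, hs.1, hs.2, rfl⟩⟩, h3⟩
  · rintro ⟨v, h1, h2⟩
    refine ⟨v, h1.cont, ?_, h2⟩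
    rintro S ⟨s, hs1, hs2, rfl⟩
    exact h1.affine s ⟨hs1, hs2⟩

end IsPWAffine

/-- Nodal interpolation. -/
theorem IsTri.exists_nodal {K : Geometry.SimplicialComplex ℝ (Eu d)} (h : IsTri Ω K)
    (c : Eu d → ℝ) : ∃ v, IsPWAffine Ω K v ∧ ∀ s ∈ topFaces K, ∀ p ∈ s, v p = c p := by
  classical
  choose! A hA using fun (s : Finset (Eu d)) (hs : s ∈ topFaces K) =>
    exists_affineMap (K.indep hs.1) hs.2 c
  -- Conformity: the intersection of two elements lies in the hull of their common vertices, where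
  -- both affine functions take the prescribed values.
  have hagree : ∀ s ∈ topFaces K, ∀ s' ∈ topFaces K, ∀ x ∈ convexHull ℝ (s : Set (Eu d)),
      x ∈ convexHull ℝ (s' : Set (Eu d)) → A s x = A s' x := by
    intro s hs s' hs' x hx hx'
    refine affineMap_eqOn_convexHull ?_ (K.inter_subset_convexHull hs.1 hs'.1 ⟨hx, hx'⟩)
    rintro p ⟨hp, hp'⟩
    rw [hA s hs p hp, hA s' hs' p hp']
  let v : Eu d → ℝ := fun x => if hx : ∃ s ∈ topFaces K, x ∈ convexHull ℝ (s : Set (Eu d)) then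
    A hx.choose x else 0
  have hv : ∀ s ∈ topFaces K, EqOn v (A s) (convexHull ℝ (s : Set (Eu d))) := by
    intro s hs x hx
    have hex : ∃ s ∈ topFaces K, x ∈ convexHull ℝ (s : Set (Eu d)) := ⟨s, hs, hx⟩
    simp only [v, dif_pos hex]
    exact hagree _ hex.choose_spec.1 s hs x hex.choose_spec.2 hx
  refine ⟨v, ⟨?_, fun s hs => ⟨A s, hv s hs⟩⟩, fun s hs p hp => ?_⟩
  · have hcl : closure Ω = ⋃ s : topFaces K, convexHull ℝ ((s : Finset (Eu d)) : Set (Eu d)) := by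
      refine Subset.antisymm (fun x hx => ?_) (iUnion_subset fun s => h.convexHull_subset s.2.1)
      obtain ⟨s, hs, hxs⟩ := h.exists_topFace hx
      exact mem_iUnion.2 ⟨⟨s, hs⟩, hxs⟩
    rw [hcl]
    have : Finite (topFaces K) := h.finite_topFaces
    refine (locallyFinite_of_finite _).continuousOn_iUnion
      (fun s => IsTri.isClosed_convexHull _) fun s => ?_
    exact ((A s).continuous_of_finiteDimensional.continuousOn).congr (hv s s.2)
  · rw [hv s hs (subset_convexHull ℝ _ hp), hA s hs p hp]

/-! ### Poincaré inequality -/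

/-- The Jacobian of `y ↦ a + t • y` contributes `t⁻ᵈ ≤ 2ᵈ`. -/
theorem lintegral_comp_add_smul_le {G : Eu d → ENNReal} (hG : Measurable G) (a : Eu d) {t : ℝ}
    (ht : 1 / 2 ≤ t) : ∫⁻ y, G (a + t • y) ≤ 2 ^ d * ∫⁻ y, G y := by
  have h0 : 0 < t := by linarith
  have h1 : ∫⁻ y, G (a + t • y) = ∫⁻ z, G (a + z) ∂(Measure.map (t • · : Eu d → Eu d) volume) := by
    rw [lintegral_map (by fun_prop) (by fun_prop)]
  rw [h1, Measure.map_addHaar_smul _ h0.ne', lintegral_smul_measure, lintegral_add_left_eq_self G,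
    finrank_euclideanSpace_fin, smul_eq_mul]
  gcongr
  have : |(t ^ d)⁻¹| ≤ 2 ^ d := by
    rw [abs_of_nonneg (by positivity), ← inv_pow]
    refine pow_le_pow_left₀ (by positivity) ?_ _
    rw [inv_le_comm₀ h0 two_pos]
    linarith
  refine (ENNReal.ofReal_le_ofReal this).trans_eq ?_
  rw [ENNReal.ofReal_pow zero_le_two, ENNReal.ofReal_ofNat]

/-- The double integral of the squared increments over `A × B` is controlled by the Dirichlet
integral over `Ω`. -/
def Linked (Ω A B : Set (Eu d)) : Prop :=
  ∃ C : ENNReal, C ≠ ⊤ ∧ ∀ φ : Eu d → ℝ, ContDiff ℝ 1 φ →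
    ∫⁻ x in A, ∫⁻ y in B, ‖φ y - φ x‖ₑ ^ 2 ≤ C * ∫⁻ x in Ω, ‖gradient φ x‖ₑ ^ 2

theorem Linked.mono {A B A' B' : Set (Eu d)} (h : Linked Ω A B) (hA : A' ⊆ A) (hB : B' ⊆ B) :
    Linked Ω A' B' := by
  obtain ⟨C, hC, h⟩ := h
  exact ⟨C, hC, fun φ hφ => (lintegral_mono' (Measure.restrict_mono_set _ hA)
    fun x => lintegral_mono_set hB).trans (h φ hφ)⟩

theorem measurable_enorm_sub_sq {φ : Eu d → ℝ} (hφ : ContDiff ℝ 1 φ) :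
    Measurable fun p : Eu d × Eu d => ‖φ p.2 - φ p.1‖ₑ ^ 2 := by
  have := hφ.continuous
  exact (by fun_prop : Continuous fun p : Eu d × Eu d => ‖φ p.2 - φ p.1‖ₑ ^ 2).measurable

theorem Linked.symm {A B : Set (Eu d)} (h : Linked Ω A B) : Linked Ω B A := by
  obtain ⟨C, hC, h⟩ := h
  refine ⟨C, hC, fun φ hφ => le_trans (le_of_eq ?_) (h φ hφ)⟩
  rw [lintegral_lintegral_swap (measurable_enorm_sub_sq hφ).aemeasurable]
  refine lintegral_congr fun x => lintegral_congr fun y => ?_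
  rw [← enorm_neg, neg_sub]

/-- The increment from `x` to `z` is split at an intermediate point `y`. Integration over all `y` in
the overlap, and division by its positive volume, chains the two estimates. -/
theorem Linked.trans {A B B' E : Set (Eu d)} (h : Linked Ω A B) (h' : Linked Ω B' E)
    (hB : volume (B ∩ B') ≠ 0) (hB' : volume (B ∩ B') ≠ ⊤) (hA : volume A ≠ ⊤)
    (hE : volume E ≠ ⊤) : Linked Ω A E := by
  obtain ⟨C, hC, h⟩ := h.mono subset_rfl (inter_subset_left (t := B'))
  obtain ⟨C', hC', h'⟩ := h'.mono (inter_subset_right (s := B)) subset_rfl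
  set S := B ∩ B' with hS
  refine ⟨(volume S)⁻¹ * (2 * (volume E * C + volume A * C')), ?_, fun φ hφ => ?_⟩
  · refine ENNReal.mul_ne_top (ENNReal.inv_ne_top.2 hB) (ENNReal.mul_ne_top (by simp) ?_)
    exact ENNReal.add_ne_top.2 ⟨ENNReal.mul_ne_top hE hC, ENNReal.mul_ne_top hA hC'⟩
  have hm := measurable_enorm_sub_sq hφ
  have hc := hφ.continuous
  have h1 : volume S * ∫⁻ x in A, ∫⁻ z in E, ‖φ z - φ x‖ₑ ^ 2 ≤
      2 * (volume E * ∫⁻ x in A, ∫⁻ y in S, ‖φ y - φ x‖ₑ ^ 2) +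
      2 * (volume A * ∫⁻ y in S, ∫⁻ z in E, ‖φ z - φ y‖ₑ ^ 2) := by
    have e1 : volume S * ∫⁻ x in A, ∫⁻ z in E, ‖φ z - φ x‖ₑ ^ 2 =
        ∫⁻ x in A, ∫⁻ z in E, (∫⁻ _ in S, ‖φ z - φ x‖ₑ ^ 2) := by
      simp_rw [setLIntegral_const]
      rw [← lintegral_const_mul' _ _ hB']
      refine lintegral_congr fun x => ?_
      rw [lintegral_mul_const' _ _ hB', mul_comm]
    rw [e1]
    calc _ ≤ ∫⁻ x in A, ∫⁻ z in E, ((∫⁻ y in S, 2 * ‖φ y - φ x‖ₑ ^ 2) +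
          ∫⁻ y in S, 2 * ‖φ z - φ y‖ₑ ^ 2) := by
          refine lintegral_mono fun x => lintegral_mono fun z => ?_
          rw [← lintegral_add_left (by fun_prop)]
          refine lintegral_mono fun y => ?_
          rw [← mul_add, add_comm]
          refine le_trans (le_of_eq ?_) (enorm_add_sq_le _ _)
          rw [sub_add_sub_cancel]
      _ = (∫⁻ x in A, ∫⁻ z in E, (∫⁻ y in S, 2 * ‖φ y - φ x‖ₑ ^ 2)) +
          ∫⁻ x in A, ∫⁻ z in E, (∫⁻ y in S, 2 * ‖φ z - φ y‖ₑ ^ 2) := by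
          rw [← lintegral_add_left]
          · refine lintegral_congr fun x => ?_
            rw [← lintegral_add_left measurable_const]
          · simp_rw [setLIntegral_const]
            refine Measurable.mul_const ?_ _
            exact Measurable.lintegral_prod_right' (f := fun p : Eu d × Eu d =>
              2 * ‖φ p.2 - φ p.1‖ₑ ^ 2) (hm.const_mul 2)
      _ = _ := by
          congr 1
          · simp_rw [setLIntegral_const, lintegral_const_mul' _ _ ENNReal.ofNat_ne_top]
            rw [lintegral_mul_const' _ _ hE, lintegral_const_mul' _ _ ENNReal.ofNat_ne_top]
            ring
          · rw [setLIntegral_const]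
            simp_rw [lintegral_const_mul' _ (fun _ => _ ^ 2) ENNReal.ofNat_ne_top]
            rw [lintegral_const_mul' _ _ ENNReal.ofNat_ne_top,
              lintegral_lintegral_swap (f := fun z y => ‖φ z - φ y‖ₑ ^ 2)]
            · ring
            · exact (hm.comp measurable_swap).aemeasurable
  rw [mul_assoc, ← ENNReal.div_eq_inv_mul, ENNReal.le_div_iff_mul_le (Or.inl hB) (Or.inl hB'),
    mul_comm]
  refine h1.trans ?_
  calc _ ≤ 2 * (volume E * (C * ∫⁻ x in Ω, ‖gradient φ x‖ₑ ^ 2)) +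
        2 * (volume A * (C' * ∫⁻ x in Ω, ‖gradient φ x‖ₑ ^ 2)) := by
        gcongr
        · exact h φ hφ
        · exact h' φ hφ
    _ = _ := by ring

/-- The increments are integrals of the gradient over segments inside `D`. After the order of
integration is changed, one endpoint is used as the variable of integration at each parameter `s`.
-/
theorem linked_of_convex {D : Set (Eu d)} (hDo : IsOpen D) (hDc : Convex ℝ D)
    (hDb : Bornology.IsBounded D) (hD : D ⊆ Ω) : Linked Ω D D := by
  obtain ⟨R, hR⟩ := hDb.exists_norm_le
  have hvol : volume D ≠ ⊤ := hDb.measure_lt_top.ne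
  refine ⟨ENNReal.ofReal (2 * R) ^ 2 * (volume D * 2 ^ d), by finiteness, fun φ hφ => ?_⟩
  set G : Eu d → ENNReal := D.indicator fun x => ‖gradient φ x‖ₑ ^ 2 with hG
  have hGm : Measurable G :=
    ((measurable_gradient φ).enorm.pow_const 2).indicator hDo.measurableSet
  have hGi : ∫⁻ x, G x ≤ ∫⁻ x in Ω, ‖gradient φ x‖ₑ ^ 2 := by
    rw [hG, lintegral_indicator hDo.measurableSet]
    exact lintegral_mono_set hD
  have hH : Measurable fun p : (Eu d × Eu d) × ℝ => G (p.1.1 + p.2 • (p.1.2 - p.1.1)) :=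
    hGm.comp (by fun_prop)
  have hpt : ∀ x ∈ D, ∀ y ∈ D, ‖φ y - φ x‖ₑ ^ 2 ≤ ENNReal.ofReal (2 * R) ^ 2 *
      ∫⁻ s in Ioc (0 : ℝ) 1, G (x + s • (y - x)) := by
    intro x hx y hy
    have := enorm_sub_sq_le_lintegral hφ x (y - x)
    rw [add_sub_cancel] at this
    refine this.trans ?_
    have hn : ‖y - x‖ₑ ≤ ENNReal.ofReal (2 * R) := by
      rw [← ofReal_norm]
      exact ENNReal.ofReal_le_ofReal ((norm_sub_le _ _).trans (by linarith [hR x hx, hR y hy]))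
    gcongr ?_ ^ 2 * ?_
    refine le_of_eq (setLIntegral_congr_fun measurableSet_Ioc fun s hs => ?_)
    have : x + s • (y - x) ∈ D := hDc.add_smul_sub_mem hx hy ⟨hs.1.le, hs.2⟩
    simp only [hG, indicator_of_mem this]
  have hs : ∀ s ∈ Ioc (0 : ℝ) 1, ∫⁻ x in D, ∫⁻ y in D, G (x + s • (y - x)) ≤
      volume D * 2 ^ d * ∫⁻ x, G x := by
    intro s _
    -- The point `x + s • (y - x)` depends on `y` with factor `s` and on `x` with factor `1 - s`.
    -- One of the factors is at least `1 / 2`, so the Jacobian never degenerates.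
    rcases le_total (1 / 2) s with h | h
    · calc _ ≤ ∫⁻ _ in D, 2 ^ d * ∫⁻ x, G x := by
            refine lintegral_mono fun x => (setLIntegral_le_lintegral _ _).trans ?_
            refine le_trans (le_of_eq (lintegral_congr fun y => ?_))
              (lintegral_comp_add_smul_le hGm (x - s • x) h)
            congr 1; rw [smul_sub]; abel
        _ = _ := by rw [setLIntegral_const]; ring
    · rw [lintegral_lintegral_swap]
      · calc _ ≤ ∫⁻ _ in D, 2 ^ d * ∫⁻ x, G x := by
              refine lintegral_mono fun y => (setLIntegral_le_lintegral _ _).trans ?_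
              refine le_trans (le_of_eq (lintegral_congr fun x => ?_))
                (lintegral_comp_add_smul_le hGm (s • y) (t := 1 - s) (by linarith))
              congr 1; rw [smul_sub, sub_smul, one_smul]; abel
          _ = _ := by rw [setLIntegral_const]; ring
      · exact (hGm.comp (by fun_prop : Measurable fun p : Eu d × Eu d =>
          p.1 + s • (p.2 - p.1))).aemeasurable
  calc _ ≤ ∫⁻ x in D, ∫⁻ y in D, ENNReal.ofReal (2 * R) ^ 2 *
        ∫⁻ s in Ioc (0 : ℝ) 1, G (x + s • (y - x)) :=
        setLIntegral_mono' hDo.measurableSet fun x hx =>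
          setLIntegral_mono' hDo.measurableSet fun y hy => hpt x hx y hy
    _ = ENNReal.ofReal (2 * R) ^ 2 * ∫⁻ x in D, ∫⁻ y in D,
        (∫⁻ s in Ioc (0 : ℝ) 1, G (x + s • (y - x))) := by
        rw [← lintegral_const_mul' _ _ (by finiteness)]
        refine lintegral_congr fun x => ?_
        rw [lintegral_const_mul' _ _ (by finiteness)]
    _ = ENNReal.ofReal (2 * R) ^ 2 * ∫⁻ s in Ioc (0 : ℝ) 1, (∫⁻ x in D, ∫⁻ y in D,
        G (x + s • (y - x))) := by
        congr 1
        rw [lintegral_lintegral_swap (f := fun s x => ∫⁻ y in D, G (x + s • (y - x)))]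
        · refine lintegral_congr fun x => ?_
          rw [lintegral_lintegral_swap]
          exact (hGm.comp (by fun_prop : Measurable fun p : Eu d × ℝ =>
            x + p.2 • (p.1 - x))).aemeasurable
        · refine (Measurable.lintegral_prod_right' (f := fun p : (ℝ × Eu d) × Eu d =>
            G (p.1.2 + p.1.1 • (p.2 - p.1.2))) (hGm.comp (by fun_prop))).aemeasurable
    _ ≤ ENNReal.ofReal (2 * R) ^ 2 * ∫⁻ s in Ioc (0 : ℝ) 1, (volume D * 2 ^ d * ∫⁻ x, G x) := by
        refine mul_le_mul_right ?_ _
        exact setLIntegral_mono' measurableSet_Ioc hs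
    _ ≤ _ := by
        rw [setLIntegral_const, Real.volume_Ioc]
        simp only [sub_zero, ENNReal.ofReal_one, mul_one]
        rw [mul_assoc (ENNReal.ofReal (2 * R) ^ 2)]
        gcongr

namespace IsTri

variable {K : Geometry.SimplicialComplex ℝ (Eu d)}

/-- Connectedness links neighbourhoods of any two points of `Ω`. Through the convexity of each
element this extends to whole interiors of elements, and finitely many of them cover `Ω` up to a
null set. The triangulation thus replaces any analysis at the boundary. -/
theorem linked_self (h : IsTri Ω K) : Linked Ω Ω Ω := by
  have hfin : ∀ S : Set (Eu d), S ⊆ Ω → volume S ≠ ⊤ := fun S hS =>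
    (h.dom.bounded.subset hS).measure_lt_top.ne
  have hP : ∀ x ∈ Ω, ∀ y ∈ Ω, ∃ U V : Set (Eu d), IsOpen U ∧ IsOpen V ∧ U ⊆ Ω ∧ V ⊆ Ω ∧ x ∈ U ∧
      y ∈ V ∧ Linked Ω U V := by
    intro x hx y hy
    refine h.dom.connected.isPreconnected.induction₂ (fun x y => ∃ U V : Set (Eu d),
      IsOpen U ∧ IsOpen V ∧ U ⊆ Ω ∧ V ⊆ Ω ∧ x ∈ U ∧ y ∈ V ∧ Linked Ω U V) ?_ ?_ ?_ hx hy
    · intro x hx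
      obtain ⟨r, hr, hb⟩ := Metric.isOpen_iff.1 h.dom.isOpen x hx
      refine mem_nhdsWithin_of_mem_nhds ?_
      filter_upwards [Metric.ball_mem_nhds x hr] with y hy
      exact ⟨_, _, Metric.isOpen_ball, Metric.isOpen_ball, hb, hb, Metric.mem_ball_self hr, hy,
        linked_of_convex Metric.isOpen_ball (convex_ball x r) Metric.isBounded_ball hb⟩
    · rintro x y z _ _ _ ⟨U, V, hU, hV, hUΩ, hVΩ, hxU, hyV, hUV⟩
        ⟨U', V', hU', hV', hUΩ', hVΩ', hyU', hzV', hUV'⟩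
      exact ⟨U, V', hU, hV', hUΩ, hVΩ', hxU, hzV', hUV.trans hUV'
        ((hV.inter hU').measure_pos volume ⟨y, hyV, hyU'⟩).ne'
        (hfin _ (inter_subset_left.trans hVΩ)) (hfin _ hUΩ) (hfin _ hVΩ')⟩
    · rintro x y _ _ ⟨U, V, hU, hV, hUΩ, hVΩ, hxU, hyV, hUV⟩
      exact ⟨V, U, hV, hU, hVΩ, hUΩ, hyV, hxU, hUV.symm⟩
  let D : Finset (Eu d) → Set (Eu d) := fun s => interior (convexHull ℝ (s : Set (Eu d)))
  have hDs : ∀ s ∈ topFaces K, Linked Ω (D s) (D s) := fun s hs =>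
    linked_of_convex isOpen_interior (convex_convexHull ℝ _).interior
      (h.dom.bounded.subset (h.interior_subset hs.1)) (h.interior_subset hs.1)
  have hDD : ∀ s ∈ topFaces K, ∀ t ∈ topFaces K, Linked Ω (D s) (D t) := by
    intro s hs t ht
    rcases (D s).eq_empty_or_nonempty with he | ⟨x, hx⟩
    · exact ⟨0, by simp, fun φ _ => by simp [he]⟩
    rcases (D t).eq_empty_or_nonempty with he | ⟨y, hy⟩
    · exact ⟨0, by simp, fun φ _ => by simp [he]⟩
    obtain ⟨U, V, hU, hV, hUΩ, hVΩ, hxU, hyV, hUV⟩ :=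
      hP x (h.interior_subset hs.1 hx) y (h.interior_subset ht.1 hy)
    have h1 := (hDs s hs).trans hUV ((isOpen_interior.inter hU).measure_pos volume ⟨x, hx, hxU⟩).ne'
      (hfin _ (inter_subset_right.trans hUΩ)) (hfin _ (h.interior_subset hs.1)) (hfin _ hVΩ)
    exact h1.trans (hDs t ht) ((hV.inter isOpen_interior).measure_pos volume ⟨y, hyV, hy⟩).ne'
      (hfin _ (inter_subset_left.trans hVΩ)) (hfin _ (h.interior_subset hs.1))
      (hfin _ (h.interior_subset ht.1))
  choose! C hC hC' using hDD
  refine ⟨∑ s ∈ h.tops, ∑ t ∈ h.tops, C s t, ?_, fun φ hφ => ?_⟩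
  · refine ENNReal.sum_ne_top.2 fun s hs => ENNReal.sum_ne_top.2 fun t ht => ?_
    exact hC s (h.mem_tops.1 hs) t (h.mem_tops.1 ht)
  refine (lintegral_mono fun x => h.lintegral_le_sum _).trans ?_
  rw [lintegral_finsetSum]
  · rw [Finset.sum_comm, Finset.sum_mul]
    refine Finset.sum_le_sum fun t ht => ?_
    refine (h.lintegral_le_sum _).trans ?_
    rw [Finset.sum_mul]
    exact Finset.sum_le_sum fun s hs => hC' s (h.mem_tops.1 hs) t (h.mem_tops.1 ht) φ hφ
  · intro t _
    exact Measurable.lintegral_prod_right' (measurable_enorm_sub_sq hφ)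

end IsTri

/-! ### Constant functions and the boundary mean -/

namespace IsLipDomain

theorem exists_one (hΩ : IsLipDomain Ω) : ∃ e : H1 Ω, fn e =ᵐ[volume.restrict Ω] (fun _ => (1 : ℝ)) ∧
    grad e = 0 ∧ (trace e : L2Bd Ω) =ᵐ[surfaceMeasure Ω] fun _ => (1 : ℝ) := by
  obtain ⟨e, he⟩ := exists_H1_of_contDiff hΩ.isOpen hΩ.bounded
    (contDiff_const (c := (1 : ℝ)) : ContDiff ℝ 1 (fun _ : Eu d => (1 : ℝ)))
  refine ⟨e, he.1, ?_, hΩ.trace_ae_eq continuousOn_const he.1⟩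
  refine (Lp.eq_zero_iff_ae_eq_zero).2 (he.2.trans (Eventually.of_forall fun x => ?_))
  exact gradient_const x 1

/-- The integral of the trace over the boundary. -/
def bdMean (hΩ : IsLipDomain Ω) : H1 Ω →L[ℝ] ℝ :=
  have : IsFiniteMeasure (surfaceMeasure Ω) := hΩ.isFiniteMeasure_surface
  (innerSL ℝ (indicatorConstLp 2 MeasurableSet.univ
    (measure_ne_top (surfaceMeasure Ω) univ) (1 : ℝ))).comp hΩ.traceL

theorem bdMean_apply (hΩ : IsLipDomain Ω) (u : H1 Ω) :
    hΩ.bdMean u = ∫ s, (trace u : L2Bd Ω) s ∂(surfaceMeasure Ω) := by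
  have : IsFiniteMeasure (surfaceMeasure Ω) := hΩ.isFiniteMeasure_surface
  have := L2.inner_indicatorConstLp_one (𝕜 := ℝ) MeasurableSet.univ
    (measure_ne_top (surfaceMeasure Ω) univ) (trace u : L2Bd Ω)
  rw [setIntegral_univ] at this
  exact this

theorem mem_H1Mean0_iff (hΩ : IsLipDomain Ω) {u : H1 Ω} : u ∈ H1Mean0 Ω ↔ hΩ.bdMean u = 0 := by
  rw [bdMean_apply]; rfl

theorem bdMean_pos (hΩ : IsLipDomain Ω) {e : H1 Ω}
    (he : (trace e : L2Bd Ω) =ᵐ[surfaceMeasure Ω] fun _ => (1 : ℝ)) : 0 < hΩ.bdMean e := by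
  have : IsFiniteMeasure (surfaceMeasure Ω) := hΩ.isFiniteMeasure_surface
  have : NeZero (surfaceMeasure Ω) := ⟨surfaceMeasure_ne_zero hΩ.one_le hΩ.isOpen hΩ.bounded
    hΩ.connected.nonempty hΩ.lip⟩
  rw [bdMean_apply, integral_congr_ae he, integral_const, smul_eq_mul, mul_one]
  exact measureReal_univ_pos

end IsLipDomain

/-- There is a point `x` at which `∫ |φ y - φ x|² dy` does not exceed its mean over `x`. The
constant is the value of `φ` there. -/
theorem Linked.exists_norm_sub_le (hΩ : IsLipDomain Ω) (hl : Linked Ω Ω Ω) {e : H1 Ω}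
    (he : fn e =ᵐ[volume.restrict Ω] fun _ => (1 : ℝ)) (he' : grad e = 0) :
    ∃ C : ℝ, 0 ≤ C ∧ ∀ (φ : Eu d → ℝ) (w : H1 Ω), ContDiff ℝ 1 φ →
      fn w =ᵐ[volume.restrict Ω] φ → ∃ c : ℝ, ‖w - c • e‖ ≤ C * ‖grad w‖ := by
  obtain ⟨C, hC, h⟩ := hl
  have hv0 : volume Ω ≠ 0 := (hΩ.isOpen.measure_pos volume hΩ.connected.nonempty).ne'
  have hv1 : volume Ω ≠ ⊤ := hΩ.bounded.measure_lt_top.ne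
  refine ⟨√(C / volume Ω).toReal + 1, by positivity, fun φ w hφ hw => ?_⟩
  obtain ⟨x, hx, hle⟩ := exists_le_setLAverage hv0 hv1
    (Measurable.lintegral_prod_right' (ν := volume.restrict Ω)
      (measurable_enorm_sub_sq hφ)).aemeasurable
  rw [setLAverage_eq] at hle
  refine ⟨φ x, ?_⟩
  have hg := grad_eq_of_contDiff hΩ.isOpen hΩ.bounded hφ hw
  have h2 : ‖fn (w - φ x • e)‖ ^ 2 ≤ (C / volume Ω).toReal * ‖grad w‖ ^ 2 := by
    refine norm_sq_le_of_lintegral_le (g := fun y => φ y - φ x) ?_ (by positivity) ?_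
    · rw [fn_sub, fn_smul]
      filter_upwards [Lp.coeFn_sub (fn w) (φ x • fn e), Lp.coeFn_smul (φ x) (fn e), hw, he]
        with y h1 h2 h3 h4
      rw [h1, Pi.sub_apply, h2, Pi.smul_apply, h3, h4, smul_eq_mul, mul_one]
    · refine hle.trans ?_
      rw [ENNReal.ofReal_mul ENNReal.toReal_nonneg,
        ENNReal.ofReal_toReal (ENNReal.div_ne_top hC hv0), ofReal_norm_sq_eq_lintegral,
        ENNReal.div_eq_inv_mul, ENNReal.div_eq_inv_mul, mul_assoc]
      refine mul_le_mul_right ((h φ hφ).trans_eq ?_) _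
      congr 1
      exact lintegral_congr_ae (hg.mono fun y hy => by simp only [hy])
  have h3 : ‖fn (w - φ x • e)‖ ≤ √(C / volume Ω).toReal * ‖grad w‖ := by
    refine le_of_sq_le_sq ?_ (by positivity)
    rwa [mul_pow, Real.sq_sqrt ENNReal.toReal_nonneg]
  refine (norm_le_fn_add_grad _).trans ?_
  rw [grad_sub, grad_smul, he', smul_zero, sub_zero]
  linarith

/-- **Poincaré inequality** for functions with zero boundary mean. -/
theorem IsTri.exists_norm_le_grad {K : Geometry.SimplicialComplex ℝ (Eu d)} (h : IsTri Ω K) :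
    ∃ C : ℝ, 0 ≤ C ∧ ∀ u ∈ H1Mean0 Ω, ‖u‖ ≤ C * ‖grad u‖ := by
  obtain ⟨e, he1, he2, he3⟩ := h.dom.exists_one
  obtain ⟨C, hC, hP⟩ := h.linked_self.exists_norm_sub_le h.dom he1 he2
  have hm := h.dom.bdMean_pos he3
  set m := h.dom.bdMean e with hmdef
  -- Since `u` has zero boundary mean, `u - c • e` has boundary mean `-c m`. This bounds `|c|` by
  -- `‖u - c • e‖`, and `D` is the resulting cost of removing the constant.
  set D := 1 + ‖h.dom.bdMean‖ / m * ‖e‖ with hD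
  have hD0 : 1 ≤ D := by rw [hD]; have : 0 ≤ ‖h.dom.bdMean‖ / m * ‖e‖ := by positivity
                         linarith
  refine ⟨D * C, by positivity, fun u hu => le_of_forall_pos_le_add fun ε hε => ?_⟩
  set η := ε / (D * (1 + C)) with hη
  have hη0 : 0 < η := by positivity
  obtain ⟨φ, w, hφ, hw, hwu⟩ := exists_smooth_close h.dom.isOpen h.dom.bounded h.dom.lip u hη0
  obtain ⟨c, hc⟩ := hP φ w (hφ.of_le (by exact_mod_cast le_top)) hw
  have hgw : ‖grad w‖ ≤ ‖grad u‖ + η := by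
    have h1 : ‖grad (w - u)‖ ≤ η := (norm_grad_le _).trans hwu
    have h2 : grad w = grad u + grad (w - u) := by rw [grad_sub]; abel
    rw [h2]
    exact (norm_add_le _ _).trans (by linarith)
  have hX : ‖u - c • e‖ ≤ η + C * (‖grad u‖ + η) := by
    have : u - c • e = (w - c • e) - (w - u) := by abel
    rw [this]
    refine (norm_sub_le _ _).trans ?_
    have := mul_le_mul_of_nonneg_left hgw hC
    linarith
  set X := η + C * (‖grad u‖ + η) with hXdef
  have hcm : |c| * m ≤ ‖h.dom.bdMean‖ * X := by
    have h1 : h.dom.bdMean (u - c • e) = - (c * m) := by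
      rw [map_sub, map_smul, h.dom.mem_H1Mean0_iff.1 hu, smul_eq_mul, zero_sub]
    have h2 := h.dom.bdMean.le_opNorm (u - c • e)
    rw [h1, norm_neg, norm_mul, Real.norm_of_nonneg hm.le, Real.norm_eq_abs] at h2
    exact h2.trans (by gcongr)
  have hc' : |c| ≤ ‖h.dom.bdMean‖ / m * X := by
    rw [div_mul_eq_mul_div, le_div_iff₀ hm]; exact hcm
  have h3 : ‖u‖ ≤ D * X := by
    have : u = (u - c • e) + c • e := by abel
    calc ‖u‖ ≤ ‖u - c • e‖ + ‖c • e‖ := by conv_lhs => rw [this]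
                                           exact norm_add_le _ _
      _ ≤ X + ‖h.dom.bdMean‖ / m * X * ‖e‖ := by
          rw [norm_smul, Real.norm_eq_abs]; gcongr
      _ = D * X := by rw [hD]; ring
  have h4 : D * X = D * C * ‖grad u‖ + D * (1 + C) * η := by rw [hXdef]; ring
  have h5 : D * (1 + C) * η = ε := by rw [hη]; field_simp
  linarith

/-! ### Faces of a simplex -/

theorem exists_eq_of_mem_convexHull_insert {A : Eu d →ᵃ[ℝ] ℝ} {p : Eu d} {t : Set (Eu d)}
    (ht : t.Nonempty) (hp : A p = 1) (hA : ∀ x ∈ t, A x = 0) {y : Eu d}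
    (hy : y ∈ convexHull ℝ (insert p t)) :
    0 ≤ A y ∧ A y ≤ 1 ∧ ∃ z ∈ convexHull ℝ t, y = A y • p + (1 - A y) • z := by
  rw [convexHull_insert ht, convexJoin_singleton_left, mem_iUnion₂] at hy
  obtain ⟨z, hz, a, b, ha, hb, hab, rfl⟩ := hy
  have hz0 : A z = 0 := affineMap_eqOn_convexHull (B := AffineMap.const ℝ _ 0) hA hz
  have : A (a • p + b • z) = a := by
    have := Convex.combo_affine_apply (f := A) (x := p) (y := z) hab
    rw [this, hp, hz0]; simp
  rw [this]
  refine ⟨ha, by linarith, z, hz, ?_⟩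
  rw [← hab, add_sub_cancel_left]

/-- The slice of the ball at the height of its centre is projected from the apex `p` to the opposite
facet. This projection expands lengths by `(1 - A c)⁻¹ ≥ 1`, so the image contains a ball of radius
`ρ` in the facet. -/
theorem exists_ball_subset_face {A : Eu d →ᵃ[ℝ] ℝ} {p c : Eu d} {t : Set (Eu d)} {ρ : ℝ}
    (hρ : 0 < ρ) (ht : t.Nonempty) (hp : A p = 1) (hA : ∀ x ∈ t, A x = 0)
    (hball : Metric.closedBall c ρ ⊆ convexHull ℝ (insert p t)) :
    ∃ c', ∀ v, A.linear v = 0 → ‖v‖ ≤ ρ → c' + v ∈ convexHull ℝ t := by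
  have hadd : ∀ x v, A (x + v) = A x + A.linear v := fun x v => by
    have := A.map_vadd x v
    simpa [add_comm] using this
  obtain ⟨h0, h1, -⟩ := exists_eq_of_mem_convexHull_insert ht hp hA
    (hball (Metric.mem_closedBall_self hρ.le))
  -- Moving from the centre towards `p` increases `A` strictly and stays in the simplex, where `A ≤
  -- 1`.
  have h1' : A c < 1 := by
    obtain ⟨x, hx⟩ := ht
    have hl : A.linear (p - x) = 1 := by
      have := hadd x (p - x)
      rw [add_sub_cancel, hp, hA x hx] at this
      linarith
    have hne : 0 < ‖p - x‖ := by
      rw [norm_pos_iff]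
      intro h
      rw [h, map_zero] at hl
      exact zero_ne_one hl
    have hm : c + (ρ / ‖p - x‖) • (p - x) ∈ Metric.closedBall c ρ := by
      rw [mem_closedBall_iff_norm, add_sub_cancel_left, norm_smul,
        Real.norm_of_nonneg (by positivity), div_mul_cancel₀ _ hne.ne']
    have := (exists_eq_of_mem_convexHull_insert ⟨x, hx⟩ hp hA (hball hm)).2.1
    rw [hadd, map_smul, hl, smul_eq_mul, mul_one] at this
    have : 0 < ρ / ‖p - x‖ := by positivity
    linarith
  set a := A c
  refine ⟨(1 - a)⁻¹ • (c - a • p), fun v hv hvn => ?_⟩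
  have hm : c + (1 - a) • v ∈ Metric.closedBall c ρ := by
    rw [mem_closedBall_iff_norm, add_sub_cancel_left, norm_smul,
      Real.norm_of_nonneg (by linarith)]
    nlinarith [norm_nonneg v]
  obtain ⟨-, -, z, hz, e⟩ := exists_eq_of_mem_convexHull_insert ht hp hA (hball hm)
  rw [hadd, map_smul, hv, smul_zero, add_zero] at e
  have : (1 - a)⁻¹ • (c - a • p) + v = z := by
    have h2 : c - a • p = (1 - a) • (z - v) := by
      rw [smul_sub]
      have : c = a • p + (1 - a) • z - (1 - a) • v := eq_sub_of_add_eq e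
      conv_lhs => rw [this]
      abel
    rw [h2, smul_smul, inv_mul_cancel₀ (by linarith), one_smul, sub_add_cancel]
  rwa [this]

/-- A constant depending only on the dimension. -/
def faceConst (d : ℕ) : ENNReal :=
  Measure.hausdorffMeasure ((d - 1 : ℕ) : ℝ) (Metric.closedBall (0 : Eu (d - 1)) 1)

theorem faceConst_ne_zero (d : ℕ) : faceConst d ≠ 0 := by
  have : (Measure.hausdorffMeasure ((d - 1 : ℕ) : ℝ) : Measure (Eu (d - 1))).IsAddHaarMeasure := by
    have := isAddHaarMeasure_hausdorffMeasure (E := Eu (d - 1))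
    rwa [finrank_euclideanSpace_fin] at this
  exact (Metric.measure_closedBall_pos _ _ one_pos).ne'

theorem faceConst_ne_top (d : ℕ) : faceConst d ≠ ⊤ := by
  have : (Measure.hausdorffMeasure ((d - 1 : ℕ) : ℝ) : Measure (Eu (d - 1))).IsAddHaarMeasure := by
    have := isAddHaarMeasure_hausdorffMeasure (E := Eu (d - 1))
    rwa [finrank_euclideanSpace_fin] at this
  exact measure_closedBall_lt_top.ne

/-- If a simplex contains a ball of radius `ρ`, its facets have surface at least
`faceConst d * ρ ^ (d - 1)`. -/
theorem le_hausdorffMeasure_facet (hd : 1 ≤ d) {s t : Finset (Eu d)}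
    (hs : AffineIndependent ℝ ((↑) : s → Eu d)) (hsc : s.card = d + 1) (hts : t ⊆ s)
    (htc : t.card = d) {c : Eu d} {ρ : ℝ} (hρ : 0 < ρ)
    (hball : Metric.closedBall c ρ ⊆ convexHull ℝ (s : Set (Eu d))) :
    ENNReal.ofReal (ρ ^ (d - 1)) * faceConst d ≤
      Measure.hausdorffMeasure ((d : ℝ) - 1) (convexHull ℝ (t : Set (Eu d))) := by
  classical
  obtain ⟨p, hps, hpt⟩ : ∃ p ∈ s, p ∉ t := by
    by_contra! hcon
    have := Finset.card_le_card (show s ⊆ t from hcon)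
    omega
  have hst : s = insert p t := by
    symm
    apply Finset.eq_of_subset_of_card_le (Finset.insert_subset hps hts)
    rw [Finset.card_insert_of_notMem hpt]
    omega
  have htne : t.Nonempty := Finset.card_pos.1 (by omega)
  obtain ⟨A, hA⟩ := exists_affineMap hs hsc (fun x => if x = p then 1 else 0)
  have hAp : A p = 1 := by rw [hA p hps, if_pos rfl]
  have hAt : ∀ x ∈ (t : Set (Eu d)), A x = 0 := fun x hx => by
    rw [hA x (hts hx), if_neg]
    rintro rfl
    exact hpt hx
  rw [hst, Finset.coe_insert] at hball
  obtain ⟨c', hc'⟩ := exists_ball_subset_face hρ (by exact_mod_cast htne) hAp hAt hball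
  let W := LinearMap.ker A.linear
  have hrange : LinearMap.range A.linear = ⊤ := by
    obtain ⟨x, hx⟩ := htne
    rw [LinearMap.range_eq_top]
    have : A.linear (p - x) = 1 := by
      have := A.linearMap_vsub p x
      rw [hAp, hAt x hx] at this
      simpa using this
    intro r
    exact ⟨r • (p - x), by rw [map_smul, this, smul_eq_mul, mul_one]⟩
  have hW : Module.finrank ℝ W = d - 1 := by
    have := LinearMap.finrank_range_add_finrank_ker A.linear
    rw [hrange, finrank_top, Module.finrank_self, finrank_euclideanSpace_fin] at this
    change Module.finrank ℝ (LinearMap.ker A.linear) = d - 1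
    omega
  -- An orthonormal basis of the hyperplane parallel to the facet identifies it isometrically with
  -- `Eu (d - 1)`, so the measure of the ball becomes `faceConst d` times a power of `ρ`.
  let e : Eu (d - 1) ≃ₗᵢ[ℝ] W := ((stdOrthonormalBasis ℝ W).reindex (finCongr hW)).repr.symm
  let g : Eu (d - 1) → Eu d := fun z => c' + (e z : Eu d)
  have hg : Isometry g := by
    refine (IsometryEquiv.addLeft c').isometry.comp (W.subtypeₗᵢ.isometry.comp e.isometry)
  have hcast : ((d : ℝ) - 1) = ((d - 1 : ℕ) : ℝ) := by rw [Nat.cast_sub hd, Nat.cast_one]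
  have hsub : g '' Metric.closedBall 0 ρ ⊆ convexHull ℝ (t : Set (Eu d)) := by
    rintro _ ⟨z, hz, rfl⟩
    refine hc' _ (e z).2 ?_
    rw [mem_closedBall_zero_iff] at hz
    exact (e.norm_map z).trans_le hz
  rw [hcast]
  refine le_trans (le_of_eq ?_) (measure_mono hsub)
  rw [hg.hausdorffMeasure_image (Or.inl (Nat.cast_nonneg _))]
  have : (Measure.hausdorffMeasure ((d - 1 : ℕ) : ℝ) : Measure (Eu (d - 1))).IsAddHaarMeasure := by
    have := isAddHaarMeasure_hausdorffMeasure (E := Eu (d - 1))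
    rwa [finrank_euclideanSpace_fin] at this
  rw [Measure.addHaar_closedBall' _ _ hρ.le, finrank_euclideanSpace_fin]
  rfl

theorem hausdorffMeasure_convexHull_eq_zero {t : Finset (Eu d)} (ht : t.card < d) :
    Measure.hausdorffMeasure ((d : ℝ) - 1) (convexHull ℝ (t : Set (Eu d))) = 0 := by
  rcases t.eq_empty_or_nonempty with rfl | ⟨x, hx⟩
  · simp
  have hc : 0 < t.card := Finset.card_pos.2 ⟨x, hx⟩
  let W := vectorSpan ℝ (t : Set (Eu d))
  have h1 : Module.finrank ℝ W < d - 1 := by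
    obtain ⟨n, hn⟩ : ∃ n, t.card = n + 1 := ⟨t.card - 1, by omega⟩
    have h1 := finrank_vectorSpan_range_le ℝ ((↑) : t → Eu d) (n := n) (by simpa using hn)
    rw [Subtype.range_coe_subtype] at h1
    have h3 : {x | x ∈ t} = (t : Set (Eu d)) := rfl
    rw [h3] at h1
    change Module.finrank ℝ (vectorSpan ℝ (t : Set (Eu d))) < d - 1
    omega
  have hcd : ContDiff ℝ 1 (fun v : W => (v : Eu d) + x) :=
    W.subtypeL.contDiff.add contDiff_const
  have h2 : convexHull ℝ (t : Set (Eu d)) ⊆ range (fun v : W => (v : Eu d) + x) := by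
    intro y hy
    refine ⟨⟨y - x, ?_⟩, sub_add_cancel y x⟩
    exact vsub_mem_vectorSpan_of_mem_affineSpan_of_mem_affineSpan (convexHull_subset_affineSpan _ hy)
      (subset_affineSpan ℝ _ hx)
  have hcast : ((d : ℝ) - 1) = (((d - 1 : ℕ) : NNReal) : ℝ) := by
    rw [NNReal.coe_natCast, Nat.cast_sub (by omega), Nat.cast_one]
  rw [hcast]
  refine measure_mono_null h2 (hausdorffMeasure_of_dimH_lt (hcd.dimH_range_le.trans_lt ?_))
  exact_mod_cast h1

/-! ### Quasi-uniform meshes -/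

/-- A triangulation with elements of diameter at most `h` which contain balls of radius `κ h`. -/
structure IsMesh (Ω : Set (Eu d)) (K : Geometry.SimplicialComplex ℝ (Eu d)) (h κ : ℝ) : Prop
    extends IsTri Ω K where
  pos : 0 < h
  le_one : h ≤ 1
  shape_pos : 0 < κ
  diam_le : ∀ s ∈ topFaces K, Metric.diam (convexHull ℝ (s : Set (Eu d))) ≤ h
  exists_ball : ∀ s ∈ topFaces K, ∃ c, Metric.closedBall c (κ * h) ⊆ convexHull ℝ (s : Set (Eu d))

namespace IsMesh

variable {K : Geometry.SimplicialComplex ℝ (Eu d)} {h κ : ℝ}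

theorem dist_le (hM : IsMesh Ω K h κ) {s : Finset (Eu d)} (hs : s ∈ topFaces K) {x y : Eu d}
    (hx : x ∈ convexHull ℝ (s : Set (Eu d))) (hy : y ∈ convexHull ℝ (s : Set (Eu d))) :
    dist x y ≤ h :=
  (Metric.dist_le_diam_of_mem (hM.dom.bounded.closure.subset (hM.convexHull_subset hs.1)) hx
    hy).trans (hM.diam_le s hs)

theorem mul_pos (hM : IsMesh Ω K h κ) : 0 < κ * h := _root_.mul_pos hM.shape_pos hM.pos

/-- A packing argument: the interiors of the elements are disjoint, each element contains a ball of
radius `κ h`, and all of them lie in a ball of radius `R h`. -/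
theorem card_le (hM : IsMesh Ω K h κ) {R : ℝ} (hR : 0 ≤ R) (y : Eu d) {F : Finset (Finset (Eu d))}
    (hF : ∀ s ∈ F, s ∈ topFaces K)
    (hF' : ∀ s ∈ F, convexHull ℝ (s : Set (Eu d)) ⊆ Metric.closedBall y (R * h)) :
    (F.card : ENNReal) ≤ ENNReal.ofReal ((R / κ) ^ d) := by
  have hV0 : volume (Metric.closedBall (0 : Eu d) 1) ≠ 0 :=
    (Metric.measure_closedBall_pos _ _ one_pos).ne'
  have hV1 : volume (Metric.closedBall (0 : Eu d) 1) ≠ ⊤ := measure_closedBall_lt_top.ne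
  have hκ := hM.mul_pos
  have h1 : (F.card : ENNReal) * (ENNReal.ofReal ((κ * h) ^ d) *
      volume (Metric.closedBall (0 : Eu d) 1)) ≤
      ENNReal.ofReal ((R * h) ^ d) * volume (Metric.closedBall (0 : Eu d) 1) := by
    calc _ = ∑ s ∈ F, ENNReal.ofReal ((κ * h) ^ d) * volume (Metric.closedBall (0 : Eu d) 1) := by
          rw [Finset.sum_const, nsmul_eq_mul]
      _ ≤ ∑ s ∈ F, volume (interior (convexHull ℝ (s : Set (Eu d)))) := by
          refine Finset.sum_le_sum fun s hs => ?_
          obtain ⟨c, hc⟩ := hM.exists_ball s (hF s hs)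
          rw [measure_congr (IsTri.interior_ae_eq s)]
          refine le_trans (le_of_eq ?_) (measure_mono hc)
          rw [Measure.addHaar_closedBall' _ _ hκ.le, finrank_euclideanSpace_fin]
      _ = volume (⋃ s ∈ F, interior (convexHull ℝ (s : Set (Eu d)))) := by
          rw [measure_biUnion_finset (fun s hs t ht hne =>
            IsTri.disjoint_interior (hF s hs) (hF t ht) hne)
            fun s _ => isOpen_interior.measurableSet]
      _ ≤ volume (Metric.closedBall y (R * h)) := by
          refine measure_mono (iUnion₂_subset fun s hs => ?_)
          exact interior_subset.trans (hF' s hs)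
      _ = _ := by
          rw [Measure.addHaar_closedBall' _ _ (mul_nonneg hR hM.pos.le), finrank_euclideanSpace_fin]
  rw [← mul_assoc, ENNReal.mul_le_mul_iff_left hV0 hV1] at h1
  have h2 : (R * h) ^ d = (R / κ) ^ d * (κ * h) ^ d := by
    rw [← mul_pow]
    congr 1
    have := hM.shape_pos.ne'
    field_simp
  have hκ' := hM.shape_pos
  rw [h2, ENNReal.ofReal_mul (by positivity)] at h1
  exact (ENNReal.mul_le_mul_iff_left (by positivity) ENNReal.ofReal_ne_top).1 h1

/-- Balls around the elements of a mesh have finite overlap. -/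
theorem sum_lintegral_ball_le (hM : IsMesh Ω K h κ) {R : ℝ} (hR : 0 ≤ R) {ν : Measure (Eu d)}
    {F : Eu d → ENNReal} (hF : AEMeasurable F ν) {x : Finset (Eu d) → Eu d}
    (hx : ∀ s ∈ topFaces K, x s ∈ convexHull ℝ (s : Set (Eu d))) :
    ∑ s ∈ hM.tops, ∫⁻ y in Metric.closedBall (x s) (R * h), F y ∂ν ≤
      ENNReal.ofReal (((R + 1) / κ) ^ d) * ∫⁻ y, F y ∂ν := by
  classical
  have hms : ∀ s, MeasurableSet (Metric.closedBall (x s) (R * h)) := fun s =>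
    Metric.isClosed_closedBall.measurableSet
  calc _ = ∫⁻ y, (∑ s ∈ hM.tops, (Metric.closedBall (x s) (R * h)).indicator F y) ∂ν := by
        rw [lintegral_finsetSum' _ fun s _ => hF.indicator (hms s)]
        refine Finset.sum_congr rfl fun s _ => ?_
        rw [lintegral_indicator (hms s)]
    _ ≤ ∫⁻ y, ENNReal.ofReal (((R + 1) / κ) ^ d) * F y ∂ν := by
        refine lintegral_mono fun y => ?_
        have e : ∑ s ∈ hM.tops, (Metric.closedBall (x s) (R * h)).indicator F y =
            ((hM.tops.filter fun s => y ∈ Metric.closedBall (x s) (R * h)).card : ENNReal) * F y := by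
          rw [← nsmul_eq_mul, ← Finset.sum_const, Finset.sum_filter]
          rfl
        rw [e]
        -- The elements whose balls contain `y` lie within `(R + 1) h` of `y`, so their number is
        -- bounded independently of the mesh.
        refine mul_le_mul_left (hM.card_le (by linarith) y ?_ ?_) _
        · intro s hs
          exact hM.mem_tops.1 (Finset.mem_filter.1 hs).1
        · intro s hs z hz
          rw [Finset.mem_filter] at hs
          have h1 := hM.dist_le (hM.mem_tops.1 hs.1) hz (hx s (hM.mem_tops.1 hs.1))
          have h2 := Metric.mem_closedBall'.1 hs.2
          rw [Metric.mem_closedBall]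
          linarith [dist_triangle z (x s) y]
    _ = _ := lintegral_const_mul'' _ hF

theorem volume_le (hM : IsMesh Ω K h κ) {s : Finset (Eu d)} (hs : s ∈ topFaces K) :
    volume (interior (convexHull ℝ (s : Set (Eu d)))) ≤
      ENNReal.ofReal (h ^ d) * volume (Metric.closedBall (0 : Eu d) 1) := by
  obtain ⟨c, hc⟩ := hM.exists_ball s hs
  have hc' := hc (Metric.mem_closedBall_self hM.mul_pos.le)
  have : interior (convexHull ℝ (s : Set (Eu d))) ⊆ Metric.closedBall c h := fun y hy =>
    hM.dist_le hs (interior_subset hy) hc'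
  refine (measure_mono this).trans_eq ?_
  rw [Measure.addHaar_closedBall' _ _ hM.pos.le, finrank_euclideanSpace_fin]

/-- Every boundary vertex belongs to a boundary facet. -/
theorem exists_boundary_facet (hM : IsMesh Ω K h κ) {s : Finset (Eu d)} (hs : s ∈ topFaces K)
    {x : Eu d} (hx : x ∈ s) (hxf : x ∈ frontier Ω) :
    ∃ t ∈ K.faces, t.card = d ∧ x ∈ t ∧ convexHull ℝ (t : Set (Eu d)) ⊆ frontier Ω := by
  classical
  by_contra! hcon
  have hsx : {x} ∈ K.faces := K.down_closed hs.1 (Finset.singleton_subset_iff.2 hx) ⟨x, by simp⟩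
  have hrx : InRelInt {x} x := ⟨fun _ => 1, by simp, by simp, by simp⟩
  -- Otherwise the boundary near `x` would be covered by simplices with fewer than `d` vertices,
  -- which have surface measure zero.
  refine (hausdorffMeasure_frontier_inter_pos hM.dom.one_le hM.dom.isOpen hM.dom.lip hxf
    (hM.eventually_mem_of_mem x)).ne' ?_
  have hnull : Measure.hausdorffMeasure ((d : ℝ) - 1)
      (⋃ t ∈ {t | t ∈ K.faces ∧ t.card < d}, convexHull ℝ (t : Set (Eu d))) = 0 := by
    rw [measure_biUnion_null_iff (hM.tri.1.subset fun t ht => ht.1).countable]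
    exact fun t ht => hausdorffMeasure_convexHull_eq_zero ht.2
  refine measure_mono_null ?_ hnull
  rintro y ⟨hyf, hy⟩
  have hy : ∀ s ∈ K.faces,
    y ∈ convexHull ℝ (s : Set (Eu d)) → x ∈ convexHull ℝ (s : Set (Eu d)) := hy
  obtain ⟨t, ht, hyt⟩ := hM.exists_face (frontier_subset_closure hyf)
  have hxt : x ∈ t := Finset.singleton_subset_iff.1
    (IsTri.subset_of_inRelInt hsx ht hrx (hy t ht hyt.mem))
  have hsub := hM.subset_frontier ht hyt hyf
  have hne : t.card ≠ d := fun hc => hcon t ht hc hxt hsub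
  have hne' : t.card ≠ d + 1 := by
    intro hc
    obtain ⟨c, hcb⟩ := hM.exists_ball t ⟨ht, hc⟩
    have h1 : c ∈ interior (convexHull ℝ (t : Set (Eu d))) :=
      mem_interior.2 ⟨Metric.ball c (κ * h), Metric.ball_subset_closedBall.trans hcb,
        Metric.isOpen_ball, Metric.mem_ball_self hM.mul_pos⟩
    have h2 := hsub (interior_subset h1)
    rw [hM.dom.isOpen.frontier_eq] at h2
    exact h2.2 (hM.interior_subset ht h1)
  have h1 := (K.indep ht).card_le_finrank_succ
  have h2 : Module.finrank ℝ (vectorSpan ℝ (range ((↑) : t → Eu d))) ≤ d := by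
    have := Submodule.finrank_le (vectorSpan ℝ (range ((↑) : t → Eu d)))
    simpa using this
  rw [Fintype.card_coe] at h1
  exact mem_iUnion₂.2 ⟨t, ⟨ht, by omega⟩, hyt.mem⟩

/-- Inverse estimate on the boundary. -/
theorem enorm_sq_le_lintegral_boundary (hM : IsMesh Ω K h κ) {w : Eu d → ℝ}
    (hw : IsPWAffine Ω K w) {s : Finset (Eu d)} (hs : s ∈ topFaces K) {x : Eu d} (hx : x ∈ s)
    (hxf : x ∈ frontier Ω) :
    ENNReal.ofReal ((κ * h / 4) ^ (d - 1)) * faceConst d * ‖w x‖ₑ ^ 2 ≤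
      4 * ∫⁻ y in Metric.closedBall x (1 * h), ‖w y‖ₑ ^ 2 ∂(surfaceMeasure Ω) := by
  obtain ⟨t, ht, htc, hxt, htf⟩ := hM.exists_boundary_facet hs hx hxf
  obtain ⟨s', hs', hts'⟩ := hM.exists_topFace_of_face ht
  obtain ⟨c, hc⟩ := hM.exists_ball s' hs'
  have hd := hM.dom.one_le
  have hmeas := le_hausdorffMeasure_facet hd (K.indep hs'.1) hs'.2 hts' htc hM.mul_pos hc
  -- At a vertex `p` where `|w|` is largest, the facet is shrunk towards `p` by the factor `1 / 4`.
  -- There `|w| ≥ (3/4 - 1/4) |w p|`, which is at least `|w x| / 2`; squaring gives the factor `4`.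
  obtain ⟨p, hp, hmax⟩ := Finset.exists_max_image t (fun q => |w q|) ⟨x, hxt⟩
  set T := AffineMap.homothety p (1 / 4 : ℝ) '' convexHull ℝ (t : Set (Eu d)) with hT
  have hform : ∀ y, AffineMap.homothety p (1 / 4 : ℝ) y = (3 / 4 : ℝ) • p + (1 / 4 : ℝ) • y := by
    intro y
    rw [AffineMap.homothety_apply, vsub_eq_sub, vadd_eq_add, smul_sub]
    have : p = (3 / 4 : ℝ) • p + (1 / 4 : ℝ) • p := by rw [← add_smul]; norm_num
    conv_lhs => rw [add_comm]; lhs; rw [this]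
    abel
  have hpt : p ∈ convexHull ℝ (t : Set (Eu d)) := subset_convexHull ℝ _ hp
  have hts : convexHull ℝ (t : Set (Eu d)) ⊆ convexHull ℝ (s' : Set (Eu d)) :=
    convexHull_mono (by exact_mod_cast hts')
  have hTt : T ⊆ convexHull ℝ (t : Set (Eu d)) := by
    rintro _ ⟨y, hy, rfl⟩
    rw [hform]
    exact convex_convexHull ℝ _ hpt hy (by norm_num) (by norm_num) (by norm_num)
  have hTs : T ⊆ frontier Ω ∩ Metric.closedBall x (1 * h) := fun y hy => by
    refine ⟨htf (hTt hy), ?_⟩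
    rw [Metric.mem_closedBall, one_mul]
    exact hM.dist_le hs' (hts (hTt hy)) (hts (subset_convexHull ℝ _ hxt))
  have hlow : ∀ y ∈ T, ‖w x‖ₑ ^ 2 ≤ 4 * ‖w y‖ₑ ^ 2 := by
    rintro _ ⟨y, hy, rfl⟩
    obtain ⟨A, hA⟩ := hw.affine s' hs'
    have hwy : |w y| ≤ |w p| := by
      obtain ⟨l, l1, l2, l3⟩ := Finset.mem_convexHull'.1 hy
      rw [← l3, hw.apply_sum hs' hts' l1 l2]
      calc _ ≤ ∑ q ∈ t, |l q * w q| := Finset.abs_sum_le_sum_abs _ _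
        _ ≤ ∑ q ∈ t, l q * |w p| := Finset.sum_le_sum fun q hq => by
            rw [abs_mul, abs_of_nonneg (l1 q hq)]
            exact mul_le_mul_of_nonneg_left (hmax q hq) (l1 q hq)
        _ = |w p| := by rw [← Finset.sum_mul, l2, one_mul]
    have hw1 : w (AffineMap.homothety p (1 / 4 : ℝ) y) = 3 / 4 * w p + 1 / 4 * w y := by
      have hm := hts (hTt ⟨y, hy, rfl⟩)
      rw [hA hm, hform, hA (hts hpt), hA (hts hy)]
      have := Convex.combo_affine_apply (f := A) (x := p) (y := y)
        (a := (3 / 4 : ℝ)) (b := 1 / 4) (by norm_num)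
      simpa using this
    rw [hw1, enorm_sq_eq_ofReal, enorm_sq_eq_ofReal, ← ENNReal.ofReal_ofNat 4,
      ← ENNReal.ofReal_mul (by norm_num)]
    refine ENNReal.ofReal_le_ofReal ?_
    have h1 : |w x| ≤ |w p| := hmax x hxt
    have h2 : |w p| / 2 ≤ |3 / 4 * w p + 1 / 4 * w y| := by
      have h3 : |3 / 4 * w p| - |1 / 4 * w y| ≤ |3 / 4 * w p + 1 / 4 * w y| := by
        have := abs_sub_abs_le_abs_sub (3 / 4 * w p) (-(1 / 4 * w y))
        rwa [abs_neg, sub_neg_eq_add] at this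
      rw [abs_mul, abs_mul, abs_of_pos (by norm_num : (0 : ℝ) < 3 / 4),
        abs_of_pos (by norm_num : (0 : ℝ) < 1 / 4)] at h3
      linarith
    rw [Real.norm_eq_abs, Real.norm_eq_abs]
    nlinarith [abs_nonneg (w x), abs_nonneg (w p)]
  have hmT : ENNReal.ofReal ((κ * h / 4) ^ (d - 1)) * faceConst d ≤
      Measure.hausdorffMeasure ((d : ℝ) - 1) T := by
    have hcast : ((d : ℝ) - 1) = ((d - 1 : ℕ) : ℝ) := by rw [Nat.cast_sub hd, Nat.cast_one]
    rw [hcast] at hmeas ⊢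
    rw [hT, hausdorffMeasure_homothety_image (Nat.cast_nonneg _) p (by norm_num), NNReal.rpow_natCast,
      ENNReal.smul_def, smul_eq_mul]
    refine le_trans (le_of_eq ?_) (mul_le_mul_right hmeas _)
    rw [← mul_assoc]
    congr 1
    have : ((‖(1 / 4 : ℝ)‖₊ ^ (d - 1) : NNReal) : ENNReal) = ENNReal.ofReal ((1 / 4) ^ (d - 1)) := by
      rw [ENNReal.ofReal, ENNReal.coe_inj, Real.toNNReal_pow (by norm_num)]
      congr 1
      ext
      simp
    rw [this, ← ENNReal.ofReal_mul (by positivity), ← mul_pow]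
    congr 2
    ring
  calc _ ≤ Measure.hausdorffMeasure ((d : ℝ) - 1) T * ‖w x‖ₑ ^ 2 := mul_le_mul_left hmT _
    _ = ∫⁻ _ in T, ‖w x‖ₑ ^ 2 ∂(Measure.hausdorffMeasure ((d : ℝ) - 1)) := by
        rw [setLIntegral_const, mul_comm]
    _ ≤ ∫⁻ y in T, 4 * ‖w y‖ₑ ^ 2 ∂(Measure.hausdorffMeasure ((d : ℝ) - 1)) := by
        have hTc : IsClosed T := by
          have : IsCompact (convexHull ℝ (t : Set (Eu d))) := t.finite_toSet.isCompact_convexHull ℝ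
          exact (this.image (AffineMap.continuous_of_finiteDimensional _)).isClosed
        exact setLIntegral_mono' hTc.measurableSet hlow
    _ ≤ ∫⁻ y in frontier Ω ∩ Metric.closedBall x (1 * h), 4 * ‖w y‖ₑ ^ 2
        ∂(Measure.hausdorffMeasure ((d : ℝ) - 1)) := lintegral_mono_set hTs
    _ = _ := by
        rw [surfaceMeasure, Measure.restrict_restrict Metric.isClosed_closedBall.measurableSet,
          inter_comm, lintegral_const_mul' _ _ (by norm_num)]

end IsMesh

/-! ### Quasi-interpolation -/

theorem abs_sub_le_of_gradient_le {ψ : Eu d → ℝ} (hψ : Differentiable ℝ ψ) {S : Set (Eu d)}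
    (hS : Convex ℝ S) {g : ℝ} (hg : ∀ x ∈ S, ‖gradient ψ x‖ ≤ g) {x y : Eu d} (hx : x ∈ S)
    (hy : y ∈ S) : |ψ y - ψ x| ≤ g * ‖y - x‖ := by
  refine hS.norm_image_sub_le_of_norm_fderiv_le (fun z _ => hψ z) (fun z hz => ?_) hx hy
  refine le_trans (le_of_eq ?_) (hg z hz)
  exact (LinearIsometryEquiv.norm_map _ _).symm

theorem ofReal_norm_sq_eq_of_ae {u : H1 Ω} {v : Eu d → ℝ} (hu : fn u =ᵐ[volume.restrict Ω] v)
    (hg : grad u =ᵐ[volume.restrict Ω] gradient v) :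
    ENNReal.ofReal (‖u‖ ^ 2) = ∫⁻ x in Ω, (‖v x‖ₑ ^ 2 + ‖gradient v x‖ₑ ^ 2) := by
  rw [norm_sq_eq, ENNReal.ofReal_add (by positivity) (by positivity), ofReal_norm_sq_eq_lintegral,
    ofReal_norm_sq_eq_lintegral, ← lintegral_add_right _ ((Lp.stronglyMeasurable _).enorm.pow_const 2)]
  refine lintegral_congr_ae ?_
  filter_upwards [hu, hg] with x h1 h2
  rw [h1, h2]

/-- Point values are not controlled by the `H¹` norm, so the nodal interpolant is taken of the
regularization `ψ` at scale `h`. The gradient of `ψ` on an element is bounded by the `H¹` norm of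
`φ` on a neighbouring ball, and these balls overlap finitely. The constant depends only on the
domain and on `κ`. -/
theorem IsLipDomain.exists_interp_smooth (hΩ : IsLipDomain Ω) (κ : ℝ) : ∃ B : ℝ, 0 ≤ B ∧
    ∀ (K : Geometry.SimplicialComplex ℝ (Eu d)) (h : ℝ), IsMesh Ω K h κ →
    ∀ (φ : Eu d → ℝ) (w : H1 Ω), ContDiff ℝ 1 φ → fn w =ᵐ[volume.restrict Ω] φ →
    ∃ (v : Eu d → ℝ) (u : H1 Ω), IsPWAffine Ω K v ∧ fn u =ᵐ[volume.restrict Ω] v ∧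
      ‖fn u - fn w‖ ≤ B * h * ‖w‖ ∧ ‖grad u‖ ≤ B * ‖w‖ := by
  obtain ⟨C⟩ := exists_coneCover hΩ.isOpen hΩ.bounded hΩ.lip
  obtain ⟨K1, hK1⟩ := C.exists_lintegral_moll_sub_le hΩ.isOpen
  obtain ⟨K2, R, hR, hK2⟩ := C.exists_enorm_gradient_moll_le hΩ.isOpen hΩ.bounded
  set V := volume (Metric.closedBall (0 : Eu d) 1) with hV
  have hVt : V ≠ ⊤ := measure_closedBall_lt_top.ne
  set N := ENNReal.ofReal (((R + 1 + 1) / κ) ^ d) with hN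
  -- `A1` bounds the squared `L²` error in units of `h² ‖w‖²`, from interpolation of `ψ` and from
  -- regularization; `A2` bounds the squared gradient in units of `‖w‖²`. The factor `4` is slack.
  set A1 : ENNReal := 2 * (4 * (K2 * V * N) + K1) with hA1
  have hA1t : A1 ≠ ⊤ := by finiteness
  set A2 : ENNReal := ENNReal.ofReal ((κ ^ 2)⁻¹) * (K2 * V * N) with hA2
  have hA2t : A2 ≠ ⊤ := by finiteness
  refine ⟨√A1.toReal + √A2.toReal, by positivity, fun K h hM φ w hφ hw => ?_⟩
  have hh := hM.pos
  have hκ := hM.shape_pos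
  have hgw := grad_eq_of_contDiff hΩ.isOpen hΩ.bounded hφ hw
  set ψ := C.moll hM.pos φ with hψdef
  have hψ : ContDiff ℝ 1 ψ :=
    (C.contDiff_moll hM.pos hφ.continuous.locallyIntegrable).of_le (by exact_mod_cast le_top)
  obtain ⟨v, hv, hvψ⟩ := hM.exists_nodal ψ
  obtain ⟨u, hu, hgu⟩ := hv.exists_H1 hM.toIsTri
  refine ⟨v, u, hv, hu, ?_⟩
  set G : Eu d → ENNReal := fun y => ‖φ y‖ₑ ^ 2 + ‖gradient φ y‖ₑ ^ 2 with hG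
  have hGm : Measurable G :=
    (hφ.continuous.measurable.enorm.pow_const 2).add ((measurable_gradient φ).enorm.pow_const 2)
  have hGi : ∫⁻ x in Ω, G x = ENNReal.ofReal (‖w‖ ^ 2) := (ofReal_norm_sq_eq_of_ae hw hgw).symm
  choose! c hc using hM.exists_ball
  have hcs : ∀ s ∈ topFaces K, c s ∈ convexHull ℝ (s : Set (Eu d)) := fun s hs =>
    hc s hs (Metric.mem_closedBall_self hM.mul_pos.le)
  set E : Finset (Eu d) → ENNReal := fun s =>
    ∫⁻ y in Metric.closedBall (c s) ((R + 1) * h), G y ∂(volume.restrict Ω) with hE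
  have hEt : ∀ s, E s ≠ ⊤ := fun s =>
    ((setLIntegral_le_lintegral _ _).trans_lt (hGi ▸ ENNReal.ofReal_lt_top)).ne
  have hsum : ∑ s ∈ hM.tops, E s ≤ N * ENNReal.ofReal (‖w‖ ^ 2) := by
    rw [← hGi]
    exact hM.sum_lintegral_ball_le (by positivity) hGm.aemeasurable hcs
  -- `g s` is the bound for the gradient of `ψ` on the element `s`, so `g s * h` bounds the
  -- oscillation there.
  set g : Finset (Eu d) → ℝ := fun s => √(K2 * ENNReal.ofReal ((h ^ d)⁻¹) * E s).toReal with hg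
  have hg0 : ∀ s, 0 ≤ g s := fun s => Real.sqrt_nonneg _
  have hgE : ∀ s, ENNReal.ofReal (g s ^ 2) = K2 * ENNReal.ofReal ((h ^ d)⁻¹) * E s := fun s => by
    rw [hg, Real.sq_sqrt ENNReal.toReal_nonneg, ENNReal.ofReal_toReal]
    have := hEt s
    finiteness
  have hgrad : ∀ s ∈ topFaces K, ∀ x ∈ convexHull ℝ (s : Set (Eu d)), ‖gradient ψ x‖ ≤ g s := by
    intro s hs x hx
    refine le_of_sq_le_sq ?_ (hg0 s)
    rw [← ENNReal.ofReal_le_ofReal_iff (by positivity), ← enorm_sq_eq_ofReal, hgE]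
    refine (hK2 hM.pos hM.le_one φ hφ x (hM.convexHull_subset hs.1 hx)).trans ?_
    refine mul_le_mul_right ?_ _
    simp only [hE]
    rw [Measure.restrict_restrict Metric.isClosed_closedBall.measurableSet]
    refine lintegral_mono_set fun y hy => ⟨?_, hy.1⟩
    have h1 := hM.dist_le hs hx (hcs s hs)
    have h2 := Metric.mem_ball.1 hy.2
    rw [Metric.mem_closedBall]
    linarith [dist_triangle y x (c s)]
  have hosc : ∀ s ∈ topFaces K, ∀ x ∈ convexHull ℝ (s : Set (Eu d)),
      ∀ y ∈ convexHull ℝ (s : Set (Eu d)), |ψ y - ψ x| ≤ g s * h := by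
    intro s hs x hx y hy
    refine (abs_sub_le_of_gradient_le (hψ.differentiable (by simp)) (convex_convexHull ℝ _)
      (hgrad s hs) hx hy).trans ?_
    rw [← dist_eq_norm]
    exact mul_le_mul_of_nonneg_left (hM.dist_le hs hy hx) (hg0 s)
  have hvsub : ∀ s ∈ topFaces K, ∀ x ∈ convexHull ℝ (s : Set (Eu d)),
      |v x - ψ x| ≤ g s * h := by
    intro s hs x hx
    refine hv.abs_le_of_forall hs (fun p hp => ?_) hx
    rw [hvψ s hs p hp]
    exact hosc s hs x hx p (subset_convexHull ℝ _ hp)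
  have hvgrad : ∀ s ∈ topFaces K, ∀ x ∈ interior (convexHull ℝ (s : Set (Eu d))),
      ‖gradient v x‖ ≤ κ⁻¹ * g s := by
    intro s hs x hx
    refine (hv.norm_gradient_le hs hM.mul_pos (mul_nonneg (hg0 s) hh.le) (hc s hs)
      (fun p hp q hq => ?_) hx).trans_eq ?_
    · rw [hvψ s hs p hp, hvψ s hs q hq]
      exact hosc s hs q (subset_convexHull ℝ _ hq) p (subset_convexHull ℝ _ hp)
    · field_simp
  have hvolE : ∀ s ∈ topFaces K, ENNReal.ofReal (g s ^ 2) *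
      volume (interior (convexHull ℝ (s : Set (Eu d)))) ≤ K2 * V * E s := by
    intro s hs
    rw [hgE]
    refine (mul_le_mul_right (hM.volume_le hs) _).trans_eq ?_
    -- The factor `h⁻ᵈ` of the pointwise bound cancels against the volume of the element.
    have : ENNReal.ofReal ((h ^ d)⁻¹) * ENNReal.ofReal (h ^ d) = 1 := by
      rw [← ENNReal.ofReal_mul (by positivity), inv_mul_cancel₀ (by positivity), ENNReal.ofReal_one]
    calc _ = (ENNReal.ofReal ((h ^ d)⁻¹) * ENNReal.ofReal (h ^ d)) * (K2 * V * E s) := by ring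
      _ = _ := by rw [this, one_mul]
  have hsum2 : ∑ s ∈ hM.tops, K2 * V * E s ≤ K2 * V * N * ENNReal.ofReal (‖w‖ ^ 2) := by
    rw [← Finset.mul_sum, mul_assoc _ N]
    exact mul_le_mul_right hsum _
  have hI1 : ∫⁻ x in Ω, ‖v x - ψ x‖ₑ ^ 2 ≤
      ENNReal.ofReal (h ^ 2) * (K2 * V * N * ENNReal.ofReal (‖w‖ ^ 2)) := by
    refine (hM.lintegral_le_sum _).trans
      (le_trans ?_ (mul_le_mul_right hsum2 (ENNReal.ofReal (h ^ 2))))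
    rw [Finset.mul_sum]
    refine Finset.sum_le_sum fun s hs => ?_
    have hs := hM.mem_tops.1 hs
    refine le_trans ?_ (mul_le_mul_right (hvolE s hs) _)
    rw [← mul_assoc, ← ENNReal.ofReal_mul (by positivity), ← setLIntegral_const]
    refine setLIntegral_mono' isOpen_interior.measurableSet fun x hx => ?_
    rw [enorm_sq_eq_ofReal]
    refine ENNReal.ofReal_le_ofReal ?_
    rw [← mul_pow, mul_comm h]
    exact pow_le_pow_left₀ (norm_nonneg _) (hvsub s hs x (interior_subset hx)) 2
  have hI2 : ∫⁻ x in Ω, ‖gradient v x‖ₑ ^ 2 ≤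
      ENNReal.ofReal ((κ ^ 2)⁻¹) * (K2 * V * N * ENNReal.ofReal (‖w‖ ^ 2)) := by
    refine (hM.lintegral_le_sum _).trans
      (le_trans ?_ (mul_le_mul_right hsum2 (ENNReal.ofReal ((κ ^ 2)⁻¹))))
    rw [Finset.mul_sum]
    refine Finset.sum_le_sum fun s hs => ?_
    have hs := hM.mem_tops.1 hs
    refine le_trans ?_ (mul_le_mul_right (hvolE s hs) _)
    rw [← mul_assoc, ← ENNReal.ofReal_mul (by positivity), ← setLIntegral_const]
    refine setLIntegral_mono' isOpen_interior.measurableSet fun x hx => ?_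
    rw [enorm_sq_eq_ofReal]
    refine ENNReal.ofReal_le_ofReal ?_
    rw [← inv_pow, ← mul_pow]
    exact pow_le_pow_left₀ (norm_nonneg _) (hvgrad s hs x hx) 2
  have hI3 : ∫⁻ x in Ω, ‖ψ x - φ x‖ₑ ^ 2 ≤ K1 * ENNReal.ofReal (h ^ 2) * ENNReal.ofReal (‖w‖ ^ 2) := by
    refine (hK1 hM.pos hM.le_one φ hφ).trans (mul_le_mul_right ?_ _)
    rw [← hGi]
    exact lintegral_mono fun x => le_add_self
  constructor
  · have h1 : ‖fn u - fn w‖ ^ 2 ≤ A1.toReal * (h * ‖w‖) ^ 2 := by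
      refine norm_sq_le_of_lintegral_le (g := fun x => v x - φ x) ?_ (by positivity) ?_
      · filter_upwards [Lp.coeFn_sub (fn u) (fn w), hu, hw] with x e1 e2 e3
        rw [e1, Pi.sub_apply, e2, e3]
      · calc _ ≤ ∫⁻ x in Ω, 2 * (‖v x - ψ x‖ₑ ^ 2 + ‖ψ x - φ x‖ₑ ^ 2) := by
              refine lintegral_mono fun x => ?_
              refine le_trans (le_of_eq ?_) (enorm_add_sq_le _ _)
              rw [sub_add_sub_cancel]
          _ = 2 * ((∫⁻ x in Ω, ‖v x - ψ x‖ₑ ^ 2) + ∫⁻ x in Ω, ‖ψ x - φ x‖ₑ ^ 2) := by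
              rw [lintegral_const_mul' _ _ (by norm_num), lintegral_add_right]
              exact (hψ.continuous.sub hφ.continuous).measurable.enorm.pow_const 2
          _ ≤ 2 * (ENNReal.ofReal (h ^ 2) * (K2 * V * N * ENNReal.ofReal (‖w‖ ^ 2)) +
                K1 * ENNReal.ofReal (h ^ 2) * ENNReal.ofReal (‖w‖ ^ 2)) := by gcongr
          _ ≤ A1 * ENNReal.ofReal ((h * ‖w‖) ^ 2) := by
              rw [mul_pow, ENNReal.ofReal_mul (by positivity), hA1]
              have : K2 * V * N ≤ 4 * (K2 * V * N) := le_mul_of_one_le_left' (by norm_num)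
              calc _ = 2 * (K2 * V * N + K1) *
                    (ENNReal.ofReal (h ^ 2) * ENNReal.ofReal (‖w‖ ^ 2)) := by ring
                _ ≤ _ := by gcongr
          _ = _ := by
              rw [ENNReal.ofReal_mul ENNReal.toReal_nonneg, ENNReal.ofReal_toReal hA1t]
    have h2 : ‖fn u - fn w‖ ≤ √A1.toReal * (h * ‖w‖) := by
      refine le_of_sq_le_sq ?_ (by positivity)
      rwa [mul_pow, Real.sq_sqrt ENNReal.toReal_nonneg]
    calc _ ≤ √A1.toReal * (h * ‖w‖) := h2
      _ ≤ (√A1.toReal + √A2.toReal) * (h * ‖w‖) := by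
          gcongr
          exact le_add_of_nonneg_right (Real.sqrt_nonneg _)
      _ = _ := by ring
  · have h1 : ‖grad u‖ ^ 2 ≤ A2.toReal * ‖w‖ ^ 2 := by
      refine norm_sq_le_of_lintegral_le hgu (by positivity) (hI2.trans_eq ?_)
      rw [ENNReal.ofReal_mul ENNReal.toReal_nonneg, ENNReal.ofReal_toReal hA2t, hA2]
      ring
    have h2 : ‖grad u‖ ≤ √A2.toReal * ‖w‖ := by
      refine le_of_sq_le_sq ?_ (by positivity)
      rwa [mul_pow, Real.sq_sqrt ENNReal.toReal_nonneg]
    refine h2.trans ?_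
    gcongr
    exact le_add_of_nonneg_left (Real.sqrt_nonneg _)

/-- Density of smooth functions: a smooth approximation within `h ‖u‖` changes the `L²` error only
at the order already present. The case `u = 0` is separate because this tolerance must be positive.
-/
theorem IsLipDomain.exists_interp (hΩ : IsLipDomain Ω) (κ : ℝ) : ∃ B : ℝ, 0 ≤ B ∧
    ∀ (K : Geometry.SimplicialComplex ℝ (Eu d)) (h : ℝ), IsMesh Ω K h κ → ∀ u : H1 Ω,
    ∃ (v : Eu d → ℝ) (u' : H1 Ω), IsPWAffine Ω K v ∧ fn u' =ᵐ[volume.restrict Ω] v ∧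
      ‖fn (u' - u)‖ ≤ B * h * ‖u‖ ∧ ‖u'‖ ≤ B * ‖u‖ := by
  obtain ⟨B, hB, hI⟩ := hΩ.exists_interp_smooth κ
  refine ⟨4 * B + 2, by positivity, fun K h hM u => ?_⟩
  rcases eq_or_ne u 0 with rfl | hu
  · refine ⟨fun _ => 0, 0, .const 0, Lp.coeFn_zero _ _ _, ?_, ?_⟩
    · rw [fn_sub, sub_self]
      simp
    · simp
  have hn := norm_pos_iff.2 hu
  have hh := hM.pos
  have hh1 := hM.le_one
  obtain ⟨φ, w, hφ, hw, hwu⟩ := exists_smooth_close hΩ.isOpen hΩ.bounded hΩ.lip u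
    (mul_pos hM.pos hn)
  obtain ⟨v, u', hv, hu', h1, h2⟩ := hI K h hM φ w (hφ.of_le (by exact_mod_cast le_top)) hw
  have hw2 : ‖w‖ ≤ 2 * ‖u‖ := by
    have : w = (w - u) + u := by abel
    rw [this]
    refine (norm_add_le _ _).trans ?_
    nlinarith
  have h3 : ‖fn (u' - u)‖ ≤ (2 * B + 1) * h * ‖u‖ := by
    have e : fn (u' - u) = (fn u' - fn w) + fn (w - u) := by rw [fn_sub, fn_sub]; abel
    rw [e]
    refine (norm_add_le _ _).trans ?_
    have h4 := (norm_fn_le (w - u)).trans hwu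
    have h5 : B * h * ‖w‖ ≤ B * h * (2 * ‖u‖) := by gcongr
    linarith
  refine ⟨v, u', hv, hu', h3.trans ?_, ?_⟩
  · have : 2 * B + 1 ≤ 4 * B + 2 := by linarith
    gcongr
  · refine (norm_le_fn_add_grad u').trans ?_
    have e : fn u' = fn (u' - u) + fn u := by rw [fn_sub, sub_add_cancel]
    have h4 : ‖fn u'‖ ≤ (2 * B + 1) * ‖u‖ + ‖u‖ := by
      rw [e]
      refine (norm_add_le _ _).trans (add_le_add (h3.trans ?_) (norm_fn_le u))
      have : (2 * B + 1) * h ≤ (2 * B + 1) * 1 := by gcongr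
      rw [mul_one] at this
      gcongr
    have h5 : B * ‖w‖ ≤ B * (2 * ‖u‖) := by gcongr
    linarith

/-! ### Extension of boundary nodal values -/

/-- The function `z` keeps the nodal values of `w` on the boundary and vanishes at the other nodes.
An element with largest nodal value `m` contributes at most order `h^(d-2) m²` to `‖z‖²`, whereas
the boundary near that node carries at least order `h^(d-1) m²` of the squared trace. This is the
loss of one power of `h`. -/
theorem IsLipDomain.exists_boundary_correction (hΩ : IsLipDomain Ω) (κ : ℝ) : ∃ B : ℝ, 0 ≤ B ∧
    ∀ (K : Geometry.SimplicialComplex ℝ (Eu d)) (h : ℝ), IsMesh Ω K h κ →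
    ∀ (w : Eu d → ℝ) (wH : H1 Ω), IsPWAffine Ω K w → fn wH =ᵐ[volume.restrict Ω] w →
    ∃ (z : Eu d → ℝ) (zH : H1 Ω), IsPWAffine Ω K z ∧ fn zH =ᵐ[volume.restrict Ω] z ∧
      trace zH = trace wH ∧ h * ‖zH‖ ^ 2 ≤ B * ‖(trace wH : L2Bd Ω)‖ ^ 2 := by
  classical
  set V := volume (Metric.closedBall (0 : Eu d) 1) with hV
  have hVt : V ≠ ⊤ := measure_closedBall_lt_top.ne
  set N := ENNReal.ofReal (((1 + 1 : ℝ) / κ) ^ d) with hN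
  set D : ENNReal := ENNReal.ofReal ((κ / 4) ^ (d - 1)) * faceConst d with hD
  set A : ENNReal := ENNReal.ofReal (1 + 4 / κ ^ 2) * V * (D⁻¹ * 4) * N with hA
  refine ⟨A.toReal, ENNReal.toReal_nonneg, fun K h hM w wH hw hwH => ?_⟩
  have hh := hM.pos
  have hh1 := hM.le_one
  have hκ := hM.shape_pos
  have hD0 : D ≠ 0 := mul_ne_zero (by positivity) (faceConst_ne_zero d)
  have hDt : D ≠ ⊤ := ENNReal.mul_ne_top ENNReal.ofReal_ne_top (faceConst_ne_top d)
  have hAt : A ≠ ⊤ := by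
    have : D⁻¹ ≠ ⊤ := ENNReal.inv_ne_top.2 hD0
    finiteness
  set c : Eu d → ℝ := fun p => if p ∈ frontier Ω then w p else 0 with hc
  obtain ⟨z, hz, hzc⟩ := hM.exists_nodal c
  obtain ⟨zH, hzH, hgz⟩ := hz.exists_H1 hM.toIsTri
  have htw := hΩ.trace_ae_eq hw.cont hwH
  refine ⟨z, zH, hz, hzH, ?_, ?_⟩
  -- A boundary point is in the relative interior of a face contained in the boundary. All vertices
  -- of that face are boundary nodes, so `z` and `w` agree on it.
  · have hzw : ∀ y ∈ frontier Ω, z y = w y := by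
      intro y hy
      obtain ⟨t, ht, hyt⟩ := hM.exists_face (frontier_subset_closure hy)
      have hsub := hM.subset_frontier ht hyt hy
      obtain ⟨s, hs, hts⟩ := hM.exists_topFace_of_face ht
      obtain ⟨l, l1, l2, rfl⟩ := hyt
      rw [hz.apply_sum hs hts (fun p hp => (l1 p hp).le) l2,
        hw.apply_sum hs hts (fun p hp => (l1 p hp).le) l2]
      refine Finset.sum_congr rfl fun p hp => ?_
      rw [hzc s hs p (hts hp), hc]
      simp only [if_pos (hsub (subset_convexHull ℝ _ hp))]
    refine Subtype.ext (Lp.ext ?_)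
    have hfr : ∀ᵐ y ∂(surfaceMeasure Ω), y ∈ frontier Ω :=
      ae_restrict_mem isClosed_frontier.measurableSet
    filter_upwards [hΩ.trace_ae_eq hz.cont hzH, htw, hfr] with y e1 e2 e3
    rw [e1, e2, hzw y e3]
  · have hne : ∀ s ∈ topFaces K, s.Nonempty := fun s hs => Finset.card_pos.1 (by have := hs.2; omega)
    choose! p hps hpmax using fun s hs => Finset.exists_max_image s (fun q => |c q|) (hne s hs)
    set I : Finset (Eu d) → ENNReal := fun s =>
      ∫⁻ y in Metric.closedBall (p s) (1 * h), ‖w y‖ₑ ^ 2 ∂(surfaceMeasure Ω) with hI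
    have hwm : AEMeasurable (fun y => ‖w y‖ₑ ^ 2) (surfaceMeasure Ω) :=
      (hΩ.memLp_surface hw.cont).1.enorm.pow_const 2
    have hsum : ∑ s ∈ hM.tops, I s ≤ N * ∫⁻ y, ‖w y‖ₑ ^ 2 ∂(surfaceMeasure Ω) :=
      hM.sum_lintegral_ball_le zero_le_one hwm fun s hs => subset_convexHull ℝ _ (hps s hs)
    -- Either the vertex with the largest value is on the boundary and the inverse estimate applies,
    -- or this value is zero.
    have hc2 : ∀ s ∈ topFaces K, ENNReal.ofReal (h ^ (d - 1) * |c (p s)| ^ 2) ≤ D⁻¹ * 4 * I s := by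
      intro s hs
      rw [mul_assoc, ← ENNReal.div_eq_inv_mul, ENNReal.le_div_iff_mul_le (Or.inl hD0) (Or.inl hDt)]
      by_cases hf : p s ∈ frontier Ω
      · have := hM.enorm_sq_le_lintegral_boundary hw hs (hps s hs) hf
        refine le_trans (le_of_eq ?_) this
        rw [hc]
        simp only [if_pos hf]
        rw [ENNReal.ofReal_mul (by positivity), hD, enorm_sq_eq_ofReal, Real.norm_eq_abs,
          show κ * h / 4 = h * (κ / 4) by ring, mul_pow, ENNReal.ofReal_mul (by positivity)]
        ring
      · rw [hc]
        simp [if_neg hf]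
    have hzle : ∀ s ∈ topFaces K, ∀ x ∈ convexHull ℝ (s : Set (Eu d)), |z x| ≤ |c (p s)| := by
      intro s hs x hx
      have := hz.abs_le_of_forall hs (c := 0) (δ := |c (p s)|) (fun q hq => ?_) hx
      · rwa [sub_zero] at this
      · rw [sub_zero, hzc s hs q hq]
        exact hpmax s hs q hq
    have hzg : ∀ s ∈ topFaces K, ∀ x ∈ interior (convexHull ℝ (s : Set (Eu d))),
        ‖gradient z x‖ ≤ 2 * |c (p s)| / (κ * h) := by
      intro s hs x hx
      obtain ⟨b, hb⟩ := hM.exists_ball s hs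
      refine hz.norm_gradient_le hs hM.mul_pos (by positivity) hb (fun q hq q' hq' => ?_) hx
      rw [hzc s hs q hq, hzc s hs q' hq']
      refine (abs_sub _ _).trans ?_
      have h1 := hpmax s hs q hq
      have h2 := hpmax s hs q' hq'
      linarith
    have hloc : ∀ s ∈ topFaces K, ENNReal.ofReal h *
        ∫⁻ x in interior (convexHull ℝ (s : Set (Eu d))), (‖z x‖ₑ ^ 2 + ‖gradient z x‖ₑ ^ 2) ≤
        ENNReal.ofReal (1 + 4 / κ ^ 2) * V * (D⁻¹ * 4) * I s := by
      intro s hs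
      have hm := abs_nonneg (c (p s))
      set m := |c (p s)| with hmdef
      calc _ ≤ ENNReal.ofReal h * ∫⁻ _ in interior (convexHull ℝ (s : Set (Eu d))),
            ENNReal.ofReal (m ^ 2 + (2 * m / (κ * h)) ^ 2) := by
            refine mul_le_mul_right ?_ _
            refine setLIntegral_mono' isOpen_interior.measurableSet fun x hx => ?_
            rw [enorm_sq_eq_ofReal, enorm_sq_eq_ofReal, ← ENNReal.ofReal_add (by positivity)
              (by positivity)]
            refine ENNReal.ofReal_le_ofReal (add_le_add ?_ ?_)
            · exact pow_le_pow_left₀ (norm_nonneg _) (hzle s hs x (interior_subset hx)) 2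
            · exact pow_le_pow_left₀ (norm_nonneg _) (hzg s hs x hx) 2
        _ ≤ ENNReal.ofReal h * (ENNReal.ofReal (m ^ 2 + (2 * m / (κ * h)) ^ 2) *
            (ENNReal.ofReal (h ^ d) * V)) := by
            rw [setLIntegral_const]
            gcongr
            exact hM.volume_le hs
        _ = ENNReal.ofReal (h * (m ^ 2 + (2 * m / (κ * h)) ^ 2) * h ^ d) * V := by
            rw [ENNReal.ofReal_mul (by positivity), ENNReal.ofReal_mul (by positivity)]
            ring
        _ ≤ ENNReal.ofReal ((1 + 4 / κ ^ 2) * (h ^ (d - 1) * m ^ 2)) * V := by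
            refine mul_le_mul_left (ENNReal.ofReal_le_ofReal ?_) _
            have hd : h ^ d = h ^ (d - 1) * h := by
              rw [← pow_succ]; congr 1; have := hΩ.one_le; omega
            have e : h * (m ^ 2 + (2 * m / (κ * h)) ^ 2) * h ^ d =
                (h ^ 2 + 4 / κ ^ 2) * (h ^ (d - 1) * m ^ 2) := by
              rw [hd]; field_simp; ring
            rw [e]
            have : h ^ 2 ≤ 1 := pow_le_one₀ hh.le hh1
            gcongr
        _ = ENNReal.ofReal (1 + 4 / κ ^ 2) * V * ENNReal.ofReal (h ^ (d - 1) * m ^ 2) := by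
            rw [ENNReal.ofReal_mul (by positivity)]; ring
        _ ≤ ENNReal.ofReal (1 + 4 / κ ^ 2) * V * (D⁻¹ * 4 * I s) := by
            gcongr
            exact hc2 s hs
        _ = _ := by ring
    rw [← ENNReal.ofReal_le_ofReal_iff (by positivity), ENNReal.ofReal_mul hh.le,
      ofReal_norm_sq_eq_of_ae hzH hgz, ENNReal.ofReal_mul ENNReal.toReal_nonneg,
      ENNReal.ofReal_toReal hAt, ofReal_norm_sq_eq_lintegral]
    calc _ ≤ ENNReal.ofReal h * ∑ s ∈ hM.tops, ∫⁻ x in interior (convexHull ℝ (s : Set (Eu d))),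
          (‖z x‖ₑ ^ 2 + ‖gradient z x‖ₑ ^ 2) := mul_le_mul_right (hM.lintegral_le_sum _) _
      _ ≤ ∑ s ∈ hM.tops, ENNReal.ofReal (1 + 4 / κ ^ 2) * V * (D⁻¹ * 4) * I s := by
          rw [Finset.mul_sum]
          exact Finset.sum_le_sum fun s hs => hloc s (hM.mem_tops.1 hs)
      _ ≤ ENNReal.ofReal (1 + 4 / κ ^ 2) * V * (D⁻¹ * 4) *
          (N * ∫⁻ y, ‖w y‖ₑ ^ 2 ∂(surfaceMeasure Ω)) := by
          rw [← Finset.mul_sum]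
          exact mul_le_mul_right hsum _
      _ = A * ∫⁻ y, ‖(trace wH : L2Bd Ω) y‖ₑ ^ 2 ∂(surfaceMeasure Ω) := by
          rw [← mul_assoc, hA]
          congr 1
          exact lintegral_congr_ae (htw.mono fun y hy => by simp only [hy])

/-- **Stable discrete extension** of discrete boundary values. -/
theorem IsLipDomain.exists_discrete_extension (hΩ : IsLipDomain Ω) (κ : ℝ) : ∃ B : ℝ, 0 ≤ B ∧
    ∀ (K : Geometry.SimplicialComplex ℝ (Eu d)) (h : ℝ), IsMesh Ω K h κ →
    ∀ u : H1 Ω, ∀ v ∈ V1 Ω K, trace v = trace u →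
    ∃ v' ∈ V1 Ω K, trace v' = trace u ∧ ‖v'‖ ≤ B * ‖u‖ := by
  obtain ⟨B1, hB1, h1⟩ := hΩ.exists_interp κ
  obtain ⟨B2, hB2, h2⟩ := hΩ.exists_boundary_correction κ
  obtain ⟨B3, hB3, h3⟩ := hΩ.exists_norm_trace_sq_le
  refine ⟨B1 + √(B2 * (B3 * (B1 * (B1 + 1)))), by positivity, fun K h hM u v hv hvu => ?_⟩
  have hh := hM.pos
  obtain ⟨f, hf, hfv⟩ := IsPWAffine.mem_V1_iff.1 hv
  obtain ⟨g, u', hg, hgu, e1, e2⟩ := h1 K h hM u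
  -- The discrete function `v` is used only through its trace: the correction repairs the boundary
  -- values of the quasi-interpolant `u'`.
  obtain ⟨z, zH, hz, hzH, hzt, hzn⟩ := h2 K h hM (f - g) (v - u') (hf.sub hg) (by
    rw [fn_sub]
    filter_upwards [Lp.coeFn_sub (fn v) (fn u'), hfv, hgu] with x a1 a2 a3
    rw [a1, Pi.sub_apply, Pi.sub_apply, a2, a3])
  have htr : trace (v - u') = trace (u - u') := by
    rw [hΩ.trace_sub, hΩ.trace_sub, hvu]
  refine ⟨u' + zH, IsPWAffine.mem_V1_iff.2 ⟨g + z, hg.add hz, ?_⟩, ?_, ?_⟩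
  · rw [fn_add]
    filter_upwards [Lp.coeFn_add (fn u') (fn zH), hgu, hzH] with x a1 a2 a3
    rw [a1, Pi.add_apply, Pi.add_apply, a2, a3]
  · rw [hΩ.trace_add, hzt, htr, ← hΩ.trace_add, add_sub_cancel]
  · refine (norm_add_le _ _).trans ?_
    rw [add_mul]
    refine add_le_add e2 ?_
    have e3 := h3 (u - u')
    have e4 : ‖fn (u - u')‖ ≤ B1 * h * ‖u‖ := by
      have : fn (u - u') = - fn (u' - u) := by rw [fn_sub, fn_sub, neg_sub]
      rw [this, norm_neg]
      exact e1
    have e5 : ‖u - u'‖ ≤ (B1 + 1) * ‖u‖ := (norm_sub_le _ _).trans (by linarith)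
    -- The trace of `v - u'` equals that of `u - u'`, whose square is of order `h ‖u‖²` by the
    -- multiplicative trace inequality. This factor `h` cancels the one lost in the correction.
    have e6 : h * ‖zH‖ ^ 2 ≤ h * (B2 * (B3 * (B1 * (B1 + 1))) * ‖u‖ ^ 2) := by
      rw [htr] at hzn
      calc _ ≤ B2 * (B3 * (‖fn (u - u')‖ * ‖u - u'‖)) := hzn.trans (by gcongr)
        _ ≤ B2 * (B3 * ((B1 * h * ‖u‖) * ((B1 + 1) * ‖u‖))) := by gcongr
        _ = _ := by ring
    have e7 := le_of_mul_le_mul_left e6 hh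
    refine le_of_sq_le_sq ?_ (by positivity)
    rwa [mul_pow, Real.sq_sqrt (by positivity)]

/-! ### Interpolation operators -/

/-- Modulo `N` the space `V` becomes a copy of `M`, the orthogonal complement of `V ∩ N` in `V`. The
operator projects orthogonally to `V ∩ N` and adds the element of `M` that represents the projection
of `u` modulo `N` to the image of `V`. The extension hypothesis says exactly that passing from a
class modulo `N` back to `M` is bounded by `B`. -/
theorem exists_projection {H : Type*} [NormedAddCommGroup H] [InnerProductSpace ℝ H]
    [CompleteSpace H] (N V : Submodule ℝ H) [CompleteSpace N] [FiniteDimensional ℝ V] {B : ℝ}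
    (hB : 0 ≤ B)
    (hext : ∀ v ∈ V, ∀ u, v - u ∈ N → ∃ v' ∈ V, v' - u ∈ N ∧ ‖v'‖ ≤ B * ‖u‖) :
    ∃ P : H →ₗ[ℝ] H, (∀ u, P u ∈ V) ∧ (∀ u ∈ V, P u = u) ∧ (∀ u ∈ N, P u ∈ N) ∧
      ∀ u, ‖P u‖ ≤ (1 + B) * ‖u‖ := by
  let V0 : Submodule ℝ H := V ⊓ N
  have : FiniteDimensional ℝ V0 := Submodule.finiteDimensional_of_le inf_le_left
  let M : Submodule ℝ H := V ⊓ V0ᗮ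
  have : FiniteDimensional ℝ M := Submodule.finiteDimensional_of_le inf_le_left
  let Q : H →ₗ[ℝ] H := LinearMap.id - N.starProjection.toLinearMap
  have hQ : ∀ u, Q u = u - N.starProjection u := fun u => rfl
  have hQN : ∀ u, u - Q u ∈ N := fun u => by
    rw [hQ, sub_sub_cancel]; exact Submodule.starProjection_apply_mem _ _
  have hQ0 : ∀ u, Q u = 0 → u ∈ N := fun u hu => by
    have := hQN u
    rwa [hu, sub_zero] at this
  have hQ0' : ∀ u ∈ N, Q u = 0 := fun u hu => by
    rw [hQ, Submodule.starProjection_eq_self_iff.2 hu, sub_self]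
  have hQn : ∀ u, ‖Q u‖ ≤ ‖u‖ := fun u => by
    have h1 : Q u = Nᗮ.starProjection u := by
      rw [hQ, Submodule.starProjection_orthogonal_val]
    rw [h1]
    exact Submodule.norm_starProjection_apply_le _ _
  let T : M →ₗ[ℝ] H := Q.comp M.subtype
  have hT : ∀ m : M, T m = Q m := fun _ => rfl
  have hTinj : Function.Injective T := by
    rw [injective_iff_map_eq_zero]
    intro m hm
    have h1 : (m : H) ∈ V0 := ⟨m.2.1, hQ0 _ hm⟩
    have h2 := (Submodule.mem_orthogonal _ _).1 m.2.2 _ h1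
    exact Subtype.ext (inner_self_eq_zero.1 h2)
  let e : M ≃ₗ[ℝ] LinearMap.range T := LinearEquiv.ofInjective T hTinj
  have he : ∀ m : M, ((e m : LinearMap.range T) : H) = Q m := fun m => rfl
  -- The extension `v'` of `Q m` differs from `m` by an element of `V0`, and `m` is orthogonal to
  -- `V0`; so `m` is the shortest choice and `‖m‖ ≤ ‖v'‖`.
  have hen : ∀ m : M, ‖(m : H)‖ ≤ B * ‖Q m‖ := by
    intro m
    obtain ⟨v', hv', h1, h2⟩ := hext m m.2.1 (Q m) (hQN m)
    refine le_trans ?_ h2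
    have h3 : v' - m ∈ V0 := by
      refine ⟨V.sub_mem hv' m.2.1, ?_⟩
      have : v' - (m : H) = (v' - Q m) - (m - Q m) := by abel
      rw [this]
      exact N.sub_mem h1 (hQN m)
    have h4 : inner ℝ (v' - m) (m : H) = 0 := (Submodule.mem_orthogonal _ _).1 m.2.2 _ h3
    have h5 := norm_add_sq_eq_norm_sq_add_norm_sq_real h4
    rw [sub_add_cancel] at h5
    nlinarith [norm_nonneg v', norm_nonneg (m : H), mul_self_nonneg ‖v' - (m : H)‖]
  let S : H →ₗ[ℝ] M := e.symm.toLinearMap.comp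
    ((LinearMap.range T).orthogonalProjectionOnto.toLinearMap.comp Q)
  have hS : ∀ u, e (S u) = (LinearMap.range T).orthogonalProjectionOnto (Q u) := fun u =>
    e.apply_symm_apply _
  refine ⟨V0.starProjection.toLinearMap + M.subtype.comp S, fun u => ?_, fun u hu => ?_,
    fun u hu => ?_, fun u => ?_⟩
  · exact V.add_mem (Submodule.starProjection_apply_mem V0 u).1 (S u).2.1
  · have hm : u - V0.starProjection u ∈ M :=
      ⟨V.sub_mem hu (Submodule.starProjection_apply_mem V0 u).1,
        Submodule.sub_starProjection_mem_orthogonal u⟩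
    have h1 : Q u = e ⟨_, hm⟩ := by
      rw [he, map_sub, hQ0' _ (Submodule.starProjection_apply_mem V0 u).2, sub_zero]
    have h2 : S u = ⟨_, hm⟩ := by
      apply e.injective
      rw [hS, h1, Submodule.orthogonalProjectionOnto_mem_subspace_eq_self]
    change V0.starProjection u + (S u : H) = u
    rw [h2, add_sub_cancel]
  · have h1 : S u = 0 := by
      apply e.injective
      rw [hS, hQ0' u hu, map_zero, map_zero]
    change V0.starProjection u + (S u : H) ∈ N
    rw [h1, ZeroMemClass.coe_zero, add_zero]
    exact (Submodule.starProjection_apply_mem V0 u).2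
  · change ‖V0.starProjection u + (S u : H)‖ ≤ _
    refine (norm_add_le _ _).trans ?_
    rw [add_mul, one_mul]
    refine add_le_add (Submodule.norm_starProjection_apply_le _ _) ((hen (S u)).trans ?_)
    refine mul_le_mul_of_nonneg_left ?_ hB
    rw [← he, hS]
    exact (Submodule.norm_orthogonalProjectionOnto_apply_le _ _).trans (hQn u)

/-- `𝒱₁` as a submodule. -/
def V1Sub (Ω : Set (Eu d)) (K : Geometry.SimplicialComplex ℝ (Eu d)) : Submodule ℝ (H1 Ω) where
  carrier := V1 Ω K
  zero_mem' := IsPWAffine.mem_V1_iff.2 ⟨_, .const 0, Lp.coeFn_zero _ _ _⟩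
  add_mem' := by
    intro a b ha hb
    obtain ⟨f, hf, hfa⟩ := IsPWAffine.mem_V1_iff.1 ha
    obtain ⟨g, hg, hgb⟩ := IsPWAffine.mem_V1_iff.1 hb
    exact IsPWAffine.mem_V1_iff.2 ⟨f + g, hf.add hg, (Lp.coeFn_add (fn a) (fn b)).trans (hfa.add hgb)⟩
  smul_mem' := by
    intro c a ha
    obtain ⟨f, hf, hfa⟩ := IsPWAffine.mem_V1_iff.1 ha
    exact IsPWAffine.mem_V1_iff.2
      ⟨c • f, hf.const_smul c, (Lp.coeFn_smul c (fn a)).trans (hfa.const_smul c)⟩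

/-- Nodal hat functions span: a member minus its nodal expansion vanishes at all vertices, hence on
each element. -/
theorem IsTri.finiteDimensional_V1Sub {K : Geometry.SimplicialComplex ℝ (Eu d)} (h : IsTri Ω K) :
    FiniteDimensional ℝ (V1Sub Ω K) := by
  classical
  choose v hv hvc using fun p : Eu d => h.exists_nodal (fun q => if q = p then (1 : ℝ) else 0)
  choose u hu hgu using fun p => (hv p).exists_H1 h
  let F : Finset (Eu d) := h.tops.biUnion id
  have hle : V1Sub Ω K ≤ Submodule.span ℝ (F.image u : Set (H1 Ω)) := by
    intro a ha
    obtain ⟨f, hf, hfa⟩ := IsPWAffine.mem_V1_iff.1 ha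
    have key : ∀ G : Finset (Eu d), IsPWAffine Ω K (∑ p ∈ G, f p • v p) ∧
        fn (∑ p ∈ G, f p • u p) =ᵐ[volume.restrict Ω] ∑ p ∈ G, f p • v p := by
      intro G
      induction G using Finset.induction_on with
      | empty => exact ⟨.const 0, Lp.coeFn_zero _ _ _⟩
      | insert p G hp ih =>
        rw [Finset.sum_insert hp, Finset.sum_insert hp]
        refine ⟨((hv p).const_smul _).add ih.1, ?_⟩
        rw [fn_add, fn_smul]
        exact (Lp.coeFn_add _ _).trans
          (((Lp.coeFn_smul (f p) (fn (u p))).trans ((hu p).const_smul _)).add ih.2)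
    have hfe : ∀ y ∈ closure Ω, f y = (∑ p ∈ F, f p • v p) y := by
      intro y hy
      obtain ⟨s, hs, hys⟩ := h.exists_topFace hy
      have := (hf.sub (key F).1).abs_le_of_forall hs (c := 0) (δ := 0) (fun q hq => ?_) hys
      · rw [sub_zero, Pi.sub_apply] at this
        exact sub_eq_zero.1 (abs_nonpos_iff.1 this)
      · rw [sub_zero, Pi.sub_apply, Finset.sum_apply, Finset.sum_eq_single q]
        · rw [Pi.smul_apply, hvc q s hs q hq, if_pos rfl]
          simp
        · intro p _ hpq
          rw [Pi.smul_apply, hvc p s hs q hq, if_neg hpq.symm, smul_zero]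
        · intro hqF
          exact absurd (Finset.mem_biUnion.2 ⟨s, h.mem_tops.2 hs, hq⟩) hqF
    have ha2 : a = ∑ p ∈ F, f p • u p := by
      refine H1_ext h.dom.isOpen (Lp.ext ?_)
      have hmem : ∀ᵐ y ∂(volume.restrict Ω), y ∈ Ω := ae_restrict_mem h.dom.isOpen.measurableSet
      filter_upwards [hfa, (key F).2, hmem] with y h1 h2 h3
      rw [h1, h2, hfe y (subset_closure h3)]
    rw [ha2]
    refine Submodule.sum_mem _ fun p hp => Submodule.smul_mem _ _ (Submodule.subset_span ?_)
    exact_mod_cast Finset.mem_image_of_mem u hp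
  exact Submodule.finiteDimensional_of_le hle

/-- `H¹_⋄(Ω)` as a submodule. -/
def IsLipDomain.mean0Sub (hΩ : IsLipDomain Ω) : Submodule ℝ (H1 Ω) := LinearMap.ker hΩ.bdMean.toLinearMap

/-- `H¹₀(Ω)` as a submodule. -/
def IsLipDomain.zeroSub (hΩ : IsLipDomain Ω) : Submodule ℝ (H1 Ω) := LinearMap.ker hΩ.traceL.toLinearMap

namespace IsLipDomain

theorem mem_mean0Sub (hΩ : IsLipDomain Ω) {u : H1 Ω} : u ∈ hΩ.mean0Sub ↔ u ∈ H1Mean0 Ω :=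
  hΩ.mem_H1Mean0_iff.symm

theorem mem_zeroSub (hΩ : IsLipDomain Ω) {u : H1 Ω} : u ∈ hΩ.zeroSub ↔ u ∈ H1Zero Ω := by
  change (trace u : L2Bd Ω) = 0 ↔ trace u = 0
  rw [ZeroMemClass.coe_eq_zero]

theorem zeroSub_le (hΩ : IsLipDomain Ω) : hΩ.zeroSub ≤ hΩ.mean0Sub := by
  intro u hu
  have hu : hΩ.traceL u = 0 := hu
  change hΩ.bdMean u = 0
  rw [bdMean, ContinuousLinearMap.comp_apply, hu, map_zero]

theorem completeSpace_mean0Sub (hΩ : IsLipDomain Ω) : CompleteSpace hΩ.mean0Sub :=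
  hΩ.bdMean.isClosed_ker.completeSpace_coe

theorem completeSpace_zeroSub (hΩ : IsLipDomain Ω) : CompleteSpace hΩ.zeroSub :=
  hΩ.traceL.isClosed_ker.completeSpace_coe

theorem sub_mem_zeroSub (hΩ : IsLipDomain Ω) {u v : H1 Ω} : u - v ∈ hΩ.zeroSub ↔ trace u = trace v := by
  rw [hΩ.mem_zeroSub]
  change trace (u - v) = 0 ↔ _
  rw [hΩ.trace_sub, sub_eq_zero]

/-- The abstract projection is used with `N` the functions of zero trace and `V` the discrete
functions of zero boundary mean. The discrete extension stays in `V`, since it differs from a member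
of `V` by a function of zero trace. -/
theorem exists_interpolation_of_mesh (hΩ : IsLipDomain Ω) (κ : ℝ) : ∃ C : ℝ,
    ∀ (K : Geometry.SimplicialComplex ℝ (Eu d)) (h : ℝ), IsMesh Ω K h κ →
    ∃ P : H1 Ω →ₗ[ℝ] H1 Ω, (∀ u, P u ∈ V1Mean0 Ω K) ∧ (∀ u ∈ V1Mean0 Ω K, P u = u) ∧
      (∀ u ∈ H1Zero Ω, P u ∈ V1Zero Ω K) ∧ ∀ u, ‖P u‖ ≤ C * ‖u‖ := by
  obtain ⟨B, hB, hext⟩ := hΩ.exists_discrete_extension κ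
  refine ⟨1 + B, fun K h hM => ?_⟩
  have := hΩ.completeSpace_zeroSub
  have := hM.finiteDimensional_V1Sub
  have : FiniteDimensional ℝ (V1Sub Ω K ⊓ hΩ.mean0Sub : Submodule ℝ (H1 Ω)) :=
    Submodule.finiteDimensional_of_le inf_le_left
  obtain ⟨P, h1, h2, h3, h4⟩ := exists_projection hΩ.zeroSub (V1Sub Ω K ⊓ hΩ.mean0Sub) hB (by
    intro v hv u hvu
    obtain ⟨v', hv', h1, h2⟩ := hext K h hM u v hv.1 (hΩ.sub_mem_zeroSub.1 hvu)
    refine ⟨v', ⟨hv', ?_⟩, hΩ.sub_mem_zeroSub.2 h1, h2⟩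
    have h3 : v' - v ∈ hΩ.zeroSub := by
      rw [hΩ.sub_mem_zeroSub, h1, hΩ.sub_mem_zeroSub.1 hvu]
    have := Submodule.add_mem _ (hΩ.zeroSub_le h3) hv.2
    rwa [sub_add_cancel] at this)
  refine ⟨P, fun u => ⟨(h1 u).1, hΩ.mem_mean0Sub.1 (h1 u).2⟩,
    fun u hu => h2 u ⟨hu.1, hΩ.mem_mean0Sub.2 hu.2⟩,
    fun u hu => ⟨(h1 u).1, hΩ.mem_zeroSub.1 (h3 u (hΩ.mem_zeroSub.2 hu))⟩, h4⟩

end IsLipDomain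

theorem exists_isMesh (hΩ : IsLipDomain Ω) {T : ℝ → Geometry.SimplicialComplex ℝ (Eu d)}
    (hT : ∀ h ∈ Ioo (0 : ℝ) 1, IsTriangulation Ω (T h)) (hTr : IsRegularFamily T)
    (hTq : IsQuasiUniformFamily T) : ∃ κ, ∀ h ∈ Ioo (0 : ℝ) 1, IsMesh Ω (T h) h κ := by
  -- The inscribed ball has radius `σ diam S ≥ σ τ h`, so `κ = σ τ`.
  obtain ⟨σ, hσ, h1⟩ := hTr
  obtain ⟨τ, hτ, h2⟩ := hTq
  refine ⟨σ * τ, fun h hh => ⟨⟨hΩ, hT h hh⟩, hh.1, hh.2.le, mul_pos hσ hτ, fun s hs => ?_,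
    fun s hs => ?_⟩⟩
  · exact (h2 h hh _ ⟨s, hs.1, hs.2, rfl⟩).2
  · obtain ⟨x, hx⟩ := h1 h hh _ ⟨s, hs.1, hs.2, rfl⟩
    refine ⟨x, (Metric.closedBall_subset_closedBall ?_).trans hx⟩
    rw [mul_assoc]
    exact mul_le_mul_of_nonneg_left (h2 h hh _ ⟨s, hs.1, hs.2, rfl⟩).1 hσ.le

theorem exists_isInterpolation (hΩ : IsLipDomain Ω) {T : ℝ → Geometry.SimplicialComplex ℝ (Eu d)}
    {κ : ℝ} (hM : ∀ h ∈ Ioo (0 : ℝ) 1, IsMesh Ω (T h) h κ) :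
    ∃ P : ℝ → H1 Ω →ₗ[ℝ] H1 Ω, IsInterpolation Ω T P := by
  obtain ⟨C, hC⟩ := hΩ.exists_interpolation_of_mesh κ
  choose! P hP using fun h (hh : h ∈ Ioo (0 : ℝ) 1) => hC (T h) h (hM h hh)
  exact ⟨P, fun h hh => (hP h hh).1, fun h hh => (hP h hh).2.1, fun h hh => (hP h hh).2.2.1,
    C, fun h hh => (hP h hh).2.2.2⟩

/-! ### Approximation -/

/-- Nodal interpolation of a `C¹` function. Uniform continuity of the gradient makes the first order
expansion `ℓ` at a point accurate to `η h` on an element. The nodal interpolant minus `ℓ` is affine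
and of this size at the vertices, so the inscribed ball bounds its slope by a multiple of `η`. No
second derivatives are involved. -/
theorem IsLipDomain.exists_mem_V1_close_smooth (hΩ : IsLipDomain Ω) {κ : ℝ} (hκ : 0 < κ)
    {φ : Eu d → ℝ} {w : H1 Ω} (hφ : ContDiff ℝ 1 φ) (hw : fn w =ᵐ[volume.restrict Ω] φ) {ε : ℝ}
    (hε : 0 < ε) : ∃ δ > 0, ∀ (K : Geometry.SimplicialComplex ℝ (Eu d)) (h : ℝ),
      IsMesh Ω K h κ → h < δ → ∃ u ∈ V1 Ω K, ‖u - w‖ ≤ ε := by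
  have hfin := isFiniteMeasure_restrict hΩ.bounded
  set m := (volume Ω).toReal with hm
  have hvol : volume Ω = ENNReal.ofReal m := (ENNReal.ofReal_toReal hΩ.bounded.measure_lt_top.ne).symm
  have hm0 : 0 ≤ m := ENNReal.toReal_nonneg
  set D : ℝ := √((2 ^ 2 + (2 / κ + 1) ^ 2) * m) + 1 with hD
  have hD0 : 0 < D := by positivity
  set η := ε / D with hη
  have hη0 : 0 < η := by positivity
  have huc := hΩ.bounded.isCompact_closure.uniformContinuousOn_of_continuous
    (continuous_gradient hφ).continuousOn
  obtain ⟨δ, hδ, hδ'⟩ := Metric.uniformContinuousOn_iff.1 huc η hη0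
  refine ⟨δ, hδ, fun K h hM hhδ => ?_⟩
  have hh := hM.pos
  obtain ⟨v, hv, hvφ⟩ := hM.exists_nodal φ
  obtain ⟨u, hu, -⟩ := hv.exists_H1 hM.toIsTri
  refine ⟨u, IsPWAffine.mem_V1_iff.2 ⟨v, hv, hu⟩, ?_⟩
  have hdiff : Differentiable ℝ φ := hφ.differentiable (by simp)
  have htay : ∀ s ∈ topFaces K, ∀ x ∈ convexHull ℝ (s : Set (Eu d)),
      ∀ y ∈ convexHull ℝ (s : Set (Eu d)),
        |φ y - φ x - inner ℝ (gradient φ x) (y - x)| ≤ η * ‖y - x‖ := by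
    intro s hs x hx y hy
    have h1 := (convex_convexHull ℝ (s : Set (Eu d))).norm_image_sub_le_of_norm_fderiv_le'
      (f := φ) (φ := fderiv ℝ φ x) (C := η) (fun z _ => hdiff z) (fun z hz => ?_) hx hy
    · rw [Real.norm_eq_abs] at h1
      convert h1 using 3
      rw [gradient, InnerProductSpace.toDual_symm_apply]
    · have h2 : ‖gradient φ z - gradient φ x‖ < η := by
        rw [← dist_eq_norm]
        exact hδ' z (hM.convexHull_subset hs.1 hz) x (hM.convexHull_subset hs.1 hx)
          ((hM.dist_le hs hz hx).trans_lt hhδ)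
      rw [gradient, gradient, ← map_sub, LinearIsometryEquiv.norm_map] at h2
      exact h2.le
  have hloc : ∀ s ∈ topFaces K, ∀ x ∈ convexHull ℝ (s : Set (Eu d)),
      |v x - φ x| ≤ 2 * η ∧ ∀ y ∈ convexHull ℝ (s : Set (Eu d)),
        |(v y - φ y) - (v x - φ x)| ≤ (2 / κ + 1) * η * ‖y - x‖ := by
    intro s hs x hx
    obtain ⟨A, hA⟩ := hv.affine s hs
    obtain ⟨c, hc⟩ := hM.exists_ball s hs
    let ℓ : Eu d →ᵃ[ℝ] ℝ := AffineMap.const ℝ _ (φ x - inner ℝ (gradient φ x) x) +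
      (innerSL ℝ (gradient φ x)).toLinearMap.toAffineMap
    have hℓ : ∀ y, ℓ y = φ x + inner ℝ (gradient φ x) (y - x) := fun y => by
      have : ℓ y = (φ x - inner ℝ (gradient φ x) x) + inner ℝ (gradient φ x) y := rfl
      rw [this, inner_sub_right]; ring
    have hv' : IsPWAffine Ω K (v - ℓ) := hv.sub
      ⟨ℓ.continuous_of_finiteDimensional.continuousOn, fun _ _ => ⟨ℓ, fun _ _ => rfl⟩⟩
    have hbd : ∀ y ∈ convexHull ℝ (s : Set (Eu d)), |v y - ℓ y| ≤ η * h := by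
      intro y hy
      have := hv'.abs_le_of_forall hs (c := 0) (δ := η * h) (fun p hp => ?_) hy
      · rwa [sub_zero] at this
      · rw [sub_zero, Pi.sub_apply, hvφ s hs p hp, hℓ, ← sub_sub]
        refine (htay s hs x hx p (subset_convexHull ℝ _ hp)).trans ?_
        rw [← dist_eq_norm]
        exact mul_le_mul_of_nonneg_left (hM.dist_le hs (subset_convexHull ℝ _ hp) hx) hη0.le
    constructor
    · have h1 := hbd x hx
      rw [hℓ, sub_self, inner_zero_right, add_zero] at h1
      nlinarith [hM.le_one]
    · intro y hy
      have h1 : |(v y - ℓ y) - (v x - ℓ x)| ≤ 2 * (η * h) / (κ * h) * ‖y - x‖ := by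
        have := norm_linear_le (A := A - ℓ) hM.mul_pos hc (δ := 2 * (η * h)) (fun a ha b hb => ?_) x y
        · rw [hA hy, hA hx]; exact this
        · have e1 := hbd a ha
          have e2 := hbd b hb
          rw [hA ha] at e1
          rw [hA hb] at e2
          refine (abs_sub (A a - ℓ a) (A b - ℓ b)).trans (by linarith)
      have h2 := htay s hs x hx y hy
      have h3 : 2 * (η * h) / (κ * h) = 2 / κ * η := by field_simp
      rw [h3] at h1
      have h4 : (v y - φ y) - (v x - φ x) = ((v y - ℓ y) - (v x - ℓ x)) -
          (φ y - φ x - inner ℝ (gradient φ x) (y - x)) := by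
        rw [hℓ, hℓ, sub_self, inner_zero_right]; ring
      rw [h4]
      refine (abs_sub _ _).trans ?_
      linarith
  -- The interpolation error itself is pointwise Lipschitz with a small constant, which bounds its
  -- weak gradient without differentiating across faces.
  have hLL : LocLip Ω ((2 / κ + 1) * η) (fun x => v x - φ x) :=
    IsPWAffine.locLip hM.toIsTri fun s hs x hx y hy => (hloc s hs x hx).2 y hy
  have hfn : fn (u - w) =ᵐ[volume.restrict Ω] fun x => v x - φ x := by
    rw [fn_sub]
    filter_upwards [Lp.coeFn_sub (fn u) (fn w), hu, hw] with x a1 a2 a3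
    rw [a1, Pi.sub_apply, a2, a3]
  have hL0 : 0 ≤ (2 / κ + 1) * η := by positivity
  have hgr := hLL.grad_eq hΩ.isOpen hΩ.bounded hL0 hfn
  have hsq : ‖u - w‖ ^ 2 ≤ (2 ^ 2 + (2 / κ + 1) ^ 2) * m * η ^ 2 := by
    have hconst : ∀ r : ℝ, 0 ≤ r → ∫⁻ _ in Ω, ENNReal.ofReal (r ^ 2) ≤ ENNReal.ofReal (r ^ 2 * m) :=
      fun r hr => by
        rw [setLIntegral_const, hvol, ENNReal.ofReal_mul (by positivity)]
    have h1 : ‖fn (u - w)‖ ^ 2 ≤ (2 * η) ^ 2 * m := by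
      refine norm_sq_le_of_lintegral_le hfn (by positivity)
        (le_trans (setLIntegral_mono' hΩ.isOpen.measurableSet fun x hx => ?_)
          (hconst (2 * η) (by positivity)))
      rw [enorm_sq_eq_ofReal]
      obtain ⟨s, hs, hxs⟩ := hM.exists_topFace (subset_closure hx)
      exact ENNReal.ofReal_le_ofReal (pow_le_pow_left₀ (norm_nonneg _) (hloc s hs x hxs).1 2)
    have h2 : ‖grad (u - w)‖ ^ 2 ≤ ((2 / κ + 1) * η) ^ 2 * m := by
      refine norm_sq_le_of_lintegral_le hgr (by positivity)
        (le_trans (setLIntegral_mono' hΩ.isOpen.measurableSet fun x hx => ?_) (hconst _ hL0))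
      rw [enorm_sq_eq_ofReal]
      exact ENNReal.ofReal_le_ofReal (pow_le_pow_left₀ (norm_nonneg _)
        (norm_gradient_le_of_eventually hL0 (hLL x hx)) 2)
    rw [norm_sq_eq]
    linarith
  have hfinal : ‖u - w‖ ≤ √((2 ^ 2 + (2 / κ + 1) ^ 2) * m) * η := by
    refine le_of_sq_le_sq ?_ (by positivity)
    rwa [mul_pow, Real.sq_sqrt (by positivity)]
  calc _ ≤ D * η := hfinal.trans (mul_le_mul_of_nonneg_right (by rw [hD]; linarith) hη0.le)
    _ = ε := by rw [hη]; field_simp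

/-- Constants belong to the discrete space, so the boundary mean of an approximation can be removed.
The constant subtracted is controlled by the approximation error, since `u` has zero boundary mean.
-/
theorem IsLipDomain.exists_mem_V1Mean0_close (hΩ : IsLipDomain Ω) {κ : ℝ} (hκ : 0 < κ) {u : H1 Ω}
    (hu : u ∈ H1Mean0 Ω) {ε : ℝ} (hε : 0 < ε) :
    ∃ δ > 0, ∀ (K : Geometry.SimplicialComplex ℝ (Eu d)) (h : ℝ),
      IsMesh Ω K h κ → h < δ → ∃ v ∈ V1Mean0 Ω K, ‖v - u‖ ≤ ε := by
  obtain ⟨e, he1, he2, he3⟩ := hΩ.exists_one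
  have hm := hΩ.bdMean_pos he3
  set m := hΩ.bdMean e with hmdef
  set D := 1 + ‖hΩ.bdMean‖ / m * ‖e‖ with hD
  have hD0 : 0 < D := by positivity
  have hη : 0 < ε / (2 * D) := by positivity
  obtain ⟨φ, w, hφ, hw, hwu⟩ := exists_smooth_close hΩ.isOpen hΩ.bounded hΩ.lip u hη
  obtain ⟨δ, hδ, h1⟩ := hΩ.exists_mem_V1_close_smooth hκ (hφ.of_le (by exact_mod_cast le_top)) hw hη
  refine ⟨δ, hδ, fun K h hM hh => ?_⟩
  obtain ⟨v, hv, hvw⟩ := h1 K h hM hh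
  have hvu : ‖v - u‖ ≤ ε / D := by
    have : v - u = (v - w) + (w - u) := by abel
    rw [this]
    refine (norm_add_le _ _).trans ((add_le_add hvw hwu).trans_eq ?_)
    field_simp; ring
  have heV : e ∈ V1Sub Ω K := IsPWAffine.mem_V1_iff.2 ⟨_, .const 1, he1⟩
  set c := hΩ.bdMean v / m with hc
  refine ⟨v - c • e, ⟨(V1Sub Ω K).sub_mem hv ((V1Sub Ω K).smul_mem c heV), ?_⟩, ?_⟩
  · rw [hΩ.mem_H1Mean0_iff, map_sub, map_smul, smul_eq_mul, ← hmdef, hc, div_mul_cancel₀ _ hm.ne',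
      sub_self]
  · have h2 : |hΩ.bdMean v| ≤ ‖hΩ.bdMean‖ * ‖v - u‖ := by
      have := hΩ.bdMean.le_opNorm (v - u)
      rwa [map_sub, hΩ.mem_H1Mean0_iff.1 hu, sub_zero] at this
    have h3 : ‖c • e‖ ≤ ‖hΩ.bdMean‖ / m * ‖e‖ * ‖v - u‖ := by
      rw [norm_smul, hc, norm_div, Real.norm_of_nonneg hm.le, Real.norm_eq_abs]
      calc _ ≤ ‖hΩ.bdMean‖ * ‖v - u‖ / m * ‖e‖ := by gcongr
        _ = _ := by ring
    have : v - c • e - u = (v - u) - c • e := by abel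
    rw [this]
    calc _ ≤ ‖v - u‖ + ‖c • e‖ := norm_sub_le _ _
      _ ≤ D * ‖v - u‖ := by rw [hD]; linarith
      _ ≤ D * (ε / D) := by gcongr
      _ = ε := by field_simp

/-- Interpolation operators converge strongly. -/
theorem IsInterpolation.tendsto {T : ℝ → Geometry.SimplicialComplex ℝ (Eu d)} {κ : ℝ}
    (hΩ : IsLipDomain Ω) (hM : ∀ h ∈ Ioo (0 : ℝ) 1, IsMesh Ω (T h) h κ)
    {P : ℝ → H1 Ω →ₗ[ℝ] H1 Ω} (hP : IsInterpolation Ω T P) {h : ℕ → ℝ}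
    (hh : ∀ n, h n ∈ Ioo (0 : ℝ) 1) (hh0 : Tendsto h atTop (𝓝 0)) {w : ℕ → H1 Ω} {u : H1 Ω}
    (hu : u ∈ H1Mean0 Ω) (hw : Tendsto w atTop (𝓝 u)) :
    Tendsto (fun n => P (h n) (w n)) atTop (𝓝 u) := by
  obtain ⟨C, hC⟩ := hP.stable
  have hC' : ∀ h ∈ Ioo (0 : ℝ) 1, ∀ u, ‖P h u‖ ≤ |C| * ‖u‖ := fun h hh u =>
    (hC h hh u).trans (mul_le_mul_of_nonneg_right (le_abs_self C) (norm_nonneg u))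
  have hκ := (hM (h 0) (hh 0)).shape_pos
  rw [Metric.tendsto_atTop] at hw ⊢
  intro ε hε
  set η := ε / (2 * |C| + 2) with hη
  have hη0 : 0 < η := by positivity
  obtain ⟨δ, hδ, h1⟩ := hΩ.exists_mem_V1Mean0_close hκ hu hη0
  obtain ⟨n1, hn1⟩ := hw η hη0
  obtain ⟨n2, hn2⟩ := (hh0.eventually (gt_mem_nhds hδ)).exists_forall_of_atTop
  refine ⟨max n1 n2, fun n hn => ?_⟩
  obtain ⟨v, hv, hvu⟩ := h1 (T (h n)) (h n) (hM _ (hh n)) (hn2 n (le_of_max_le_right hn))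
  have h2 := hn1 n (le_of_max_le_left hn)
  rw [dist_eq_norm] at h2 ⊢
  -- The discrete approximation `v` is fixed by the projection, so every term on the right is small
  -- by uniform boundedness.
  have h3 : P (h n) (w n) - u = P (h n) (w n - u) - P (h n) (v - u) + (v - u) := by
    rw [map_sub, map_sub, hP.proj _ (hh n) v hv]; abel
  rw [h3]
  have h4 := hC' (h n) (hh n) (w n - u)
  have h5 := hC' (h n) (hh n) (v - u)
  have h6 : |C| * ‖w n - u‖ ≤ |C| * η := by gcongr
  have h7 : |C| * ‖v - u‖ ≤ |C| * η := by gcongr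
  have h8 : (2 * |C| + 2) * η = ε := by rw [hη]; field_simp
  calc _ ≤ ‖P (h n) (w n - u)‖ + ‖P (h n) (v - u)‖ + ‖v - u‖ :=
        (norm_add_le _ _).trans (add_le_add_left (norm_sub_le _ _) _)
    _ < ε := by linarith

/-! ### The energy form -/

/-- Lax–Milgram on the closed subspace `X`. One formulation serves the continuous and discrete,
Neumann and Dirichlet problems. -/
theorem exists_variational_solution {H F' : Type*} [NormedAddCommGroup H] [InnerProductSpace ℝ H]
    [NormedAddCommGroup F'] [InnerProductSpace ℝ F'] (X : Submodule ℝ H) [CompleteSpace X]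
    (G : H →L[ℝ] F') (M : F' →L[ℝ] F') {c : ℝ} (hc : 0 < c)
    (hX : ∀ u ∈ X, c * ‖u‖ ^ 2 ≤ inner ℝ (M (G u)) (G u)) (F : H →L[ℝ] ℝ) :
    ∃ u ∈ X, ∀ φ ∈ X, inner ℝ (M (G u)) (G φ) = F φ := by
  let g : X →L[ℝ] F' := G.comp X.subtypeL
  let B : X →L[ℝ] X →L[ℝ] ℝ :=
    (ContinuousLinearMap.flip ((ContinuousLinearMap.flip ((innerSL ℝ).comp (M.comp g))).comp g))
  have hB : ∀ u v : X, B u v = inner ℝ (M (G u)) (G v) := fun u v => rfl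
  have hC : IsCoercive B := by
    refine ⟨c, hc, fun u => ?_⟩
    rw [hB, mul_assoc, ← pow_two]
    exact hX u u.2
  let e := hC.continuousLinearEquivOfBilin
  let z : X := (InnerProductSpace.toDual ℝ X).symm (F.comp X.subtypeL)
  refine ⟨e.symm z, (e.symm z).2, fun φ hφ => ?_⟩
  have h1 := hC.continuousLinearEquivOfBilin_apply (e.symm z) ⟨φ, hφ⟩
  rw [hB] at h1
  refine h1.symm.trans ?_
  have h2 : hC.continuousLinearEquivOfBilin (e.symm z) = z := e.apply_symm_apply z
  rw [h2, InnerProductSpace.toDual_symm_apply]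
  rfl

section Energy

variable {ql qu : ℝ} {q : Eu d → ℝ}

theorem memLp_smul_of_conductivity (hql : 0 < ql) (hq : q ∈ Conductivities Ω ql qu) (G : L2Vec Ω) :
    MemLp (fun x => q x • G x) 2 (volume.restrict Ω) := by
  refine MemLp.of_le_mul (c := qu) (Lp.memLp G) (hq.1.smul (Lp.aestronglyMeasurable G)) ?_
  filter_upwards [hq.2] with x hx
  rw [norm_smul, Real.norm_of_nonneg (hql.le.trans hx.1)]
  exact mul_le_mul_of_nonneg_right hx.2 (norm_nonneg _)

/-- Multiplication of vector fields by a conductivity. -/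
def condMul (hql : 0 < ql) (hq : q ∈ Conductivities Ω ql qu) : L2Vec Ω →L[ℝ] L2Vec Ω :=
  LinearMap.mkContinuous
    { toFun := fun G => (memLp_smul_of_conductivity hql hq G).toLp _
      map_add' := fun F G => by
        refine Lp.ext ?_
        filter_upwards [(memLp_smul_of_conductivity hql hq (F + G)).coeFn_toLp,
          (memLp_smul_of_conductivity hql hq F).coeFn_toLp,
          (memLp_smul_of_conductivity hql hq G).coeFn_toLp, Lp.coeFn_add F G,
          Lp.coeFn_add ((memLp_smul_of_conductivity hql hq F).toLp _)
            ((memLp_smul_of_conductivity hql hq G).toLp _)] with x h1 h2 h3 h4 h5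
        rw [h1, h5, Pi.add_apply, h2, h3, h4, Pi.add_apply, smul_add]
      map_smul' := fun c F => by
        refine Lp.ext ?_
        filter_upwards [(memLp_smul_of_conductivity hql hq (c • F)).coeFn_toLp,
          (memLp_smul_of_conductivity hql hq F).coeFn_toLp, Lp.coeFn_smul c F,
          Lp.coeFn_smul c ((memLp_smul_of_conductivity hql hq F).toLp _)] with x h1 h2 h3 h4
        rw [h1, RingHom.id_apply, h4, Pi.smul_apply, h2, h3, Pi.smul_apply, smul_comm] }
    qu fun G => by
      refine Lp.norm_le_mul_norm_of_ae_le_mul ?_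
      filter_upwards [hq.2, (memLp_smul_of_conductivity hql hq G).coeFn_toLp] with x hx h1
      refine (congrArg norm h1).trans_le ?_
      rw [norm_smul, Real.norm_of_nonneg (hql.le.trans hx.1)]
      exact mul_le_mul_of_nonneg_right hx.2 (norm_nonneg _)

theorem condMul_ae (hql : 0 < ql) (hq : q ∈ Conductivities Ω ql qu) (G : L2Vec Ω) :
    condMul hql hq G =ᵐ[volume.restrict Ω] fun x => q x • G x :=
  (memLp_smul_of_conductivity hql hq G).coeFn_toLp

theorem norm_condMul_le (hql : 0 < ql) (hqu : 0 < qu) (hq : q ∈ Conductivities Ω ql qu) (G : L2Vec Ω) :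
    ‖condMul hql hq G‖ ≤ qu * ‖G‖ :=
  (ContinuousLinearMap.le_of_opNorm_le _ (LinearMap.mkContinuous_norm_le _ hqu.le _) G)

theorem energy_eq_inner (hql : 0 < ql) (hq : q ∈ Conductivities Ω ql qu) (u v : H1 Ω) :
    energy q u v = inner ℝ (condMul hql hq (grad u)) (grad v) := by
  rw [L2.inner_def, energy]
  refine integral_congr_ae ?_
  filter_upwards [condMul_ae hql hq (grad u)] with x hx
  rw [hx, real_inner_smul_left]

theorem le_inner_condMul (hql : 0 < ql) (hq : q ∈ Conductivities Ω ql qu)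
    (G : L2Vec Ω) : ql * ‖G‖ ^ 2 ≤ inner ℝ (condMul hql hq G) G := by
  rw [← real_inner_self_eq_norm_sq, ← real_inner_smul_left, L2.inner_def, L2.inner_def]
  refine integral_mono_ae (L2.integrable_inner _ _) (L2.integrable_inner _ _) ?_
  filter_upwards [condMul_ae hql hq G, Lp.coeFn_smul ql G, hq.2] with x h1 h2 h3
  rw [h1, h2, Pi.smul_apply, real_inner_smul_left, real_inner_smul_left]
  exact mul_le_mul_of_nonneg_right h3.1 real_inner_self_nonneg

theorem le_energy (hql : 0 < ql) (hq : q ∈ Conductivities Ω ql qu) (u : H1 Ω) :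
    ql * ‖grad u‖ ^ 2 ≤ energy q u u := by
  rw [energy_eq_inner hql hq]; exact le_inner_condMul hql hq _

theorem energy_add_left (hql : 0 < ql) (hq : q ∈ Conductivities Ω ql qu)
    (u v w : H1 Ω) : energy q (u + v) w = energy q u w + energy q v w := by
  simp only [energy_eq_inner hql hq, grad_add, map_add, inner_add_left]

theorem energy_sub_left (hql : 0 < ql) (hq : q ∈ Conductivities Ω ql qu)
    (u v w : H1 Ω) : energy q (u - v) w = energy q u w - energy q v w := by
  simp only [energy_eq_inner hql hq, grad_sub, map_sub, inner_sub_left]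

/-- Multiplication operators converge strongly if the conductivities converge in `L¹`. -/
theorem tendsto_condMul (hql : 0 < ql) (hqu : 0 < qu) (hq : q ∈ Conductivities Ω ql qu)
    {qn : ℕ → Eu d → ℝ} (hqn : ∀ n, qn n ∈ Conductivities Ω ql qu)
    (hlim : Tendsto (fun n => eLpNorm (qn n - q) 1 (volume.restrict Ω)) atTop (𝓝 0)) (G : L2Vec Ω) :
    Tendsto (fun n => condMul hql (hqn n) G) atTop (𝓝 (condMul hql hq G)) := by
  -- Convergence in `L¹` yields convergence almost everywhere only along a subsequence, so every
  -- subsequence is thinned once more.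
  refine tendsto_of_subseq_tendsto fun ns hns => ?_
  have hm : TendstoInMeasure (volume.restrict Ω) (fun n => qn (ns n)) atTop q :=
    tendstoInMeasure_of_tendsto_eLpNorm one_ne_zero (fun n => (hqn _).1) hq.1 (hlim.comp hns)
  obtain ⟨ms, hms, hae⟩ := hm.exists_seq_tendsto_ae
  refine ⟨ms, ?_⟩
  rw [tendsto_iff_norm_sub_tendsto_zero]
  -- Both conductivities lie in `[ql, qu]` with `ql > 0`, so their difference is at most `qu`, and
  -- `qu² |G|²` dominates.
  have hint : ∫⁻ x in Ω, ENNReal.ofReal (qu ^ 2) * ‖G x‖ₑ ^ 2 ≠ ⊤ := by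
    rw [lintegral_const_mul' _ _ ENNReal.ofReal_ne_top, ← ofReal_norm_sq_eq_lintegral]
    finiteness
  have hl : Tendsto (fun n => ∫⁻ x in Ω, ‖(qn (ns (ms n)) x - q x) • G x‖ₑ ^ 2) atTop
      (𝓝 (∫⁻ _ in Ω, 0)) := by
    refine tendsto_lintegral_of_dominated_convergence' _ (fun n => ?_) (fun n => ?_) hint ?_
    · exact (((hqn _).1.sub hq.1).smul (Lp.aestronglyMeasurable G)).enorm.pow_const 2
    · filter_upwards [(hqn (ns (ms n))).2, hq.2] with x h1 h2
      rw [enorm_sq_eq_ofReal, enorm_sq_eq_ofReal, ← ENNReal.ofReal_mul (by positivity), ← mul_pow]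
      refine ENNReal.ofReal_le_ofReal (pow_le_pow_left₀ (norm_nonneg _) ?_ 2)
      rw [norm_smul]
      refine mul_le_mul_of_nonneg_right ?_ (norm_nonneg _)
      rw [Real.norm_eq_abs, abs_le]
      constructor <;> linarith [h1.1, h1.2, h2.1, h2.2]
    · filter_upwards [hae] with x hx
      have h1 : Tendsto (fun n => (qn (ns (ms n)) x - q x) • G x) atTop (𝓝 0) := by
        have := (hx.sub_const (q x)).smul_const (G x)
        rwa [sub_self, zero_smul] at this
      have h2 := ((ENNReal.continuous_pow 2).tendsto _).comp h1.enorm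
      rw [enorm_zero, zero_pow two_ne_zero] at h2
      exact h2
  rw [lintegral_zero] at hl
  have h2 : Tendsto (fun n => ‖condMul hql (hqn (ns (ms n))) G - condMul hql hq G‖ ^ 2)
      atTop (𝓝 0) := by
    have h3 := (ENNReal.tendsto_toReal ENNReal.zero_ne_top).comp hl
    refine h3.congr fun n => ?_
    rw [norm_sq_eq_toReal_lintegral, Function.comp_apply]
    congr 1
    refine lintegral_congr_ae ?_
    filter_upwards [Lp.coeFn_sub (condMul hql (hqn (ns (ms n))) G) (condMul hql hq G),
      condMul_ae hql (hqn (ns (ms n))) G, condMul_ae hql hq G] with x e1 e2 e3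
    rw [e1, Pi.sub_apply, e2, e3, sub_smul]
  have h4 := h2.sqrt
  simpa [Real.sqrt_sq] using h4

/-- Lax–Milgram for the energy form. -/
theorem exists_energy_solution (hql : 0 < ql) (hq : q ∈ Conductivities Ω ql qu)
    (X : Submodule ℝ (H1 Ω)) [CompleteSpace X] {C : ℝ} (hX : ∀ u ∈ X, ‖u‖ ≤ C * ‖grad u‖)
    (F : H1 Ω →L[ℝ] ℝ) : ∃ u ∈ X, ∀ φ ∈ X, energy q u φ = F φ := by
  refine exists_variational_solution X (gradL Ω) (condMul hql hq) (c := ql / (C ^ 2 + 1))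
    (by positivity) (fun u hu => ?_) F |>.imp fun u hu =>
      ⟨hu.1, fun φ hφ => (energy_eq_inner hql hq u φ).trans (hu.2 φ hφ)⟩
  refine le_trans ?_ (le_inner_condMul hql hq (grad u))
  have h1 : ‖u‖ ^ 2 ≤ C ^ 2 * ‖grad u‖ ^ 2 := by
    rw [← mul_pow]; exact pow_le_pow_left₀ (norm_nonneg _) (hX u hu) 2
  rw [div_mul_eq_mul_div, mul_div_assoc]
  refine mul_le_mul_of_nonneg_left ?_ hql.le
  rw [div_le_iff₀ (by positivity)]
  nlinarith [sq_nonneg ‖grad u‖]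

/-- A Céa type estimate for perturbed conductivities. -/
theorem tendsto_zero_of_energy_eq (hql : 0 < ql) (hqu : 0 < qu) (hq : q ∈ Conductivities Ω ql qu)
    {qn : ℕ → Eu d → ℝ} (hqn : ∀ n, qn n ∈ Conductivities Ω ql qu)
    (hlim : Tendsto (fun n => eLpNorm (qn n - q) 1 (volume.restrict Ω)) atTop (𝓝 0))
    {u : H1 Ω} {v e : ℕ → H1 Ω} {a : ℕ → ℝ} {C : ℝ} (hC : 0 ≤ C)
    (he : ∀ n, ‖e n‖ ≤ C * ‖grad (e n)‖) (hv : Tendsto v atTop (𝓝 u))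
    (ha0 : ∀ n, 0 ≤ a n) (ha : Tendsto a atTop (𝓝 0))
    (heq : ∀ n, energy (qn n) (e n) (e n) ≤
      a n * ‖e n‖ + (energy q u (e n) - energy (qn n) (v n) (e n))) :
    Tendsto e atTop (𝓝 0) := by
  set b : ℕ → ℝ := fun n => ‖condMul hql (hqn n) (grad u) - condMul hql hq (grad u)‖ with hb
  have hb0 : Tendsto b atTop (𝓝 0) :=
    tendsto_iff_norm_sub_tendsto_zero.1 (tendsto_condMul hql hqu hq hqn hlim (grad u))
  have hv0 := tendsto_iff_norm_sub_tendsto_zero.1 hv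
  have hmain : ∀ n, ‖e n‖ ≤ C / ql * (a n * C + b n + qu * ‖v n - u‖) := by
    intro n
    have h1 : energy q u (e n) - energy (qn n) (v n) (e n) ≤
        (b n + qu * ‖v n - u‖) * ‖grad (e n)‖ := by
      -- The difference `q_n - q` is made to multiply only the fixed field `∇u`; strong convergence
      -- of the multiplication operators then suffices, without convergence in `L^∞`.
      have h2 : energy q u (e n) - energy (qn n) (v n) (e n) =
          - inner ℝ (condMul hql (hqn n) (grad u) - condMul hql hq (grad u)) (grad (e n)) -
          inner ℝ (condMul hql (hqn n) (grad (v n - u))) (grad (e n)) := by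
        rw [energy_eq_inner hql hq, energy_eq_inner hql (hqn n), grad_sub, map_sub,
          inner_sub_left, inner_sub_left]
        ring
      have h3 := abs_real_inner_le_norm
        (condMul hql (hqn n) (grad u) - condMul hql hq (grad u)) (grad (e n))
      have h4 := abs_real_inner_le_norm (condMul hql (hqn n) (grad (v n - u))) (grad (e n))
      have h5 : ‖condMul hql (hqn n) (grad (v n - u))‖ ≤ qu * ‖v n - u‖ :=
        (norm_condMul_le hql hqu (hqn n) _).trans (mul_le_mul_of_nonneg_left (norm_grad_le _) hqu.le)
      have h6 := mul_le_mul_of_nonneg_right h5 (norm_nonneg (grad (e n)))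
      rw [h2, add_mul]
      linarith [(abs_le.1 h3).1, (abs_le.1 h4).1]
    have h2 := le_energy hql (hqn n) (e n)
    have h3 : a n * ‖e n‖ ≤ a n * C * ‖grad (e n)‖ := by
      rw [mul_assoc]; exact mul_le_mul_of_nonneg_left (he n) (ha0 n)
    have h4 : ql * ‖grad (e n)‖ ≤ a n * C + b n + qu * ‖v n - u‖ := by
      rcases (norm_nonneg (grad (e n))).eq_or_lt with h0 | h0
      · rw [← h0, mul_zero]
        have := ha0 n
        positivity
      · refine le_of_mul_le_mul_right ?_ h0
        have := heq n
        nlinarith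
    refine (he n).trans ?_
    rw [div_mul_eq_mul_div, mul_div_assoc]
    refine mul_le_mul_of_nonneg_left ?_ hC
    rw [le_div_iff₀ hql, mul_comm]
    exact h4
  refine squeeze_zero_norm hmain ?_
  have := (((ha.mul_const C).add hb0).add (hv0.const_mul qu)).const_mul (C / ql)
  simpa using this

/-- The fluxes `q_n ∇w_n` converge in `L²` to `q ∇u`: the part with `w_n - u` is small by the bound
`qu`, the rest by `tendsto_condMul`. The energy is an inner product of flux and gradient. -/
theorem tendsto_energy (hql : 0 < ql) (hqu : 0 < qu) (hq : q ∈ Conductivities Ω ql qu)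
    {qn : ℕ → Eu d → ℝ} (hqn : ∀ n, qn n ∈ Conductivities Ω ql qu)
    (hlim : Tendsto (fun n => eLpNorm (qn n - q) 1 (volume.restrict Ω)) atTop (𝓝 0))
    {w : ℕ → H1 Ω} {u : H1 Ω} (hw : Tendsto w atTop (𝓝 u)) :
    Tendsto (fun n => energy (qn n) (w n) (w n)) atTop (𝓝 (energy q u u)) := by
  have hg : Tendsto (fun n => grad (w n)) atTop (𝓝 (grad u)) := ((gradL Ω).continuous.tendsto u).comp hw
  have h1 : Tendsto (fun n => condMul hql (hqn n) (grad (w n - u))) atTop (𝓝 0) := by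
    refine squeeze_zero_norm (a := fun n => qu * ‖w n - u‖) (fun n => ?_) ?_
    · exact (norm_condMul_le hql hqu (hqn n) _).trans (mul_le_mul_of_nonneg_left (norm_grad_le _) hqu.le)
    · simpa using (tendsto_iff_norm_sub_tendsto_zero.1 hw).const_mul qu
  have h2 : Tendsto (fun n => condMul hql (hqn n) (grad (w n))) atTop
      (𝓝 (condMul hql hq (grad u))) := by
    have := h1.add (tendsto_condMul hql hqu hq hqn hlim (grad u))
    rw [zero_add] at this
    refine this.congr fun n => ?_
    rw [← map_add, grad_sub, sub_add_cancel]
  rw [energy_eq_inner hql hq]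
  refine (h2.inner hg).congr fun n => ?_
  rw [energy_eq_inner hql (hqn n)]

end Energy

/-! ### Boundary functionals -/

theorem normHalf_nonneg (g : HHalf Ω) : 0 ≤ normHalf g := by
  refine Real.sInf_nonneg ?_
  rintro _ ⟨u, -, rfl⟩
  exact norm_nonneg u

theorem sub_mem_HNegHalf {j j' : HHalf Ω →ₗ[ℝ] ℝ} (hj : j ∈ HNegHalf Ω) (hj' : j' ∈ HNegHalf Ω) :
    j - j' ∈ HNegHalf Ω := by
  obtain ⟨C, hC⟩ := hj
  obtain ⟨C', hC'⟩ := hj'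
  refine ⟨C + C', fun g => ?_⟩
  rw [LinearMap.sub_apply, add_mul]
  exact (abs_sub _ _).trans (add_le_add (hC g) (hC' g))

theorem normNegHalf_nonneg (j : HHalf Ω →ₗ[ℝ] ℝ) : 0 ≤ normNegHalf j :=
  Real.sInf_nonneg fun _ h => h.1

theorem abs_le_normNegHalf_mul {j : HHalf Ω →ₗ[ℝ] ℝ} (hj : j ∈ HNegHalf Ω) (g : HHalf Ω) :
    |j g| ≤ normNegHalf j * normHalf g := by
  obtain ⟨C, hC⟩ := hj
  have hne : {C : ℝ | 0 ≤ C ∧ ∀ g, |j g| ≤ C * normHalf g}.Nonempty :=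
    ⟨|C|, abs_nonneg C, fun g => (hC g).trans
      (mul_le_mul_of_nonneg_right (le_abs_self C) (normHalf_nonneg g))⟩
  rcases (normHalf_nonneg g).eq_or_lt with h0 | h0
  · have := hC g
    rw [← h0, mul_zero] at this ⊢
    exact this
  · rw [← div_le_iff₀ h0]
    refine le_csInf hne fun D hD => ?_
    rw [div_le_iff₀ h0]
    exact hD.2 g

theorem IsLipDomain.abs_trace_le (hΩ : IsLipDomain Ω) {j : HHalf Ω →ₗ[ℝ] ℝ} (hj : j ∈ HNegHalf Ω)
    (u : H1 Ω) : |j (trace u)| ≤ normNegHalf j * ‖u‖ :=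
  (abs_le_normNegHalf_mul hj _).trans
    (mul_le_mul_of_nonneg_left (hΩ.normHalf_trace_le u) (normNegHalf_nonneg j))

/-- The functional `u ↦ ⟨j, γu⟩` on `H¹(Ω)`. -/
def IsLipDomain.bdFunctional (hΩ : IsLipDomain Ω) {j : HHalf Ω →ₗ[ℝ] ℝ} (hj : j ∈ HNegHalf Ω) :
    H1 Ω →L[ℝ] ℝ :=
  (j.comp hΩ.traceLin).mkContinuous (normNegHalf j) fun u => hΩ.abs_trace_le hj u

/-! ### Existence of solutions -/

section Existence

variable {ql qu : ℝ} {q : Eu d → ℝ} {K : Geometry.SimplicialComplex ℝ (Eu d)}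

/-- The solution operators are arbitrary choices, so existence is what makes them solutions.
Uniqueness is not required, since the convergence argument applies to any choice. -/
theorem isNeumannSol_neumann (h : IsTri Ω K) (hql : 0 < ql)
    (hq : q ∈ Conductivities Ω ql qu) (f : HNegOne Ω) {j : HHalf Ω →ₗ[ℝ] ℝ} (hj : j ∈ HNegHalf Ω) :
    IsNeumannSol f q j (neumann f q j) := by
  obtain ⟨C, hC, hP⟩ := h.exists_norm_le_grad
  have := h.dom.completeSpace_mean0Sub
  obtain ⟨u, hu, hs⟩ := exists_energy_solution hql hq h.dom.mean0Sub
    (fun u hu => hP u (h.dom.mem_mean0Sub.1 hu)) (h.dom.bdFunctional hj + f)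
  exact Classical.epsilon_spec (p := IsNeumannSol f q j)
    ⟨u, h.dom.mem_mean0Sub.1 hu, fun φ hφ => hs φ (h.dom.mem_mean0Sub.2 hφ)⟩

/-- A lift `w` of the boundary value is fixed, and Lax–Milgram on functions of zero trace provides
the remainder, with the energy against `w` moved to the right-hand side. -/
theorem isDirichletSol_dirichlet (h : IsTri Ω K) (hql : 0 < ql)
    (hq : q ∈ Conductivities Ω ql qu) (f : HNegOne Ω) (g : HHalf Ω) :
    IsDirichletSol f q g (dirichlet f q g) := by
  obtain ⟨C, hC, hP⟩ := h.exists_norm_le_grad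
  have := h.dom.completeSpace_zeroSub
  obtain ⟨w, hw, -⟩ := h.dom.exists_extension g one_pos
  obtain ⟨u, hu, hs⟩ := exists_energy_solution hql hq h.dom.zeroSub
    (fun u hu => hP u (h.dom.mem_mean0Sub.1 (h.dom.zeroSub_le hu)))
    (f - (innerSL ℝ (condMul hql hq (grad w))).comp (gradL Ω))
  refine Classical.epsilon_spec (p := IsDirichletSol f q g) ⟨w + u, ?_, fun ψ hψ => ?_⟩
  · rw [h.dom.trace_add, hw, h.dom.mem_zeroSub.1 hu, add_zero]
  · rw [energy_add_left hql hq, hs ψ (h.dom.mem_zeroSub.2 hψ), energy_eq_inner hql hq]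
    change _ + (f ψ - inner ℝ (condMul hql hq (grad w)) (grad ψ)) = f ψ
    ring

theorem isDiscNeumannSol_discNeumann (h : IsTri Ω K) (hql : 0 < ql)
    (hq : q ∈ Conductivities Ω ql qu) (f : HNegOne Ω) {j : HHalf Ω →ₗ[ℝ] ℝ} (hj : j ∈ HNegHalf Ω) :
    IsDiscNeumannSol K f q j (discNeumann K f q j) := by
  obtain ⟨C, hC, hP⟩ := h.exists_norm_le_grad
  have := h.finiteDimensional_V1Sub
  have : FiniteDimensional ℝ (V1Sub Ω K ⊓ h.dom.mean0Sub : Submodule ℝ (H1 Ω)) :=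
    Submodule.finiteDimensional_of_le inf_le_left
  have := FiniteDimensional.complete ℝ (V1Sub Ω K ⊓ h.dom.mean0Sub : Submodule ℝ (H1 Ω))
  obtain ⟨u, hu, hs⟩ := exists_energy_solution hql hq (V1Sub Ω K ⊓ h.dom.mean0Sub)
    (fun u hu => hP u (h.dom.mem_mean0Sub.1 hu.2)) (h.dom.bdFunctional hj + f)
  exact Classical.epsilon_spec (p := IsDiscNeumannSol K f q j)
    ⟨u, ⟨hu.1, h.dom.mem_mean0Sub.1 hu.2⟩, fun φ hφ => hs φ ⟨hφ.1, h.dom.mem_mean0Sub.2 hφ.2⟩⟩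

theorem isDiscDirichletSol_discDirichlet (h : IsTri Ω K) (hql : 0 < ql)
    (hq : q ∈ Conductivities Ω ql qu) (f : HNegOne Ω) {P : H1 Ω →ₗ[ℝ] H1 Ω} {E : HHalf Ω → H1 Ω}
    {g : HHalf Ω} (hPE : P (E g) ∈ V1Mean0 Ω K) :
    IsDiscDirichletSol K P E f q g (discDirichlet K P E f q g) := by
  obtain ⟨C, hC, hP⟩ := h.exists_norm_le_grad
  have := h.finiteDimensional_V1Sub
  have : FiniteDimensional ℝ (V1Sub Ω K ⊓ h.dom.zeroSub : Submodule ℝ (H1 Ω)) :=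
    Submodule.finiteDimensional_of_le inf_le_left
  have := FiniteDimensional.complete ℝ (V1Sub Ω K ⊓ h.dom.zeroSub : Submodule ℝ (H1 Ω))
  set w := P (E g) with hw
  obtain ⟨u, hu, hs⟩ := exists_energy_solution hql hq (V1Sub Ω K ⊓ h.dom.zeroSub)
    (fun u hu => hP u (h.dom.mem_mean0Sub.1 (h.dom.zeroSub_le hu.2)))
    (f - (innerSL ℝ (condMul hql hq (grad w))).comp (gradL Ω))
  refine Classical.epsilon_spec (p := IsDiscDirichletSol K P E f q g)
    ⟨w + u, ⟨?_, ?_⟩, ?_, fun ψ hψ => ?_⟩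
  · exact (V1Sub Ω K).add_mem hPE.1 hu.1
  · exact h.dom.mem_mean0Sub.1
      (h.dom.mean0Sub.add_mem (h.dom.mem_mean0Sub.2 hPE.2) (h.dom.zeroSub_le hu.2))
  · rw [h.dom.trace_add, h.dom.mem_zeroSub.1 hu.2, add_zero]
  · rw [energy_add_left hql hq, hs ψ ⟨hψ.1, h.dom.mem_zeroSub.2 hψ.2⟩,
      energy_eq_inner hql hq]
    change _ + (f ψ - inner ℝ (condMul hql hq (grad w)) (grad ψ)) = f ψ
    ring

end Existence

/-! ### Convergence of the discrete solutions -/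

section Convergence

variable {ql qu κ : ℝ} {q : Eu d → ℝ} {T : ℝ → Geometry.SimplicialComplex ℝ (Eu d)}
  {P : ℝ → H1 Ω →ₗ[ℝ] H1 Ω} {h : ℕ → ℝ} {qn : ℕ → Eu d → ℝ}

/-- The error against the interpolant of `u` is an admissible test function in both problems, and
subtraction leaves only the data term `⟨j_n - j, γ e⟩`. -/
theorem tendsto_discNeumann (hΩ : IsLipDomain Ω) (hM : ∀ h ∈ Ioo (0 : ℝ) 1, IsMesh Ω (T h) h κ)
    (hP : IsInterpolation Ω T P) (hh : ∀ n, h n ∈ Ioo (0 : ℝ) 1) (hh0 : Tendsto h atTop (𝓝 0))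
    (hql : 0 < ql) (hqu : 0 < qu) (hq : q ∈ Conductivities Ω ql qu)
    (hqn : ∀ n, qn n ∈ Conductivities Ω ql qu)
    (hlim : Tendsto (fun n => eLpNorm (qn n - q) 1 (volume.restrict Ω)) atTop (𝓝 0))
    (f : HNegOne Ω) {jn : ℕ → HHalf Ω →ₗ[ℝ] ℝ} {j : HHalf Ω →ₗ[ℝ] ℝ} (hjn : ∀ n, jn n ∈ HNegHalf Ω)
    (hj : j ∈ HNegHalf Ω) (hjl : Tendsto (fun n => normNegHalf (jn n - j)) atTop (𝓝 0)) :
    Tendsto (fun n => discNeumann (T (h n)) f (qn n) (jn n)) atTop (𝓝 (neumann f q j)) := by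
  have hK := hM _ (hh 0)
  -- The Poincaré constant concerns all of `H¹_⋄(Ω)`; one mesh serves to prove it, and the same `C`
  -- is used for every `n`.
  obtain ⟨C, hC, hPoin⟩ := hK.exists_norm_le_grad
  obtain ⟨hu1, hu2⟩ := isNeumannSol_neumann hK.toIsTri hql hq f hj
  have hun := fun n => isDiscNeumannSol_discNeumann (hM _ (hh n)).toIsTri hql (hqn n) f (hjn n)
  set u := neumann f q j
  set un := fun n => discNeumann (T (h n)) f (qn n) (jn n) with hundef
  have hv : Tendsto (fun n => P (h n) u) atTop (𝓝 u) :=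
    hP.tendsto hΩ hM hh hh0 hu1 tendsto_const_nhds
  have he : ∀ n, un n - P (h n) u ∈ V1Mean0 Ω (T (h n)) := fun n =>
    ⟨(V1Sub Ω _).sub_mem (hun n).1.1 (hP.range _ (hh n) u).1,
      hΩ.mem_mean0Sub.1 (hΩ.mean0Sub.sub_mem (hΩ.mem_mean0Sub.2 (hun n).1.2)
        (hΩ.mem_mean0Sub.2 (hP.range _ (hh n) u).2))⟩
  have hlim0 : Tendsto (fun n => un n - P (h n) u) atTop (𝓝 0) := by
    refine tendsto_zero_of_energy_eq hql hqu hq hqn hlim hC (fun n => hPoin _ (he n).2) hv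
      (fun n => normNegHalf_nonneg _) hjl fun n => ?_
    have h1 := (hun n).2 _ (he n)
    have h2 := hu2 _ (he n).2
    have h3 := hΩ.abs_trace_le (sub_mem_HNegHalf (hjn n) hj) (un n - P (h n) u)
    rw [LinearMap.sub_apply] at h3
    rw [energy_sub_left hql (hqn n), h1, h2]
    linarith [(abs_le.1 h3).2]
  have := hlim0.add hv
  rw [zero_add] at this
  exact this.congr fun n => sub_add_cancel _ _

/-- The error must have zero trace to be an admissible test function. It is therefore measured
against the interpolant of `u + r n`, whose trace before interpolation is exactly `g_n`. -/
theorem tendsto_discDirichlet (hΩ : IsLipDomain Ω) (hM : ∀ h ∈ Ioo (0 : ℝ) 1, IsMesh Ω (T h) h κ)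
    (hP : IsInterpolation Ω T P) (hh : ∀ n, h n ∈ Ioo (0 : ℝ) 1) (hh0 : Tendsto h atTop (𝓝 0))
    (hql : 0 < ql) (hqu : 0 < qu) (hq : q ∈ Conductivities Ω ql qu)
    (hqn : ∀ n, qn n ∈ Conductivities Ω ql qu)
    (hlim : Tendsto (fun n => eLpNorm (qn n - q) 1 (volume.restrict Ω)) atTop (𝓝 0))
    (f : HNegOne Ω) {E : HHalf Ω → H1 Ω} (hE : ∀ g, trace (E g) = g) {gn : ℕ → HHalf Ω}
    {g : HHalf Ω} (hgn : ∀ n, gn n ∈ HHalfMean0 Ω)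
    (hgl : Tendsto (fun n => normHalf (gn n - g)) atTop (𝓝 0)) :
    Tendsto (fun n => discDirichlet (T (h n)) (P (h n)) E f (qn n) (gn n)) atTop
      (𝓝 (dirichlet f q g)) := by
  have hK := hM _ (hh 0)
  obtain ⟨C, hC, hPoin⟩ := hK.exists_norm_le_grad
  obtain ⟨hu1, hu2⟩ := isDirichletSol_dirichlet hK.toIsTri hql hq f g
  have hun := fun n => isDiscDirichletSol_discDirichlet (hM _ (hh n)).toIsTri hql (hqn n) f
    (hP.range _ (hh n) (E (gn n)))
  set u := dirichlet f q g
  set un := fun n => discDirichlet (T (h n)) (P (h n)) E f (qn n) (gn n) with hundef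
  choose r hr hrn using fun n : ℕ => hΩ.exists_extension (gn n - g) (ε := 1 / ((n : ℝ) + 1))
    Nat.one_div_pos_of_nat
  have hr0 : Tendsto r atTop (𝓝 0) := by
    refine squeeze_zero_norm (fun n => (hrn n).le) ?_
    simpa using hgl.add tendsto_one_div_add_atTop_nhds_zero_nat
  have hw : Tendsto (fun n => u + r n) atTop (𝓝 u) := by
    simpa using tendsto_const_nhds.add hr0
  have hwt : ∀ n, trace (u + r n) = gn n := fun n => by
    rw [hΩ.trace_add, hu1, hr, add_sub_cancel]
  have hwm : ∀ n, u + r n ∈ H1Mean0 Ω := fun n => by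
    change trace (u + r n) ∈ HHalfMean0 Ω
    rw [hwt n]
    exact hgn n
  -- The limit datum inherits zero mean from the `g_n`, by continuity of the boundary mean in `H¹`.
  have hum : u ∈ H1Mean0 Ω := by
    rw [hΩ.mem_H1Mean0_iff]
    have h1 : Tendsto (fun n => hΩ.bdMean (u + r n)) atTop (𝓝 (hΩ.bdMean u)) :=
      (hΩ.bdMean.continuous.tendsto u).comp hw
    refine tendsto_nhds_unique h1 (tendsto_const_nhds.congr fun n => ?_)
    exact (hΩ.mem_H1Mean0_iff.1 (hwm n)).symm
  have hv : Tendsto (fun n => P (h n) (u + r n)) atTop (𝓝 u) := hP.tendsto hΩ hM hh hh0 hum hw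
  -- The two functions have the same trace, and interpolation preserves zero traces; hence no
  -- property of `E` other than being a right inverse matters.
  have hPt : ∀ n, trace (P (h n) (E (gn n))) = trace (P (h n) (u + r n)) := fun n => by
    have h1 : E (gn n) - (u + r n) ∈ hΩ.zeroSub := by
      rw [hΩ.sub_mem_zeroSub, hE, hwt]
    have h2 := (hP.zero _ (hh n) _ (hΩ.mem_zeroSub.1 h1)).2
    rw [map_sub, ← hΩ.mem_zeroSub, hΩ.sub_mem_zeroSub] at h2
    exact h2
  have he : ∀ n, un n - P (h n) (u + r n) ∈ V1Zero Ω (T (h n)) := fun n =>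
    ⟨(V1Sub Ω _).sub_mem (hun n).1.1 (hP.range _ (hh n) _).1, hΩ.mem_zeroSub.1 (by
      rw [hΩ.sub_mem_zeroSub, ← hPt]
      exact (hun n).2.1)⟩
  have hlim0 : Tendsto (fun n => un n - P (h n) (u + r n)) atTop (𝓝 0) := by
    refine tendsto_zero_of_energy_eq hql hqu hq hqn hlim hC (fun n => hPoin _ ?_) hv
      (a := fun _ => 0) (fun _ => le_rfl) tendsto_const_nhds fun n => ?_
    · exact hΩ.mem_mean0Sub.1 (hΩ.zeroSub_le (hΩ.mem_zeroSub.2 (he n).2))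
    · have h1 := (hun n).2.2 _ (he n)
      have h2 := hu2 _ (he n).2
      rw [energy_sub_left hql (hqn n), h1, h2, zero_mul, zero_add]
  have := hlim0.add hv
  rw [zero_add] at this
  exact this.congr fun n => sub_add_cancel _ _

end Convergence

end EIT

end

/-! ### The convergence theorem -/

theorem lemma3p3 (d : ℕ) (hd : d = 2 ∨ d = 3) (Ω : Set (EIT.Eu d)) (hΩo : IsOpen Ω)
    (hΩb : Bornology.IsBounded Ω) (hΩc : IsConnected Ω) (hΩl : EIT.HasLipschitzBoundary Ω)
    (ql qu : ℝ) (hql : 0 < ql) (hqu : 0 < qu) (f : EIT.HNegOne Ω)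
    (T : ℝ → Geometry.SimplicialComplex ℝ (EIT.Eu d))
    (hT : ∀ h ∈ Ioo (0 : ℝ) 1, EIT.IsTriangulation Ω (T h))
    (hTr : EIT.IsRegularFamily T) (hTq : EIT.IsQuasiUniformFamily T) :
    (∃ P : ℝ → EIT.H1 Ω →ₗ[ℝ] EIT.H1 Ω, EIT.IsInterpolation Ω T P) ∧
    ∀ P : ℝ → EIT.H1 Ω →ₗ[ℝ] EIT.H1 Ω, EIT.IsInterpolation Ω T P →
    ∀ E : EIT.HHalf Ω → EIT.H1 Ω, (∀ g, EIT.trace (E g) = g) →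
    ∀ h : ℕ → ℝ, (∀ n, h n ∈ Ioo (0 : ℝ) 1) → Tendsto h atTop (𝓝 0) →
    ∀ (jn : ℕ → EIT.HHalf Ω →ₗ[ℝ] ℝ) (gn : ℕ → EIT.HHalf Ω)
      (j : EIT.HHalf Ω →ₗ[ℝ] ℝ) (g : EIT.HHalf Ω),
      (∀ n, jn n ∈ EIT.HNegHalfCompat f) → (∀ n, gn n ∈ EIT.HHalfMean0 Ω) →
      j ∈ EIT.HNegHalf Ω →
      Tendsto (fun n => EIT.normNegHalf (jn n - j)) atTop (𝓝 0) →
      Tendsto (fun n => EIT.normHalf (gn n - g)) atTop (𝓝 0) →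
    ∀ q ∈ EIT.Conductivities Ω ql qu,
      Tendsto (fun n => EIT.discCostJ (T (h n)) (P (h n)) E f (jn n) (gn n) q) atTop
        (𝓝 (EIT.costJ f j g q)) ∧
      ∀ qn : ℕ → EIT.Eu d → ℝ, (∀ n, qn n ∈ EIT.Conductivities Ω ql qu) →
        Tendsto (fun n => eLpNorm (qn n - q) 1 (volume.restrict Ω)) atTop (𝓝 0) →
        Tendsto (fun n => (EIT.discNeumann (T (h n)) f (qn n) (jn n),
            EIT.discDirichlet (T (h n)) (P (h n)) E f (qn n) (gn n))) atTop
          (𝓝 (EIT.neumann f q j, EIT.dirichlet f q g)) ∧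
        Tendsto (fun n => EIT.discCostJ (T (h n)) (P (h n)) E f (jn n) (gn n) (qn n)) atTop
          (𝓝 (EIT.costJ f j g q)) := by

  have hΩ : EIT.IsLipDomain Ω := ⟨by omega, hΩo, hΩb, hΩl, hΩc⟩
  obtain ⟨κ, hM⟩ := EIT.exists_isMesh hΩ hT hTr hTq
  refine ⟨EIT.exists_isInterpolation hΩ hM, ?_⟩
  intro P hP E hE h hh hh0 jn gn j g hjn hgn hj hjl hgl q hq
  have main : ∀ qn : ℕ → EIT.Eu d → ℝ, (∀ n, qn n ∈ EIT.Conductivities Ω ql qu) →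
      Tendsto (fun n => eLpNorm (qn n - q) 1 (volume.restrict Ω)) atTop (𝓝 0) →
      Tendsto (fun n => (EIT.discNeumann (T (h n)) f (qn n) (jn n),
          EIT.discDirichlet (T (h n)) (P (h n)) E f (qn n) (gn n))) atTop
        (𝓝 (EIT.neumann f q j, EIT.dirichlet f q g)) ∧
      Tendsto (fun n => EIT.discCostJ (T (h n)) (P (h n)) E f (jn n) (gn n) (qn n)) atTop
        (𝓝 (EIT.costJ f j g q)) := by
    intro qn hqn hlim
    have hN := EIT.tendsto_discNeumann hΩ hM hP hh hh0 hql hqu hq hqn hlim f (fun n => (hjn n).1) hj hjl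
    have hD := EIT.tendsto_discDirichlet hΩ hM hP hh hh0 hql hqu hq hqn hlim f hE hgn hgl
    exact ⟨hN.prodMk_nhds hD, EIT.tendsto_energy hql hqu hq hqn hlim (hN.sub hD)⟩
  -- Convergence for a fixed conductivity is the case of the constant sequence.
  refine ⟨(main (fun _ => q) (fun _ => hq) ?_).2, main⟩
  simp
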